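/- Let $\delta\in\{1,-1\}$. Let $\mathfrak A=\mathfrak A^{\delta}$ be the commutative algebra of all complex matrices $\begin{pmatrix} a&\delta b\\ b&a\end{pmatrix}$, which we write as pairs $(a,b)$; $\overline{\,\cdot\,}$ denotes entrywise complex conjugation and $\operatorname{Re}$ the entrywise real part. Write a point $(z_1,z_2,w_1,w_2)\in\mathbb C^4$ as $(Z,W)\in\mathfrak A\times\mathfrak A$ with $Z=(z_1,z_2)$, $W=U+iV=(w_1,w_2)$, $U$ and $V$ real. Let $$Q_H=\{V=Z\overline Z\}=\{\operatorname{Im}w_1=|z_1|^2+\delta|z_2|^2,\ \operatorname{Im}w_2=z_1\overline{z_2}+z_2\overline{z_1}\},$$ with the complex tangent spaces $T^c$ cut out by $\hat\theta=0$, where $\hat\theta=\tfrac12(dU-i\overline Z\,dZ+iZ\,d\overline Z)$. *The bundles.* Let $P^1$ be the bundle over $Q_H$ whose points over $p$ are the forms $D\hat\theta_p$ with $D=C\overline C$ for some invertible $C\in\mathfrak A$, and let $\theta=(\theta^1,\theta^2)$ be its tautological form. Let $P^2$ be the bundle over $P^1$ whose points over $y\in P^1$ are the coframes $(\theta,\operatorname{Re}\tilde\omega,\operatorname{Im}\tilde\omega,\tilde\phi)$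 at $y$, where $\tilde\omega=(\tilde\omega^1,\tilde\omega^2)$ is the pullback of two complex covectors on $Q_H$ that are complex linear on $T^c$, $\tilde\phi=(\tilde\phi^1,\tilde\phi^2)$ is real, and, for some $r_1,r_2\in\mathbb C$, at $y$ $$d\theta^1=i(\tilde\omega^1\wedge\overline{\tilde\omega^1}+\delta\tilde\omega^2\wedge\overline{\tilde\omega^2})+\theta^1\wedge\tilde\phi^1+\delta\theta^2\wedge\tilde\phi^2,$$ $$d\theta^2=i(\tilde\omega^1\wedge\overline{\tilde\omega^2}+\tilde\omega^2\wedge\overline{\tilde\omega^1})+\theta^1\wedge\tilde\phi^2+\theta^2\wedge\tilde\phi^1+2\theta^1\wedge\operatorname{Re}(\delta r_1\tilde\omega^1+r_2\tilde\omega^2)+2\theta^2\wedge\operatorname{Re}(r_2\tilde\omega^1+r_1\tilde\omega^2).$$ Then $P^2$ is a 16-dimensional manifold, and it carries the tautological $\mathfrak A$-valued forms $\theta,\omega,\phi$. *The parallelism.* Let $\kappa,\mu,\psi$ be the smooth $\mathfrak A$-valued 1-forms on $P^2$ determined by $$d\omega=\omega\wedge\kappa+\theta\wedge\mu,\qquad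 \operatorname{Re}\kappa=\tfrac12\phi,\qquad d\phi=2\operatorname{Re}(i\mu\wedge\overline\omega)+\theta\wedge\psi,\qquad\psi=\overline\psi,$$ together with the following normalisation: in the expansions with respect to the coframe given by $\theta,\omega,\overline\omega,\phi,\operatorname{Im}\kappa,\mu,\overline\mu,\psi$ of the curvature components $$\tfrac23d\kappa-\tfrac13d\phi+i\overline\mu\wedge\omega+i\mu\wedge\overline\omega,\qquad \tfrac12\bigl(d\mu+\mu\wedge\overline\kappa+\tfrac12\psi\wedge\omega\bigr),\qquad -\tfrac14\bigl(d\psi-2i\mu\wedge\overline\mu+\psi\wedge\phi\bigr),$$ the coefficient of $\omega^1\wedge\overline{\omega^1}$ in the first entry and the coefficient of $\omega^2\wedge\overline{\omega^2}$ in the second entry are zero. *$G$-chains.* The chain distribution on $P^2$ is $\{\omega=0,\ \mu=0\}$, of rank $8$. A *$G$-chain* on $Q_H$ is the projection to $Q_H$ of a maximal connected integral manifold of the chain distribution. **Proposition 3.4.** For every $G$-chain $\Gamma$ on $Q_H$ that passes through the origin there is $A\in\mathfrak A^{\delta}$ such that $$\Gamma=Q_H\cap\{(Z,W): Z=AW\}.$$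 -/

import Mathlib

open scoped ContDiff Manifold

noncomputable section

namespace CRQuadric

/-! ### The algebra of matrices `!![a, δ b; b, a]` -/

/-- An element `!![a, δ b; b, a]` of the algebra is stored through its two entries `(a, b)`.
The same pairs are the points of `ℂ²`, as `z = (z₁, z₂)` is identified with `!![z₁, δ z₂; z₂, z₁]`. -/
abbrev A : Type := ℂ × ℂ

/-- Two real numbers `(a, b)`, standing for the real matrix `!![a, δ b; b, a]`. -/
abbrev ReA : Type := ℝ × ℝ

/-- The matrix with the entries `(a, b)`. -/
def mat (δ : ℝ) (a : A) : Matrix (Fin 2) (Fin 2) ℂ := !![a.1, δ * a.2; a.2, a.1]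

/-- The commutative algebra of all complex matrices `!![a, δ b; b, a]`. -/
def algebraA (δ : ℝ) : Set (Matrix (Fin 2) (Fin 2) ℂ) :=
  {M | ∃ a b : ℂ, M = !![a, δ * b; b, a]}

/-- The matrix product, in entries. -/
def mul (δ : ℝ) (a b : A) : A := (a.1 * b.1 + δ * (a.2 * b.2), a.1 * b.2 + a.2 * b.1)

/-- Entrywise complex conjugation. -/
def conj (a : A) : A := (starRingEnd ℂ a.1, starRingEnd ℂ a.2)

/-- The inclusion of the real matrices. -/
def ofRe (u : ReA) : A := ((u.1 : ℂ), (u.2 : ℂ))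

/-- The determinant `a² - δ b²`; the matrix is invertible if and only if it is nonzero. -/
def det (δ : ℝ) (a : A) : ℂ := a.1 ^ 2 - δ * a.2 ^ 2

/-- The inverse matrix (for a nonzero determinant). -/
def inv (δ : ℝ) (a : A) : A := (a.1 / det δ a, -a.2 / det δ a)

/-- The real matrix `C * conj C`. -/
def normSq (δ : ℝ) (C : A) : ReA :=
  (Complex.normSq C.1 + δ * Complex.normSq C.2, 2 * (C.1 * starRingEnd ℂ C.2).re)

theorem mat_mul (δ : ℝ) (a b : A) : mat δ (mul δ a b) = mat δ a * mat δ b := by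
  ext i j
  fin_cases i <;> fin_cases j <;> simp [mat, mul, Matrix.mul_apply, Fin.sum_univ_two] <;> ring

theorem mat_conj (δ : ℝ) (a : A) : mat δ (conj a) = (mat δ a).map (starRingEnd ℂ) := by
  ext i j
  fin_cases i <;> fin_cases j <;> simp [mat, conj]

theorem mul_inv (δ : ℝ) (a : A) (ha : det δ a ≠ 0) : mul δ a (inv δ a) = (1, 0) := by
  ext1
  · simp only [mul, inv]
    field_simp
    simp only [det]
    ring
  · simp only [mul, inv]
    field_simp
    ring

theorem ofRe_normSq (δ : ℝ) (C : A) : ofRe (normSq δ C) = mul δ C (conj C) := by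
  ext1
  · simp [ofRe, normSq, mul, conj, Complex.mul_conj]
  · apply Complex.ext <;> simp [ofRe, normSq, mul, conj] <;> ring

/-- Multiplication by a fixed matrix, as a real-linear map. -/
def mulL (δ : ℝ) (a : A) : A →L[ℝ] A :=
  LinearMap.toContinuousLinearMap
    { toFun := fun b => mul δ a b
      map_add' := fun b c => by ext1 <;> simp [mul] <;> ring
      map_smul' := fun r b => by ext1 <;> simp [mul] <;> ring }

/-- Conjugation as a real-linear map. -/
def conjL : A →L[ℝ] A :=
  LinearMap.toContinuousLinearMap
    { toFun := conj
      map_add' := fun b c => by ext1 <;> simp [conj]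
      map_smul' := fun r b => by ext1 <;> simp [conj] }

/-- The inclusion of the real matrices as a real-linear map. -/
def ofReL : ReA →L[ℝ] A :=
  LinearMap.toContinuousLinearMap
    { toFun := ofRe
      map_add' := fun b c => by ext1 <;> simp [ofRe]
      map_smul' := fun r b => by ext1 <;> simp [ofRe] }

@[simp] theorem mulL_apply (δ : ℝ) (a b : A) : mulL δ a b = mul δ a b := rfl
@[simp] theorem conjL_apply (a : A) : conjL a = conj a := rfl
@[simp] theorem ofReL_apply (u : ReA) : ofReL u = ofRe u := rfl

/-! ### Differential forms with values in the algebra -/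

section Forms

variable {V : Type} [NormedAddCommGroup V] [NormedSpace ℝ V]

/-- The exterior derivative of a 1-form. -/
def extd (α : V → V →L[ℝ] A) (x X Y : V) : A := fderiv ℝ α x X Y - fderiv ℝ α x Y X

/-- The wedge product of two covectors with values in the algebra. -/
def wedge (δ : ℝ) (α β : V →L[ℝ] A) (X Y : V) : A := mul δ (α X) (β Y) - mul δ (α Y) (β X)

/-- The wedge product of two complex-valued functions on tangent vectors. -/
def wedgeC (α β : V → ℂ) (X Y : V) : ℂ := α X * β Y - α Y * β X

/-- The conjugate covector. -/
def bar (α : V →L[ℝ] A) : V →L[ℝ] A := conjL.comp α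

end Forms

/-! ### The quadric -/

/-- The quadric `Im w = H(z, z)` in `ℂ² × ℂ²`, where
`H(z, z) = (|z₁|² + δ |z₂|², z₁ conj z₂ + z₂ conj z₁)`. -/
def quadric (δ : ℝ) : Set (A × A) :=
  {p | ((p.2.1.im : ℂ) = p.1.1 * starRingEnd ℂ p.1.1 + δ * (p.1.2 * starRingEnd ℂ p.1.2)) ∧
    ((p.2.2.im : ℂ) = p.1.1 * starRingEnd ℂ p.1.2 + p.1.2 * starRingEnd ℂ p.1.1)}

/-- Coordinates `(z, u)` on the quadric, `u = Re w`. -/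
abbrev Base : Type := A × ReA

/-- The global parametrisation `(z, u) ↦ (z, u + i z conj z)` of the quadric. -/
def embed (δ : ℝ) (p : Base) : A × A :=
  (p.1, ofRe p.2 + Complex.I • mul δ p.1 (conj p.1))

theorem embed_bijOn (δ : ℝ) : Set.BijOn (embed δ) Set.univ (quadric δ) := by
  refine ⟨fun p _ => ?_, fun p _ q _ h => ?_, fun p hp => ?_⟩
  · constructor
    · apply Complex.ext <;> simp [embed, mul, conj, ofRe] <;> ring
    · apply Complex.ext <;> simp [embed, mul, conj, ofRe] <;> ring
  · obtain ⟨z, u⟩ := p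
    obtain ⟨z', u'⟩ := q
    simp only [embed, Prod.mk.injEq] at h
    obtain ⟨rfl, h⟩ := h
    have h := add_right_cancel h
    simp only [ofRe, Prod.mk.injEq, Complex.ofReal_inj] at h
    exact Prod.ext rfl (Prod.ext h.1 h.2)
  · obtain ⟨h1, h2⟩ := hp
    refine ⟨(p.1, (p.2.1.re, p.2.2.re)), trivial, ?_⟩
    ext1
    · rfl
    · ext1
      · simp only [embed, mul, conj, ofRe, Prod.fst_add, Prod.smul_fst, ← h1, smul_eq_mul]
        rw [mul_comm]; exact Complex.re_add_im _
      · simp only [embed, mul, conj, ofRe, Prod.snd_add, Prod.smul_snd, ← h2, smul_eq_mul]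
        rw [mul_comm]; exact Complex.re_add_im _

/-- The contact form `θ = ½ (dU - i conj Z dZ + i Z d conj Z)` of the quadric, in the coordinates
`(z, u)`.  Its entries are real, and their common kernel is the complex tangent space. -/
def theta0 (δ : ℝ) (p : Base) : Base →L[ℝ] A :=
  (1 / 2 : ℝ) • (ofReL.comp (ContinuousLinearMap.snd ℝ A ReA)
    - (mulL δ (Complex.I • conj p.1)).comp (ContinuousLinearMap.fst ℝ A ReA)
    + (mulL δ (Complex.I • p.1)).comp (conjL.comp (ContinuousLinearMap.fst ℝ A ReA)))

/-- `J v = v'` for tangent vectors `v`, `v'` of the quadric: multiplication by `i` in `ℂ² × ℂ²` takes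
`v` to `v'`.  So both lie in the complex tangent space at `p`. -/
def IsJ (δ : ℝ) (p v v' : Base) : Prop :=
  fderiv ℝ (embed δ) p v' = Complex.I • fderiv ℝ (embed δ) p v

/-! ### The first bundle -/

/-- Coordinates on the first bundle: `(p, D)` stands for the value at `p` of the pair of forms `D θ`. -/
abbrev Tot1 : Type := Base × ReA

/-- The first bundle: `D = C conj C` with `C` invertible. -/
def P1 (δ : ℝ) : Set Tot1 := {y | ∃ C : A, det δ C ≠ 0 ∧ y.2 = normSq δ C}

/-- The tautological form on the first bundle. -/
def thetaTaut (δ : ℝ) (y : Tot1) : Tot1 →L[ℝ] A :=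
  (mulL δ (ofRe y.2)).comp ((theta0 δ y.1).comp (ContinuousLinearMap.fst ℝ Base ReA))

/-! ### The second bundle -/

/-- Candidates `(y, ω, φ)` for points of the second bundle: a point `y = (p, D)` of the first bundle,
two complex covectors `ω = (ω¹, ω²)` at `p`, two covectors `φ = (φ¹, φ²)` at `y`. -/
abbrev Frame : Type := Tot1 × (Base →L[ℝ] A) × (Tot1 →L[ℝ] A)

/-- The pullback of `ω` to the first bundle. -/
def Frame.omega (f : Frame) : Tot1 →L[ℝ] A := f.2.1.comp (ContinuousLinearMap.fst ℝ Base ReA)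

/-- The fibre of the second bundle over `y` consists of the coframes `(θ, Re ω, Im ω, φ)` at `y` with
`θ` the tautological form, `ω` complex linear on the complex tangent space, `φ` real, and, for some
`r = (r₁, r₂)`,
`dθ¹ = i (ω¹ ∧ conj ω¹ + δ ω² ∧ conj ω²) + θ¹ ∧ φ¹ + δ θ² ∧ φ²`,
`dθ² = i (ω¹ ∧ conj ω² + ω² ∧ conj ω¹) + θ¹ ∧ φ² + θ² ∧ φ¹
  + 2 θ¹ ∧ Re (δ r₁ ω¹ + r₂ ω²) + 2 θ² ∧ Re (r₂ ω¹ + r₁ ω²)`. -/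
def P2 (δ : ℝ) : Set Frame :=
  {f | f.1 ∈ P1 δ ∧
    (∀ v v', IsJ δ f.1.1 v v' → f.2.1 v' = Complex.I • f.2.1 v) ∧
    (∀ X, conj (f.2.2 X) = f.2.2 X) ∧
    (∀ X, thetaTaut δ f.1 X = 0 → f.omega X = 0 → f.2.2 X = 0 → X = 0) ∧
    ∃ r : A, ∀ X Y, extd (thetaTaut δ) f.1 X Y =
      Complex.I • wedge δ f.omega (bar f.omega) X Y + wedge δ (thetaTaut δ f.1) f.2.2 X Y
      + (0,
          2 * wedgeC (fun X => (thetaTaut δ f.1 X).1)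
            (fun X => ((δ * r.1 * (f.omega X).1 + r.2 * (f.omega X).2).re : ℂ)) X Y
          + 2 * wedgeC (fun X => (thetaTaut δ f.1 X).2)
            (fun X => ((r.2 * (f.omega X).1 + r.1 * (f.omega X).2).re : ℂ)) X Y)}

/-- Coordinates `((z, u), K, T, S)` on the second bundle. -/
abbrev Tot2 : Type := Base × A × A × ReA

/-- The coordinate domain: `K` is invertible. -/
def dom (δ : ℝ) : Set Tot2 := {x | det δ x.2.1 ≠ 0}

/-- The projection to the first bundle, in coordinates: `D = K conj K`. -/
def toP1 (δ : ℝ) (x : Tot2) : Tot1 := (x.1, normSq δ x.2.1)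

/-- The coframe with the coordinates `((z, u), K, T, S)`: with `D = K conj K`,
`ω = T θ + K dZ` and `φ = S θ + i K conj T dZ - i T conj K d conj Z - D⁻¹ dD`. -/
def frame (δ : ℝ) (x : Tot2) : Frame :=
  (toP1 δ x,
    (mulL δ (mul δ x.2.2.1 (ofRe (normSq δ x.2.1)))).comp (theta0 δ x.1)
      + (mulL δ x.2.1).comp (ContinuousLinearMap.fst ℝ A ReA),
    (mulL δ (ofRe x.2.2.2)).comp (thetaTaut δ (toP1 δ x))
      + (mulL δ (Complex.I • mul δ x.2.1 (conj x.2.2.1))).comp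
          ((ContinuousLinearMap.fst ℝ A ReA).comp (ContinuousLinearMap.fst ℝ Base ReA))
      - (mulL δ (Complex.I • mul δ x.2.2.1 (conj x.2.1))).comp
          (conjL.comp ((ContinuousLinearMap.fst ℝ A ReA).comp (ContinuousLinearMap.fst ℝ Base ReA)))
      - (mulL δ (inv δ (ofRe (normSq δ x.2.1)))).comp
          (ofReL.comp (ContinuousLinearMap.snd ℝ Base ReA)))

/-! #### The coordinates are a global chart of the second bundle -/

section Chart

theorem mul_left_cancel (δ : ℝ) (a b c : A) (ha : det δ a ≠ 0) (h : mul δ a b = mul δ a c) :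
    b = c := by
  simp only [mul, Prod.mk.injEq] at h
  obtain ⟨h1, h2⟩ := h
  have e1 : det δ a * (b.1 - c.1) = 0 := by
    simp only [det]; linear_combination a.1 * h1 - δ * a.2 * h2
  have e2 : det δ a * (b.2 - c.2) = 0 := by
    simp only [det]; linear_combination a.1 * h2 - a.2 * h1
  ext1
  · exact sub_eq_zero.1 ((mul_eq_zero.1 e1).resolve_left ha)
  · exact sub_eq_zero.1 ((mul_eq_zero.1 e2).resolve_left ha)

theorem det_normSq (δ : ℝ) (C : A) :
    det δ (ofRe (normSq δ C)) = det δ C * starRingEnd ℂ (det δ C) := by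
  rw [ofRe_normSq]
  simp [det, mul, conj]
  ring

theorem det_normSq_ne (δ : ℝ) (C : A) (h : det δ C ≠ 0) : det δ (ofRe (normSq δ C)) ≠ 0 := by
  rw [det_normSq]
  exact mul_ne_zero h ((map_ne_zero _).2 h)

theorem fderiv_of_cubic {V W : Type} [NormedAddCommGroup V] [NormedSpace ℝ V]
    [NormedAddCommGroup W] [NormedSpace ℝ W] (f : V → W) (y X : V) (b c e : W)
    (hf : DifferentiableAt ℝ f y)
    (h : ∀ t : ℝ, f (y + t • X) = f y + t • b + t ^ 2 • c + t ^ 3 • e) :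
    fderiv ℝ f y X = b := by
  have h1 := hf.hasFDerivAt.hasLineDerivAt X
  have h2 : HasDerivAt (fun t : ℝ => f (y + t • X)) b 0 := by
    have : (fun t : ℝ => f (y + t • X)) = fun t => f y + t • b + t ^ 2 • c + t ^ 3 • e :=
      funext h
    rw [this]
    have h3 := ((((hasDerivAt_id (0 : ℝ)).smul_const b).const_add (f y)).add
      (((hasDerivAt_id (0 : ℝ)).pow 2).smul_const c)).add
      (((hasDerivAt_id (0 : ℝ)).pow 3).smul_const e)
    have h4 := h3
    simp only [id, Nat.cast_ofNat, mul_one, one_smul, zero_smul, ne_eq, OfNat.ofNat_ne_zero,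
      not_false_eq_true, zero_pow, mul_zero, add_zero, Nat.add_one_sub_one, pow_one] at h4
    exact h4
  exact HasDerivAt.unique h1 h2

theorem contDiff_mul {V : Type} [NormedAddCommGroup V] [NormedSpace ℝ V] (δ : ℝ) {f g : V → A}
    (hf : ContDiff ℝ ∞ f) (hg : ContDiff ℝ ∞ g) : ContDiff ℝ ∞ fun x => mul δ (f x) (g x) := by
  unfold mul
  fun_prop

theorem theta0_apply (δ : ℝ) (p v : Base) : theta0 δ p v = (1 / 2 : ℝ) •
    (ofRe v.2 - mul δ (Complex.I • conj p.1) v.1 + mul δ (Complex.I • p.1) (conj v.1)) := rfl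

theorem thetaTaut_apply (δ : ℝ) (y X : Tot1) :
    thetaTaut δ y X = mul δ (ofRe y.2) (theta0 δ y.1 X.1) := rfl

theorem contDiff_thetaTaut (δ : ℝ) : ContDiff ℝ ∞ (thetaTaut δ) := by
  rw [contDiff_clm_apply_iff]
  intro Y
  simp only [thetaTaut_apply, theta0_apply]
  simp only [← ofReL_apply, ← conjL_apply]
  refine contDiff_mul δ (by fun_prop) ?_
  refine ContDiff.const_smul (1 / 2 : ℝ) ?_
  refine (contDiff_const.sub (contDiff_mul δ (by fun_prop) (by fun_prop))).add
    (contDiff_mul δ (by fun_prop) (by fun_prop))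

theorem extd_thetaTaut (δ : ℝ) (y X Y : Tot1) : extd (thetaTaut δ) y X Y =
    mul δ (ofRe X.2) (theta0 δ y.1 Y.1) - mul δ (ofRe Y.2) (theta0 δ y.1 X.1)
      + mul δ (ofRe y.2) (Complex.I • (mul δ X.1.1 (conj Y.1.1) - mul δ Y.1.1 (conj X.1.1))) := by
  have hd : DifferentiableAt ℝ (thetaTaut δ) y :=
    (contDiff_thetaTaut δ).contDiffAt.differentiableAt (by simp)
  have key : ∀ X Y : Tot1, fderiv ℝ (thetaTaut δ) y X Y =
      mul δ (ofRe X.2) (theta0 δ y.1 Y.1) + (1 / 2 : ℝ) • mul δ (ofRe y.2)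
        (mul δ (Complex.I • X.1.1) (conj Y.1.1) - mul δ (Complex.I • conj X.1.1) Y.1.1) := by
    intro X Y
    have h1 : fderiv ℝ (fun y => thetaTaut δ y Y) y X = fderiv ℝ (thetaTaut δ) y X Y := by
      rw [fderiv_clm_apply hd (differentiableAt_const _)]
      simp
    rw [← h1]
    refine fderiv_of_cubic _ y X _ ((1 / 2 : ℝ) • mul δ (ofRe X.2)
        (mul δ (Complex.I • X.1.1) (conj Y.1.1) - mul δ (Complex.I • conj X.1.1) Y.1.1)) 0
        (hd.clm_apply (differentiableAt_const _)) ?_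
    intro t
    simp only [thetaTaut_apply, theta0_apply]
    ext1 <;> simp [mul, conj, ofRe] <;> ring
  simp only [extd, key]
  ext1 <;> simp [mul, conj, ofRe, theta0_apply] <;> ring

theorem contDiff_embed (δ : ℝ) : ContDiff ℝ ∞ (embed δ) := by
  unfold embed
  simp only [← ofReL_apply, ← conjL_apply]
  have := contDiff_mul (V := Base) δ (f := fun p => p.1) (g := fun p => conjL p.1) (by fun_prop)
    (by fun_prop)
  fun_prop

theorem fderiv_embed (δ : ℝ) (p v : Base) : fderiv ℝ (embed δ) p v =
    (v.1, ofRe v.2 + Complex.I • (mul δ v.1 (conj p.1) + mul δ p.1 (conj v.1))) := by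
  refine fderiv_of_cubic _ p v _ (0, Complex.I • mul δ v.1 (conj v.1)) 0
    ((contDiff_embed δ).contDiffAt.differentiableAt (by simp)) ?_
  intro t
  simp only [embed]
  ext1
  · simp
  · ext1 <;> simp [mul, conj, ofRe] <;> ring

/-- The vector of the complex tangent space with the given `z`-part. -/
def lift (δ : ℝ) (z dz : A) : Base :=
  (dz, (-2 * (starRingEnd ℂ z.1 * dz.1 + δ * (starRingEnd ℂ z.2 * dz.2)).im,
    -2 * (starRingEnd ℂ z.1 * dz.2 + starRingEnd ℂ z.2 * dz.1).im))

theorem theta0_eq (δ : ℝ) (p v : Base) : theta0 δ p v = ofRe (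
    v.2.1 / 2 + (starRingEnd ℂ p.1.1 * v.1.1 + δ * (starRingEnd ℂ p.1.2 * v.1.2)).im,
    v.2.2 / 2 + (starRingEnd ℂ p.1.1 * v.1.2 + starRingEnd ℂ p.1.2 * v.1.1).im) := by
  rw [theta0_apply]
  ext1 <;> apply Complex.ext <;> simp [mul, conj, ofRe] <;> ring

theorem theta0_lift (δ : ℝ) (p : Base) (dz : A) : theta0 δ p (lift δ p.1 dz) = 0 := by
  rw [theta0_eq]
  simp only [lift, ofRe]
  ext1 <;> apply Complex.ext <;> simp <;> ring

theorem isJ_lift (δ : ℝ) (p : Base) (dz : A) :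
    IsJ δ p (lift δ p.1 dz) (lift δ p.1 (Complex.I • dz)) := by
  rw [IsJ, fderiv_embed, fderiv_embed]
  ext1
  · rfl
  · ext1 <;> apply Complex.ext <;> simp [lift, mul, conj, ofRe] <;> ring

theorem isJ_iff (δ : ℝ) (p v v' : Base) (h : IsJ δ p v v') :
    v'.1 = Complex.I • v.1 ∧ theta0 δ p v = 0 ∧ theta0 δ p v' = 0 := by
  rw [IsJ, fderiv_embed, fderiv_embed] at h
  have h1 : v'.1 = Complex.I • v.1 := congrArg Prod.fst h
  have h2 := congrArg Prod.snd h
  refine ⟨h1, ?_, ?_⟩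
  · rw [theta0_eq]
    have a := congrArg (fun q : A => q.1.im) h2
    have b := congrArg (fun q : A => q.2.im) h2
    simp [mul, conj, ofRe, h1] at a b
    ext1 <;> apply Complex.ext <;> simp [ofRe] <;> linarith
  · rw [theta0_eq]
    have a := congrArg (fun q : A => q.1.re) h2
    have b := congrArg (fun q : A => q.2.re) h2
    simp [mul, conj, ofRe, h1] at a b
    ext1 <;> apply Complex.ext <;> simp [ofRe, h1] <;> linarith

theorem toP1_fst (δ : ℝ) (x : Tot2) : (frame δ x).1 = toP1 δ x := rfl

theorem frame_omega (δ : ℝ) (x : Tot2) (v : Base) : (frame δ x).2.1 v =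
    mul δ (mul δ x.2.2.1 (ofRe (normSq δ x.2.1))) (theta0 δ x.1 v) + mul δ x.2.1 v.1 := rfl

theorem frame_phi (δ : ℝ) (x : Tot2) (X : Tot1) : (frame δ x).2.2 X =
    mul δ (ofRe x.2.2.2) (thetaTaut δ (toP1 δ x) X)
      + mul δ (Complex.I • mul δ x.2.1 (conj x.2.2.1)) X.1.1
      - mul δ (Complex.I • mul δ x.2.2.1 (conj x.2.1)) (conj X.1.1)
      - mul δ (inv δ (ofRe (normSq δ x.2.1))) (ofRe X.2) := rfl


theorem conj_thetaTaut (δ : ℝ) (y X : Tot1) : conj (thetaTaut δ y X) = thetaTaut δ y X := by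
  have h : ∀ a b : ReA, conj (mul δ (ofRe a) (ofRe b)) = mul δ (ofRe a) (ofRe b) := by
    intro a b
    ext1 <;> simp [mul, conj, ofRe]
  rw [thetaTaut_apply, theta0_eq, h]

theorem conj_theta0 (δ : ℝ) (p v : Base) : conj (theta0 δ p v) = theta0 δ p v := by
  rw [theta0_eq]
  simp only [conj, ofRe, Complex.conj_ofReal]

theorem conj_add (a b : A) : conj (a + b) = conj a + conj b := by
  ext1 <;> simp [conj]

theorem mul_zero_iff (δ : ℝ) (a b : A) (ha : det δ a ≠ 0) (h : mul δ a b = 0) : b = 0 := by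
  refine mul_left_cancel δ a b 0 ha ?_
  rw [h]
  ext1 <;> simp [mul]

theorem ofRe_inj (a b : ReA) (h : ofRe a = ofRe b) : a = b := by
  simp only [ofRe, Prod.mk.injEq, Complex.ofReal_inj] at h
  exact Prod.ext h.1 h.2

theorem det_inv (δ : ℝ) (a : A) (ha : det δ a ≠ 0) : det δ (inv δ a) ≠ 0 := by
  have : det δ (inv δ a) = (det δ a)⁻¹ := by
    have h : det δ (inv δ a) * det δ a ^ 2 = det δ a := by
      rw [det, inv]
      simp only [neg_div, neg_sq]
      rw [sub_mul]
      field_simp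
      simp [det]
    field_simp
    field_simp at h
    linear_combination h
  rw [this]
  exact inv_ne_zero ha

theorem conj_ofRe (a : ReA) : conj (ofRe a) = ofRe a := by
  ext1 <;> simp [conj, ofRe]

theorem conj_mul (δ : ℝ) (a b : A) : conj (mul δ a b) = mul δ (conj a) (conj b) := by
  ext1 <;> simp [conj, mul]

theorem conj_inv_ofRe (δ : ℝ) (a : ReA) : conj (inv δ (ofRe a)) = inv δ (ofRe a) := by
  ext1 <;> simp [conj, inv, ofRe, det]

theorem frame_mapsTo (δ : ℝ) :
    Set.MapsTo (frame δ) (dom δ) (P2 δ) := by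
  rintro ⟨⟨z, u⟩, K, T, S⟩ hK
  replace hK : det δ K ≠ 0 := hK
  have hD := det_normSq_ne δ K hK
  refine ⟨⟨K, hK, rfl⟩, ?_, ?_, ?_, 0, ?_⟩
  · intro v v' hJ
    obtain ⟨h1, h2, h3⟩ := isJ_iff δ _ v v' hJ
    rw [frame_omega, frame_omega]
    change mul δ _ (theta0 δ (z, u) v') + _ = Complex.I • (mul δ _ (theta0 δ (z, u) v) + _)
    have h2 : theta0 δ (z, u) v = 0 := h2
    have h3 : theta0 δ (z, u) v' = 0 := h3
    rw [h2, h3, h1]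
    ext1 <;> simp [mul] <;> ring
  · intro X
    rw [frame_phi]
    have h1 := conj_thetaTaut δ (toP1 δ ((z, u), K, T, S)) X
    have h2 := conj_inv_ofRe δ (normSq δ K)
    generalize thetaTaut δ (toP1 δ ((z, u), K, T, S)) X = t at *
    generalize inv δ (ofRe (normSq δ K)) = E at *
    obtain ⟨t1, t2⟩ := t
    obtain ⟨E1, E2⟩ := E
    simp only [conj, Prod.mk.injEq] at h1 h2
    ext1
    · simp [conj, mul, ofRe, h1, h2]; ring
    · simp [conj, mul, ofRe, h1, h2]; ring
  · rintro ⟨⟨dz, du⟩, dD⟩ h1 h2 h3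
    have e1 : theta0 δ (z, u) (dz, du) = 0 := mul_zero_iff δ _ _ hD h1
    have e2 : dz = 0 := by
      have h2 : mul δ (mul δ T (ofRe (normSq δ K))) (theta0 δ (z, u) (dz, du)) + mul δ K dz = 0 := h2
      rw [e1] at h2
      refine mul_zero_iff δ _ _ hK ?_
      rw [← h2]
      ext1 <;> simp [mul]
    subst e2
    have e3 : du = 0 := by
      rw [theta0_eq] at e1
      have := ofRe_inj _ 0 (e1.trans (by ext1 <;> simp [ofRe]))
      simp only [Prod.mk_eq_zero] at this
      ext1
      · simpa using this.1
      · simpa using this.2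
    subst e3
    have e4 : dD = 0 := by
      change mul δ (ofRe S) (thetaTaut δ (toP1 δ ((z, u), K, T, S)) ((0, 0), dD))
        + mul δ _ 0 - mul δ _ (conj 0) - mul δ (inv δ (ofRe (normSq δ K))) (ofRe dD) = 0 at h3
      change thetaTaut δ (toP1 δ ((z, u), K, T, S)) ((0, 0), dD) = 0 at h1
      rw [h1] at h3
      have h4 : mul δ (inv δ (ofRe (normSq δ K))) (ofRe dD) = 0 := by
        have h5 := neg_eq_zero.2 h3
        rw [← h5]
        ext1 <;> simp [mul, conj] <;> ring
      have := mul_zero_iff δ _ _ (det_inv δ _ hD) h4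
      exact ofRe_inj _ 0 (this.trans (by ext1 <;> simp [ofRe]))
    subst e4
    rfl
  · intro X Y
    have hext : extd (thetaTaut δ) (frame δ ((z, u), K, T, S)).1 X Y =
        mul δ (ofRe X.2) (theta0 δ (z, u) Y.1) - mul δ (ofRe Y.2) (theta0 δ (z, u) X.1)
          + mul δ (ofRe (normSq δ K)) (Complex.I •
            (mul δ X.1.1 (conj Y.1.1) - mul δ Y.1.1 (conj X.1.1))) := extd_thetaTaut δ _ X Y
    have tX : ∀ X, thetaTaut δ (frame δ ((z, u), K, T, S)).1 X =
        mul δ (ofRe (normSq δ K)) (theta0 δ (z, u) X.1) := fun _ => rfl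
    have oX : ∀ X, (frame δ ((z, u), K, T, S)).omega X =
        mul δ (mul δ T (ofRe (normSq δ K))) (theta0 δ (z, u) X.1) + mul δ K X.1.1 := fun _ => rfl
    have pX : ∀ X, (frame δ ((z, u), K, T, S)).2.2 X =
        mul δ (ofRe S) (mul δ (ofRe (normSq δ K)) (theta0 δ (z, u) X.1))
          + mul δ (Complex.I • mul δ K (conj T)) X.1.1
          - mul δ (Complex.I • mul δ T (conj K)) (conj X.1.1)
          - mul δ (inv δ (ofRe (normSq δ K))) (ofRe X.2) := fun _ => rfl
    have hE := mul_inv δ _ hD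
    rw [hext]
    simp only [wedge, wedgeC, bar, ContinuousLinearMap.comp_apply, conjL_apply, tX, oX, pX,
      conj_add, conj_mul, conj_ofRe, conj_theta0]
    generalize inv δ (ofRe (normSq δ K)) = E at *
    rw [ofRe_normSq] at *
    obtain ⟨⟨x, du⟩, dD⟩ := X
    obtain ⟨⟨y, dv⟩, dF⟩ := Y
    dsimp only
    generalize theta0 δ (z, u) (x, du) = a
    generalize theta0 δ (z, u) (y, dv) = b
    generalize conj T = T'
    generalize conj K = K' at *
    generalize conj x = x'
    generalize conj y = y'
    generalize ofRe S = S'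
    generalize ofRe dD = m
    generalize ofRe dF = n
    simp only [mul, Prod.mk.injEq] at hE
    obtain ⟨e1, e2⟩ := hE
    ext1
    · simp only [mul, Prod.fst_add, Prod.fst_sub, Prod.smul_fst, Prod.snd_add, Prod.snd_sub,
        Prod.smul_snd, smul_eq_mul, Prod.fst_zero, Prod.snd_zero]
      linear_combination (-1) * (b.1 * m.1 + δ * b.2 * m.2 - a.1 * n.1 - δ * a.2 * n.2) * e1
        - δ * (b.1 * m.2 + b.2 * m.1 - a.1 * n.2 - a.2 * n.1) * e2
    · simp only [mul, Prod.fst_add, Prod.fst_sub, Prod.smul_fst, Prod.snd_add, Prod.snd_sub,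
        Prod.smul_snd, smul_eq_mul, Prod.fst_zero, Prod.snd_zero, mul_zero, zero_mul, add_zero,
        Complex.zero_re, Complex.ofReal_zero, sub_zero]
      linear_combination (-1) * (b.1 * m.2 + b.2 * m.1 - a.1 * n.2 - a.2 * n.1) * e1
        - (b.1 * m.1 + δ * b.2 * m.2 - a.1 * n.1 - δ * a.2 * n.2) * e2

theorem frame_injOn (δ : ℝ) : Set.InjOn (frame δ) (dom δ) := by
  rintro ⟨⟨z, u⟩, K, T, S⟩ hK ⟨⟨z', u'⟩, K', T', S'⟩ hK' h
  replace hK : det δ K ≠ 0 := hK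
  have hD := det_normSq_ne δ K hK
  have hp : (z, u) = (z', u') := congrArg (fun f : Frame => f.1.1) h
  obtain ⟨rfl, rfl⟩ := Prod.mk.inj hp
  have ho : ∀ v, mul δ (mul δ T (ofRe (normSq δ K))) (theta0 δ (z, u) v) + mul δ K v.1 =
      mul δ (mul δ T' (ofRe (normSq δ K'))) (theta0 δ (z, u) v) + mul δ K' v.1 :=
    fun v => congrArg (fun f : Frame => f.2.1 v) h
  have hKK : K = K' := by
    have := ho (lift δ z (1, 0))
    rw [show theta0 δ (z, u) (lift δ z (1, 0)) = 0 from theta0_lift δ (z, u) (1, 0)] at this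
    simpa [mul, lift, Prod.ext_iff] using this
  subst hKK
  have hv : theta0 δ (z, u) (0, (2, 0)) = (1, 0) := by
    rw [theta0_eq]; ext1 <;> simp [ofRe]
  have hTT : T = T' := by
    have := ho (0, (2, 0))
    rw [hv] at this
    refine mul_left_cancel δ _ _ _ hD ?_
    have h1 := congrArg Prod.fst this
    have h2 := congrArg Prod.snd this
    simp [mul] at h1 h2
    ext1
    · simp only [mul]; linear_combination h1
    · simp only [mul]; linear_combination h2
  subst hTT
  have hSS : S = S' := by
    have : (frame δ ((z, u), K, T, S)).2.2 ((0, (2, 0)), 0) =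
        (frame δ ((z, u), K, T, S')).2.2 ((0, (2, 0)), 0) :=
      congrArg (fun f : Frame => f.2.2 ((0, (2, 0)), 0)) h
    have this : mul δ (ofRe S) (mul δ (ofRe (normSq δ K)) (theta0 δ (z, u) (0, (2, 0)))) + _ - _ - _
      = mul δ (ofRe S') (mul δ (ofRe (normSq δ K)) (theta0 δ (z, u) (0, (2, 0)))) + _ - _ - _ := this
    rw [hv] at this
    have this := add_right_cancel (sub_left_injective (sub_left_injective this))
    refine ofRe_inj _ _ (mul_left_cancel δ _ _ _ hD ?_)
    have h1 := congrArg Prod.fst this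
    have h2 := congrArg Prod.snd this
    simp [mul] at h1 h2
    ext1
    · simp only [mul]; linear_combination h1
    · simp only [mul]; linear_combination h2
  subst hSS
  rfl


theorem lift_om (δ : ℝ) (p : Base) (om : Base →L[ℝ] A)
    (hJ : ∀ v v', IsJ δ p v v' → om v' = Complex.I • om v) (dz : A) :
    om (lift δ p.1 dz) =
      dz.1 • om (lift δ p.1 (1, 0)) + dz.2 • om (lift δ p.1 (0, 1)) := by
  have h1 := hJ _ _ (isJ_lift δ p (1, 0))
  have h2 := hJ _ _ (isJ_lift δ p (0, 1))
  have e : lift δ p.1 dz = dz.1.re • lift δ p.1 (1, 0)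
      + dz.1.im • lift δ p.1 (Complex.I • ((1, 0) : A)) + dz.2.re • lift δ p.1 (0, 1)
      + dz.2.im • lift δ p.1 (Complex.I • ((0, 1) : A)) := by
    ext1
    · ext1 <;> apply Complex.ext <;> simp [lift]
    · ext1 <;> simp [lift] <;> ring
  rw [e, map_add, map_add, map_add, map_smul, map_smul, map_smul, map_smul, h1, h2]
  ext1 <;> apply Complex.ext <;> simp <;> ring

theorem eq_of_theta0 (δ : ℝ) (p v v' : Base) (h : v.1 = v'.1) (h' : theta0 δ p v = theta0 δ p v') :
    v = v' := by
  obtain ⟨dz, du⟩ := v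
  obtain ⟨dz', du'⟩ := v'
  obtain rfl : dz = dz' := h
  rw [theta0_eq, theta0_eq] at h'
  have := ofRe_inj _ _ h'
  simp only [Prod.mk.injEq, add_left_inj] at this
  ext1
  · rfl
  · ext1
    · linarith [this.1]
    · linarith [this.2]

theorem exists_vertical (δ : ℝ) (p : Base) (D : ReA) (hD : det δ (ofRe D) ≠ 0) (b : ReA) :
    ∃ v : Base, v.1 = 0 ∧ mul δ (ofRe D) (theta0 δ p v) = ofRe b := by
  have hN : D.1 ^ 2 - δ * D.2 ^ 2 ≠ 0 := by
    intro h
    apply hD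
    simp only [det, ofRe]
    exact_mod_cast h
  refine ⟨(0, (2 * ((D.1 * b.1 - δ * (D.2 * b.2)) / (D.1 ^ 2 - δ * D.2 ^ 2)),
    2 * ((D.1 * b.2 - D.2 * b.1) / (D.1 ^ 2 - δ * D.2 ^ 2)))), rfl, ?_⟩
  rw [theta0_eq]
  have e : mul δ (ofRe D) (ofRe ((D.1 * b.1 - δ * (D.2 * b.2)) / (D.1 ^ 2 - δ * D.2 ^ 2),
    (D.1 * b.2 - D.2 * b.1) / (D.1 ^ 2 - δ * D.2 ^ 2))) = ofRe b := by
    have hN' : ((D.1 : ℂ) ^ 2 - δ * D.2 ^ 2) ≠ 0 := by exact_mod_cast hN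
    have hi := mul_inv_cancel₀ hN'
    ext1
    · simp only [mul, ofRe]
      push_cast
      simp only [div_eq_mul_inv]
      linear_combination (b.1 : ℂ) * hi
    · simp only [mul, ofRe]
      push_cast
      simp only [div_eq_mul_inv]
      linear_combination (b.2 : ℂ) * hi
  rw [← e]
  congr 2
  ext1 <;> simp

theorem conj_conj (a : A) : conj (conj a) = a := by
  ext1 <;> simp [conj]

theorem frame_surjOn (δ : ℝ) (hδ : δ = 1 ∨ δ = -1) :
    Set.SurjOn (frame δ) (dom δ) (P2 δ) := by
  rintro ⟨⟨⟨z, u⟩, D⟩, om, ph⟩ ⟨⟨C, hC, hDC⟩, hJ, hreal, -, r, hr⟩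
  replace hDC : D = normSq δ C := hDC
  have hD : det δ (ofRe D) ≠ 0 := by rw [hDC]; exact det_normSq_ne δ C hC
  clear hDC hC C
  dsimp only at hJ hreal
  replace hr : ∀ X Y : Tot1, mul δ (ofRe X.2) (theta0 δ (z, u) Y.1)
      - mul δ (ofRe Y.2) (theta0 δ (z, u) X.1)
      + mul δ (ofRe D) (Complex.I • (mul δ X.1.1 (conj Y.1.1) - mul δ Y.1.1 (conj X.1.1))) =
      Complex.I • (mul δ (om X.1) (conj (om Y.1)) - mul δ (om Y.1) (conj (om X.1)))
      + (mul δ (mul δ (ofRe D) (theta0 δ (z, u) X.1)) (ph Y)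
        - mul δ (mul δ (ofRe D) (theta0 δ (z, u) Y.1)) (ph X))
      + (0,
          2 * ((mul δ (ofRe D) (theta0 δ (z, u) X.1)).1
              * ((δ * r.1 * (om Y.1).1 + r.2 * (om Y.1).2).re : ℂ)
            - (mul δ (ofRe D) (theta0 δ (z, u) Y.1)).1
              * ((δ * r.1 * (om X.1).1 + r.2 * (om X.1).2).re : ℂ))
          + 2 * ((mul δ (ofRe D) (theta0 δ (z, u) X.1)).2
              * ((r.2 * (om Y.1).1 + r.1 * (om Y.1).2).re : ℂ)
            - (mul δ (ofRe D) (theta0 δ (z, u) Y.1)).2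
              * ((r.2 * (om X.1).1 + r.1 * (om X.1).2).re : ℂ))) := by
    intro X Y
    have := hr X Y
    rw [extd_thetaTaut] at this
    exact this
  have mz : ∀ a, mul δ a 0 = 0 := fun a => by ext1 <;> simp [mul]
  have zm : ∀ a, mul δ 0 a = 0 := fun a => by ext1 <;> simp [mul]
  have o0 : ofRe 0 = 0 := by ext1 <;> simp [ofRe]
  have c0 : conj 0 = 0 := by ext1 <;> simp [conj]
  -- the part of `om` on the complex tangent space
  have hl := lift_om δ (z, u) om hJ
  dsimp only at hl
  have tl : ∀ dz, theta0 δ (z, u) (lift δ z dz) = 0 := theta0_lift δ (z, u)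
  have hb : ∀ dz dy : A, mul δ (ofRe D) (Complex.I • (mul δ dz (conj dy) - mul δ dy (conj dz))) =
      Complex.I • (mul δ (om (lift δ z dz)) (conj (om (lift δ z dy)))
        - mul δ (om (lift δ z dy)) (conj (om (lift δ z dz)))) := by
    intro dz dy
    have := hr (lift δ z dz, 0) (lift δ z dy, 0)
    have e1 : ∀ dz, (lift δ z dz).1 = dz := fun _ => rfl
    simp only [tl, mz, zm, o0, e1, sub_self, zero_add, Prod.fst_zero, zero_mul, Prod.snd_zero,
      mul_zero, add_zero, Prod.mk_zero_zero] at this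
    exact this
  set K := om (lift δ z (1, 0)) with hKdef
  set K₂ := om (lift δ z (0, 1)) with hK₂def
  have hK1 : ofRe D = mul δ K (conj K) := by
    have := hb (1, 0) (Complex.I, 0)
    rw [hl (Complex.I, 0), ← hKdef] at this
    have h1 := congrArg Prod.fst this
    have h2 := congrArg Prod.snd this
    simp [mul, conj] at h1 h2
    have hI := Complex.I_mul_I
    ext1
    · simp only [mul, conj]
      linear_combination (1 / 2 : ℂ) * h1 + ((ofRe D).1
        - (K.1 * starRingEnd ℂ K.1 + δ * (K.2 * starRingEnd ℂ K.2))) * hI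
    · simp only [mul, conj]
      linear_combination (1 / 2 : ℂ) * h2 + ((ofRe D).2
        - (K.1 * starRingEnd ℂ K.2 + K.2 * starRingEnd ℂ K.1)) * hI
  have hK2 : mul δ (ofRe D) (0, 1) = mul δ K (conj K₂) := by
    have := hb (1, 0) (0, Complex.I)
    have t2 := hb (1, 0) (0, 1)
    rw [hl (0, Complex.I), ← hKdef] at this
    rw [← hKdef, ← hK₂def] at t2
    have h1 := congrArg Prod.fst this
    have h2 := congrArg Prod.snd this
    have h3 := congrArg Prod.fst t2
    have h4 := congrArg Prod.snd t2
    simp [mul, conj] at h1 h2 h3 h4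
    have hI := Complex.I_mul_I
    ext1
    · simp only [mul, conj]
      linear_combination (1 / 2 : ℂ) * h1 - (1 / 2 : ℂ) * h3 + (δ * (ofRe D).2
        - (1 / 2) * (K.1 * starRingEnd ℂ K₂.1 + δ * (K.2 * starRingEnd ℂ K₂.2)
          + (K₂.1 * starRingEnd ℂ K.1 + δ * (K₂.2 * starRingEnd ℂ K.2)))) * hI
    · simp only [mul, conj]
      linear_combination (1 / 2 : ℂ) * h2 - (1 / 2 : ℂ) * h4 + ((ofRe D).1
        - (1 / 2) * (K.1 * starRingEnd ℂ K₂.2 + K.2 * starRingEnd ℂ K₂.1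
          + (K₂.1 * starRingEnd ℂ K.2 + K₂.2 * starRingEnd ℂ K.1))) * hI
  have hdK : det δ K ≠ 0 := by
    intro h
    apply hD
    rw [hK1]
    have : det δ (mul δ K (conj K)) = det δ K * det δ (conj K) := by
      simp only [det, mul]; ring
    rw [this, h, zero_mul]
  have hDK : D = normSq δ K := ofRe_inj _ _ (by rw [hK1, ofRe_normSq])
  have hK₂ : K₂ = mul δ K (0, 1) := by
    have h1 : mul δ K (conj K₂) = mul δ K (conj (mul δ K (0, 1))) := by
      rw [← hK2, hK1]
      ext1 <;> simp [mul, conj] <;> ring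
    have h2 := mul_left_cancel δ _ _ _ hdK h1
    rw [← conj_conj K₂, h2, conj_conj]
  have hlK : ∀ dz, om (lift δ z dz) = mul δ K dz := by
    intro dz
    rw [hl, hK₂]
    ext1 <;> simp [mul] <;> ring
  -- the part on the remaining directions
  obtain ⟨V₁, hV₁, tV₁⟩ := exists_vertical δ (z, u) D hD (1, 0)
  obtain ⟨V₂, hV₂, tV₂⟩ := exists_vertical δ (z, u) D hD (0, 1)
  have hx : ∀ dz, ph (lift δ z dz, 0) = Complex.I • (mul δ (mul δ K dz) (conj (om V₁))
      - mul δ (om V₁) (conj (mul δ K dz)))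
      + (0, -2 * ((δ * r.1 * (mul δ K dz).1 + r.2 * (mul δ K dz).2).re : ℂ)) := by
    intro dz
    have := hr (lift δ z dz, 0) (V₁, 0)
    simp only [tl, mz, zm, o0, c0, hV₁, tV₁, sub_self, zero_add, Prod.fst_zero, Prod.snd_zero,
      zero_mul, mul_zero, add_zero, smul_zero, hlK, zero_sub] at this
    have h1 := congrArg Prod.fst this
    have h2 := congrArg Prod.snd this
    simp [mul, ofRe] at h1 h2
    ext1
    · simp [mul]; linear_combination h1
    · simp [mul]; linear_combination h2
  have hy : ∀ dz, mul δ (0, 1) (ph (lift δ z dz, 0)) =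
      Complex.I • (mul δ (mul δ K dz) (conj (om V₂))
      - mul δ (om V₂) (conj (mul δ K dz)))
      + (0, -2 * ((r.2 * (mul δ K dz).1 + r.1 * (mul δ K dz).2).re : ℂ)) := by
    intro dz
    have := hr (lift δ z dz, 0) (V₂, 0)
    simp only [tl, mz, zm, o0, c0, hV₂, tV₂, sub_self, zero_add, Prod.fst_zero, Prod.snd_zero,
      zero_mul, mul_zero, add_zero, smul_zero, hlK, zero_sub] at this
    have h1 := congrArg Prod.fst this
    have h2 := congrArg Prod.snd this
    simp [mul, ofRe] at h1 h2
    ext1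
    · simp [mul]; linear_combination h1
    · simp [mul]; linear_combination h2
  have hxy : ∀ x : A, mul δ (0, 1) (Complex.I • (mul δ x (conj (om V₁))
      - mul δ (om V₁) (conj x))
      + (0, -2 * ((δ * r.1 * x.1 + r.2 * x.2).re : ℂ))) =
      Complex.I • (mul δ x (conj (om V₂)) - mul δ (om V₂) (conj x))
      + (0, -2 * ((r.2 * x.1 + r.1 * x.2).re : ℂ)) := by
    intro x
    have e : mul δ K (mul δ (inv δ K) x) = x := by
      have := mul_inv δ K hdK
      calc mul δ K (mul δ (inv δ K) x) = mul δ (mul δ K (inv δ K)) x := by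
            ext1 <;> simp [mul] <;> ring
        _ = x := by rw [this]; ext1 <;> simp [mul]
    have := hy (mul δ (inv δ K) x)
    rw [hx, e] at this
    exact this
  have hrs : r = 0 ∧ om V₂ = mul δ (0, 1) (om V₁) := by
    have q1 := hxy (1, 0)
    have q2 := hxy (Complex.I, 0)
    have q3 := hxy (0, 1)
    have q4 := hxy (0, Complex.I)
    generalize om V₁ = s at *
    generalize om V₂ = t at *
    obtain ⟨r1, r2⟩ := r
    obtain ⟨s1, s2⟩ := s
    obtain ⟨t1, t2⟩ := t
    simp [mul, conj, Complex.ext_iff, Prod.ext_iff] at q1 q2 q3 q4 ⊢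
    rcases hδ with rfl | rfl
    · norm_num at q1 q2 q3 q4 ⊢
      obtain ⟨⟨a1, a2⟩, ⟨a3, a4⟩, ⟨a5, a6⟩, a7, a8⟩ := And.intro q1 (And.intro q2 (And.intro q3 q4))
      refine ⟨⟨⟨?_, ?_⟩, ?_, ?_⟩, ⟨?_, ?_⟩, ?_, ?_⟩ <;> linarith
    · norm_num at q1 q2 q3 q4 ⊢
      obtain ⟨⟨a1, a2⟩, ⟨a3, a4⟩, ⟨a5, a6⟩, a7, a8⟩ := And.intro q1 (And.intro q2 (And.intro q3 q4))
      refine ⟨⟨⟨?_, ?_⟩, ?_, ?_⟩, ⟨?_, ?_⟩, ?_, ?_⟩ <;> linarith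
  obtain ⟨rfl, hs⟩ := hrs
  have hS : ∃ S : ReA, ph (V₁, 0) = ofRe S := by
    have h := hreal (V₁, 0)
    refine ⟨((ph (V₁, 0)).1.re, (ph (V₁, 0)).2.re), ?_⟩
    have h1 := congrArg Prod.fst h
    have h2 := congrArg Prod.snd h
    ext1
    · exact (Complex.conj_eq_iff_re.1 h1).symm
    · exact (Complex.conj_eq_iff_re.1 h2).symm
  obtain ⟨S, hS⟩ := hS
  have o1 : ∀ a, mul δ (ofRe (1, 0)) a = a := fun a => by ext1 <;> simp [mul, ofRe]
  have hV : ph (V₂, 0) = mul δ (0, 1) (ph (V₁, 0)) := by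
    have := hr (V₁, 0) (V₂, 0)
    rw [tV₁, tV₂, o1, hs] at this
    have h1 := congrArg Prod.fst this
    have h2 := congrArg Prod.snd this
    simp [mul, ofRe, conj, hV₁, hV₂] at h1 h2
    ext1
    · simp [mul]; linear_combination (-1 : ℂ) * h1
    · simp [mul]; linear_combination (-1 : ℂ) * h2
  have hc : ∀ c : ReA, ph (0, c) = - mul δ (inv δ (ofRe D)) (ofRe c) := by
    intro c
    have e : theta0 δ (z, u) V₁ = inv δ (ofRe D) := by
      refine mul_left_cancel δ _ _ _ hD ?_
      rw [tV₁, mul_inv δ _ hD]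
      ext1 <;> simp [ofRe]
    have := hr (V₁, 0) (0, c)
    rw [tV₁, o1, e] at this
    have h1 := congrArg Prod.fst this
    have h2 := congrArg Prod.snd this
    simp [mul, conj, ofRe, hV₁] at h1 h2
    ext1
    · simp [mul, ofRe]; linear_combination (-1 : ℂ) * h1
    · simp [mul, ofRe]; linear_combination (-1 : ℂ) * h2
  have hdec : ∀ v : Base, ∃ b : ReA, mul δ (ofRe D) (theta0 δ (z, u) v) = ofRe b ∧
      v = lift δ z v.1 + b.1 • V₁ + b.2 • V₂ := by
    intro v
    have : ∃ b : ReA, mul δ (ofRe D) (theta0 δ (z, u) v) = ofRe b := by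
      rw [theta0_eq]
      generalize ((v.2.1 / 2 + _, _) : ReA) = q
      refine ⟨(D.1 * q.1 + δ * (D.2 * q.2), D.1 * q.2 + D.2 * q.1), ?_⟩
      ext1 <;> simp [mul, ofRe]
    obtain ⟨b, hb'⟩ := this
    refine ⟨b, hb', eq_of_theta0 δ (z, u) _ _ ?_ ?_⟩
    · simp [lift, hV₁, hV₂]
    · refine mul_left_cancel δ _ _ _ hD ?_
      rw [hb', map_add, map_add, map_smul, map_smul, tl]
      have a1 := congrArg (fun q : A => b.1 • q) tV₁
      have a2 := congrArg (fun q : A => b.2 • q) tV₂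
      have : mul δ (ofRe D) (0 + b.1 • theta0 δ (z, u) V₁ + b.2 • theta0 δ (z, u) V₂) =
          b.1 • mul δ (ofRe D) (theta0 δ (z, u) V₁) + b.2 • mul δ (ofRe D) (theta0 δ (z, u) V₂) := by
        ext1 <;> simp [mul] <;> ring
      rw [this, tV₁, tV₂]
      ext1 <;> simp [ofRe]
  refine ⟨((z, u), K, om V₁, S), hdK, ?_⟩
  ext1
  · rw [toP1_fst, toP1, ← hDK]
  · ext1
    · refine ContinuousLinearMap.ext fun v => ?_
      obtain ⟨b, hb', hv⟩ := hdec v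
      rw [frame_omega]
      dsimp only
      rw [← hDK]
      have : mul δ (mul δ (om V₁) (ofRe D)) (theta0 δ (z, u) v) =
          mul δ (om V₁) (mul δ (ofRe D) (theta0 δ (z, u) v)) := by
        ext1 <;> simp [mul] <;> ring
      rw [this, hb']
      conv_rhs => rw [hv]
      rw [map_add, map_add, map_smul, map_smul, hs, hlK]
      ext1 <;> simp [mul, ofRe] <;> ring
    · refine ContinuousLinearMap.ext fun X => ?_
      obtain ⟨v, c⟩ := X
      obtain ⟨b, hb', hv⟩ := hdec v
      rw [frame_phi]
      dsimp only
      have hX : ((v, c) : Tot1) = (lift δ z v.1, 0) + b.1 • (V₁, 0) + b.2 • (V₂, 0) + (0, c) := by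
        conv_lhs => rw [hv]
        ext1
        · simp
        · simp
      have ht : thetaTaut δ (toP1 δ ((z, u), K, om V₁, S)) (v, c) = ofRe b := by
        rw [thetaTaut_apply]
        dsimp only [toP1]
        rw [← hDK, hb']
      conv_rhs => rw [hX]
      rw [map_add, map_add, map_add, map_smul, map_smul, hV, hS, hc, hx, ht, ← hDK]
      ext1 <;> simp [mul, ofRe, conj] <;> ring

/-- For every coframe there is exactly one choice of coordinates. -/
theorem frame_bijOn (δ : ℝ) (hδ : δ = 1 ∨ δ = -1) : Set.BijOn (frame δ) (dom δ) (P2 δ) :=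
  ⟨frame_mapsTo δ, frame_injOn δ, frame_surjOn δ hδ⟩

end Chart

/-! ### The tautological forms on the second bundle -/

/-- The form `θ` on the second bundle. -/
def thetaHat (δ : ℝ) (x : Tot2) : Tot2 →L[ℝ] A :=
  (thetaTaut δ (toP1 δ x)).comp (fderiv ℝ (toP1 δ) x)

/-- The form `ω` on the second bundle. -/
def omegaHat (δ : ℝ) (x : Tot2) : Tot2 →L[ℝ] A :=
  (frame δ x).omega.comp (fderiv ℝ (toP1 δ) x)

/-- The form `φ` on the second bundle. -/
def phiHat (δ : ℝ) (x : Tot2) : Tot2 →L[ℝ] A :=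
  (frame δ x).2.2.comp (fderiv ℝ (toP1 δ) x)

/-! ### The parallelism -/

/-- The curvature component `Ω₁¹ = ⅔ dκ - ⅓ dφ + i conj μ ∧ ω + i μ ∧ conj ω`. -/
def Omega11 (δ : ℝ) (κ μ : Tot2 → Tot2 →L[ℝ] A) (x X Y : Tot2) : A :=
  (2 / 3 : ℝ) • extd κ x X Y - (1 / 3 : ℝ) • extd (phiHat δ) x X Y
    + Complex.I • wedge δ (bar (μ x)) (omegaHat δ x) X Y
    + Complex.I • wedge δ (μ x) (bar (omegaHat δ x)) X Y

/-- The curvature component `Ω₂¹ = ½ (dμ + μ ∧ conj κ + ½ ψ ∧ ω)`. -/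
def Omega21 (δ : ℝ) (κ μ ψ : Tot2 → Tot2 →L[ℝ] A) (x X Y : Tot2) : A :=
  (1 / 2 : ℝ) • (extd μ x X Y + wedge δ (μ x) (bar (κ x)) X Y
    + (1 / 2 : ℝ) • wedge δ (ψ x) (omegaHat δ x) X Y)

/-- The curvature component `Ω₂⁰ = -¼ (dψ - 2 i μ ∧ conj μ + ψ ∧ φ)`. -/
def Omega20 (δ : ℝ) (μ ψ : Tot2 → Tot2 →L[ℝ] A) (x X Y : Tot2) : A :=
  (-(1 / 4) : ℝ) • (extd ψ x X Y - (2 * Complex.I) • wedge δ (μ x) (bar (μ x)) X Y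
    + wedge δ (ψ x) (phiHat δ x) X Y)

/-- All members of the coframe `(θ, ω, conj ω, φ, Im κ, μ, conj μ, ψ)` other than `ω¹, ω²` (and their
conjugates) vanish on `X`.  (The real part of `κ` is `φ / 2`.) -/
def OnlyOmega (δ : ℝ) (κ μ ψ : Tot2 → Tot2 →L[ℝ] A) (x X : Tot2) : Prop :=
  thetaHat δ x X = 0 ∧ phiHat δ x X = 0 ∧ κ x X = 0 ∧ μ x X = 0 ∧ ψ x X = 0

/-- The coefficient of `ω¹ ∧ conj ω¹` in the expansion of the 2-form `β` in the coframe is zero: `β`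
vanishes on the plane on which only `ω¹` and `conj ω¹` are nonzero. -/
def NoOmega1 (δ : ℝ) (κ μ ψ : Tot2 → Tot2 →L[ℝ] A) (x : Tot2) (β : Tot2 → Tot2 → ℂ) : Prop :=
  ∀ X Y, OnlyOmega δ κ μ ψ x X → OnlyOmega δ κ μ ψ x Y →
    (omegaHat δ x X).2 = 0 → (omegaHat δ x Y).2 = 0 → β X Y = 0

/-- The coefficient of `ω² ∧ conj ω²` in the expansion of the 2-form `β` in the coframe is zero. -/
def NoOmega2 (δ : ℝ) (κ μ ψ : Tot2 → Tot2 →L[ℝ] A) (x : Tot2) (β : Tot2 → Tot2 → ℂ) : Prop :=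
  ∀ X Y, OnlyOmega δ κ μ ψ x X → OnlyOmega δ κ μ ψ x Y →
    (omegaHat δ x X).1 = 0 → (omegaHat δ x Y).1 = 0 → β X Y = 0

/-- The forms `κ = (φ₁¹, φ₁²)`, `μ = (μ₁¹, μ₁²)`, `ψ = (ψ¹, ψ³)` of the parallelism of the (semi-flat)
quadric: smooth forms on the second bundle with the structure equations
`dω = ω ∧ κ + θ ∧ μ`, `Re κ = φ / 2`, `dφ = 2 Re (i μ ∧ conj ω) + θ ∧ ψ`, `ψ` real, and the normalising
conditions on the curvature which fix them uniquely. -/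
structure IsParallelism (δ : ℝ) (κ μ ψ : Tot2 → Tot2 →L[ℝ] A) : Prop where
  smooth_κ : ContDiffOn ℝ ∞ κ (dom δ)
  smooth_μ : ContDiffOn ℝ ∞ μ (dom δ)
  smooth_ψ : ContDiffOn ℝ ∞ ψ (dom δ)
  re_κ : ∀ x ∈ dom δ, ∀ X, κ x X + conj (κ x X) = phiHat δ x X
  real_ψ : ∀ x ∈ dom δ, ∀ X, conj (ψ x X) = ψ x X
  d_omega : ∀ x ∈ dom δ, ∀ X Y, extd (omegaHat δ) x X Y =
    wedge δ (omegaHat δ x) (κ x) X Y + wedge δ (thetaHat δ x) (μ x) X Y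
  d_phi : ∀ x ∈ dom δ, ∀ X Y, extd (phiHat δ) x X Y =
    (Complex.I • wedge δ (μ x) (bar (omegaHat δ x)) X Y
      + conj (Complex.I • wedge δ (μ x) (bar (omegaHat δ x)) X Y))
    + wedge δ (thetaHat δ x) (ψ x) X Y
  norm_κ₁ : ∀ x ∈ dom δ, NoOmega1 δ κ μ ψ x fun X Y => (Omega11 δ κ μ x X Y).1
  norm_κ₂ : ∀ x ∈ dom δ, NoOmega2 δ κ μ ψ x fun X Y => (Omega11 δ κ μ x X Y).2
  norm_μ₁ : ∀ x ∈ dom δ, NoOmega1 δ κ μ ψ x fun X Y => (Omega21 δ κ μ ψ x X Y).1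
  norm_μ₂ : ∀ x ∈ dom δ, NoOmega2 δ κ μ ψ x fun X Y => (Omega21 δ κ μ ψ x X Y).2
  norm_ψ₁ : ∀ x ∈ dom δ, NoOmega1 δ κ μ ψ x fun X Y => (Omega20 δ μ ψ x X Y).1
  norm_ψ₂ : ∀ x ∈ dom δ, NoOmega2 δ κ μ ψ x fun X Y => (Omega20 δ μ ψ x X Y).2

/-! ### The chain distribution and its integral manifolds -/

/-- The chain distribution `ω = 0`, `μ = 0`. -/
def chainDistribution (δ : ℝ) (μ : Tot2 → Tot2 →L[ℝ] A) (x : Tot2) : Submodule ℝ Tot2 :=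
  LinearMap.ker (omegaHat δ x : Tot2 →ₗ[ℝ] A) ⊓ LinearMap.ker (μ x : Tot2 →ₗ[ℝ] A)

/-- `L` is a connected integral manifold of the distribution `Δ` (of rank `8`, on the `16`-dimensional
second bundle): the image of a connected smooth manifold under an injective immersion whose tangent
spaces are the spaces `Δ x`. -/
def IsConnectedIntegralManifold (δ : ℝ) (Δ : Tot2 → Submodule ℝ Tot2) (L : Set Tot2) : Prop :=
  ∃ (N : Type) (_ : TopologicalSpace N) (_ : T2Space N) (_ : SecondCountableTopology N)
    (_ : ConnectedSpace N) (_ : ChartedSpace (EuclideanSpace ℝ (Fin 8)) N)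
    (_ : IsManifold (𝓡 8) ∞ N) (ι : N → Tot2),
    ContMDiff (𝓡 8) 𝓘(ℝ, Tot2) ∞ ι ∧ Function.Injective ι ∧
    (∀ n, Function.Injective (mfderiv (𝓡 8) 𝓘(ℝ, Tot2) ι n)) ∧
    (∀ n, Set.range (mfderiv (𝓡 8) 𝓘(ℝ, Tot2) ι n) = (Δ (ι n) : Set Tot2)) ∧
    (∀ n, ι n ∈ dom δ) ∧ Set.range ι = L

/-- A maximal connected integral manifold (leaf): it contains every connected integral manifold that it
meets. -/
def IsLeaf (δ : ℝ) (Δ : Tot2 → Submodule ℝ Tot2) (L : Set Tot2) : Prop :=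
  IsConnectedIntegralManifold δ Δ L ∧
    ∀ L', IsConnectedIntegralManifold δ Δ L' → (L ∩ L').Nonempty → L' ⊆ L

/-- A `G`-chain on the quadric: the projection of a maximal connected integral manifold of the chain
distribution. -/
def IsGChain (δ : ℝ) (Γ : Set (A × A)) : Prop :=
  ∃ κ μ ψ : Tot2 → Tot2 →L[ℝ] A, IsParallelism δ κ μ ψ ∧
    ∃ L, IsLeaf δ (chainDistribution δ μ) L ∧ Γ = (fun x : Tot2 => embed δ x.1) '' L

end CRQuadric

end

/-!
Everything is computed in the commutative ring `𝔄` (`toQ` maps pairs to the ring `ℂ[ε] / (ε² - δ)`, so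
that `ring` and `linear_combination` apply) and in the global chart `((z, u), K, T, S)` of the second
bundle. There `ω = T θ + K dZ` and `θ = K conj K h`, where `h` is the contact form of the quadric and
`dh = i dZ ∧ d conj Z`.

*The parallelism.* By Cartan's lemma the structure equation of `dω` and `Re κ = φ / 2` determine `κ` up
to a multiple `β θ` and `μ` up to `β ω + γ θ` (`IsParallelism.exists_coeff`). On vectors where only `ω`
is nonzero all quadratic terms of the curvature vanish, so the normalising conditions on `Ω₁¹` and `Ω₂¹`
are equations for `dκ` and `dμ`; they give `2 β = S - 3 i T conj T` (`IsParallelism.two_beta`) and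
`γ = i T² conj T - T S` (`IsParallelism.gamma_eq`), where `ψ` enters only through the equation of `dφ`.

*The chain distribution.* With `a = -T conj K` it is given by `dZ = a h`, `da = i a² conj a h`
(`IsParallelism.mem_chainDistribution_iff`). For `q = 1 + i a conj Z` this implies
`dq = i a conj a q h` and `dW = 2 q h`. Hence `q conj q` and `a conj q` are constant along a leaf; over
the origin `q = 1`, so `q conj q = 1` and `a = a₀ q` on the whole leaf. Then `d(Z - ½ a₀ W) = 0`, that
is, `Z = ½ a₀ W` (`IsParallelism.eq_mul_wCoord`).

*All points are reached.* The curve `Im W = a conj a W conj W` (now `a = ½ a₀`) has near each of its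
points `w₀` the parametrisation `w₀ + q(w₀) t (1 - i a conj a t)⁻¹`, `t` real, which lifts to integral
manifolds of the chain distribution (`IsParallelism.exists_integralManifold`). The curve is connected:
for `δ = 1` it is a product of two lines or circles in `ℂ`, for `δ = -1` a complex conic, the image of
`ℂ` without at most one point (`isPreconnected_chainCurve`). As a leaf contains every connected integral
manifold that it meets, it lies over the whole curve (`IsParallelism.chainPoint_mem_leaf`).
-/

namespace CRQuadric

/-! ### The algebra as a ring -/

/-- The algebra `𝔄`, as the ring `ℂ[ε] / (ε² - δ)`: the entries `(a, b)` become `a + b ε`. -/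
noncomputable def toQ (δ : ℝ) : A →+ QuadraticAlgebra ℂ (δ : ℂ) 0 where
  toFun a := ⟨a.1, a.2⟩
  map_zero' := rfl
  map_add' _ _ := rfl

/-- The imaginary unit of `𝔄`. -/
noncomputable def unitI (δ : ℝ) : QuadraticAlgebra ℂ (δ : ℂ) 0 := ⟨Complex.I, 0⟩

theorem toQ_inj {δ : ℝ} {a b : A} (h : toQ δ a = toQ δ b) : a = b := by
  have h1 := congrArg QuadraticAlgebra.re h
  have h2 := congrArg QuadraticAlgebra.im h
  exact Prod.ext h1 h2

theorem toQ_mul (δ : ℝ) (a b : A) : toQ δ (mul δ a b) = toQ δ a * toQ δ b := by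
  ext <;> simp [toQ, mul]
  ring

theorem toQ_I (δ : ℝ) (a : A) : toQ δ (Complex.I • a) = unitI δ * toQ δ a := by
  ext <;> simp [toQ, unitI]

theorem unitI_sq (δ : ℝ) : unitI δ * unitI δ = -1 := by
  ext <;> simp [unitI, QuadraticAlgebra.re_one, QuadraticAlgebra.im_one]

theorem toQ_one (δ : ℝ) : toQ δ (1, 0) = 1 := rfl

theorem conj_sub (a b : A) : conj (a - b) = conj a - conj b := by
  ext1 <;> simp [conj]

theorem conj_neg (a : A) : conj (-a) = -conj a := by
  ext1 <;> simp [conj]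

theorem conj_zero : conj 0 = 0 := by
  ext1 <;> simp [conj]

theorem conj_one : conj (1, 0) = (1, 0) := by
  ext1 <;> simp [conj]

theorem conj_I (a : A) : conj (Complex.I • a) = -(Complex.I • conj a) := by
  ext1 <;> simp [conj]

theorem ofRe_zero : ofRe 0 = 0 := by
  ext1 <;> simp [ofRe]

theorem eq_ofRe_of_conj {a : A} (h : conj a = a) : ∃ u : ReA, a = ofRe u := by
  refine ⟨(a.1.re, a.2.re), ?_⟩
  ext1
  · exact (Complex.conj_eq_iff_re.1 (congrArg Prod.fst h)).symm
  · exact (Complex.conj_eq_iff_re.1 (congrArg Prod.snd h)).symm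

theorem mul_zero' (δ : ℝ) (a : A) : mul δ a 0 = 0 := by
  ext1 <;> simp [mul]

theorem zero_mul' (δ : ℝ) (a : A) : mul δ 0 a = 0 := by
  ext1 <;> simp [mul]

theorem toQ_inv (δ : ℝ) (a : A) (ha : det δ a ≠ 0) : toQ δ a * toQ δ (inv δ a) = 1 := by
  rw [← toQ_mul, mul_inv δ a ha, toQ_one]

theorem toQ_mul_left_cancel {δ : ℝ} {a b c : A} (ha : det δ a ≠ 0)
    (h : toQ δ a * toQ δ b = toQ δ a * toQ δ c) : b = c := by
  rw [← toQ_mul, ← toQ_mul] at h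
  exact mul_left_cancel δ a b c ha (toQ_inj h)

theorem det_conj (δ : ℝ) (a : A) : det δ (conj a) = starRingEnd ℂ (det δ a) := by
  simp [det, conj]

theorem det_conj_ne {δ : ℝ} {a : A} (ha : det δ a ≠ 0) : det δ (conj a) ≠ 0 := by
  rw [det_conj]
  exact (map_ne_zero _).2 ha

theorem toQ_two_cancel {δ : ℝ} {a b : A} (h : 2 * toQ δ a = 2 * toQ δ b) : a = b := by
  have h : toQ δ (a + a) = toQ δ (b + b) := by
    rw [map_add, map_add]
    linear_combination h
  have h := toQ_inj h
  have h1 := congrArg Prod.fst h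
  have h2 := congrArg Prod.snd h
  simp only [Prod.fst_add, Prod.snd_add] at h1 h2
  ext1
  · linear_combination h1 / 2
  · linear_combination h2 / 2

/-! ### Products of functions and forms -/

section Forms

variable {V : Type} [NormedAddCommGroup V] [NormedSpace ℝ V]

/-- The product of a function and a form with values in `𝔄`. -/
noncomputable def fmul (δ : ℝ) (f : V → A) (α : V → V →L[ℝ] A) (x : V) : V →L[ℝ] A :=
  (mulL δ (f x)).comp (α x)

theorem fmul_apply (δ : ℝ) (f : V → A) (α : V → V →L[ℝ] A) (x X : V) :
    fmul δ f α x X = mul δ (f x) (α x X) := rfl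

/-- The product of matrices as a bounded bilinear map. -/
noncomputable def mulB (δ : ℝ) : A →L[ℝ] A →L[ℝ] A :=
  LinearMap.toContinuousLinearMap
    { toFun := mulL δ
      map_add' := fun b c => by
        refine ContinuousLinearMap.ext fun x => ?_
        ext1 <;> simp [mul] <;> ring
      map_smul' := fun r b => by
        refine ContinuousLinearMap.ext fun x => ?_
        ext1 <;> simp [mul] <;> ring }

theorem mulB_apply (δ : ℝ) (a b : A) : mulB δ a b = mul δ a b := rfl

theorem hasFDerivAt_mul (δ : ℝ) {f g : V → A} {x : V} (hf : DifferentiableAt ℝ f x)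
    (hg : DifferentiableAt ℝ g x) : DifferentiableAt ℝ (fun x => mul δ (f x) (g x)) x ∧
    ∀ X, fderiv ℝ (fun x => mul δ (f x) (g x)) x X =
      mul δ (fderiv ℝ f x X) (g x) + mul δ (f x) (fderiv ℝ g x X) := by
  have h := (mulB δ).hasFDerivAt_of_bilinear hf.hasFDerivAt hg.hasFDerivAt
  refine ⟨h.differentiableAt, fun X => ?_⟩
  rw [show (fun x => mul δ (f x) (g x)) = fun x => mulB δ (f x) (g x) from rfl, h.fderiv]
  simp [mulB_apply, add_comm]

theorem differentiableAt_fmul (δ : ℝ) {f : V → A} {α : V → V →L[ℝ] A} {x : V}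
    (hf : DifferentiableAt ℝ f x) (hα : DifferentiableAt ℝ α x) :
    DifferentiableAt ℝ (fmul δ f α) x := by
  have h1 : DifferentiableAt ℝ (fun x => mulB δ (f x)) x :=
    (mulB δ).differentiableAt.comp x hf
  exact h1.clm_comp hα

theorem fderiv_form_apply {α : V → V →L[ℝ] A} {x : V} (hα : DifferentiableAt ℝ α x) (X Y : V) :
    fderiv ℝ α x X Y = fderiv ℝ (fun x => α x Y) x X := by
  rw [fderiv_clm_apply hα (differentiableAt_const _)]
  simp

theorem extd_fmul (δ : ℝ) {f : V → A} {α : V → V →L[ℝ] A} {x : V}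
    (hf : DifferentiableAt ℝ f x) (hα : DifferentiableAt ℝ α x) (X Y : V) :
    extd (fmul δ f α) x X Y = mul δ (fderiv ℝ f x X) (α x Y) - mul δ (fderiv ℝ f x Y) (α x X)
      + mul δ (f x) (extd α x X Y) := by
  have key : ∀ X Y, fderiv ℝ (fmul δ f α) x X Y =
      mul δ (fderiv ℝ f x X) (α x Y) + mul δ (f x) (fderiv ℝ α x X Y) := by
    intro X Y
    rw [fderiv_form_apply (differentiableAt_fmul δ hf hα), fderiv_form_apply hα]
    exact (hasFDerivAt_mul δ hf (hα.clm_apply (differentiableAt_const _))).2 X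
  simp only [extd, key]
  refine toQ_inj (δ := δ) ?_
  simp only [map_add, map_sub, toQ_mul]
  ring

theorem extd_add {α β : V → V →L[ℝ] A} {x : V} (hα : DifferentiableAt ℝ α x)
    (hβ : DifferentiableAt ℝ β x) (X Y : V) :
    extd (fun x => α x + β x) x X Y = extd α x X Y + extd β x X Y := by
  simp only [extd]
  rw [fderiv_fun_add hα hβ]
  simp only [add_apply]
  abel

theorem extd_sub {α β : V → V →L[ℝ] A} {x : V} (hα : DifferentiableAt ℝ α x)
    (hβ : DifferentiableAt ℝ β x) (X Y : V) :
    extd (fun x => α x - β x) x X Y = extd α x X Y - extd β x X Y := by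
  simp only [extd]
  rw [fderiv_fun_sub hα hβ]
  simp only [sub_apply]
  abel

theorem extd_const (α : V →L[ℝ] A) (x X Y : V) : extd (fun _ => α) x X Y = 0 := by
  simp [extd]

theorem differentiableAt_bar {α : V → V →L[ℝ] A} {x : V} (hα : DifferentiableAt ℝ α x) :
    DifferentiableAt ℝ (fun x => bar (α x)) x :=
  (differentiableAt_const conjL).clm_comp hα

theorem extd_bar {α : V → V →L[ℝ] A} {x : V} (hα : DifferentiableAt ℝ α x) (X Y : V) :
    extd (fun x => bar (α x)) x X Y = conj (extd α x X Y) := by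
  have key : ∀ X Y, fderiv ℝ (fun x => bar (α x)) x X Y = conj (fderiv ℝ α x X Y) := by
    intro X Y
    rw [fderiv_form_apply (differentiableAt_bar hα), fderiv_form_apply hα]
    have h := (conjL.hasFDerivAt (x := α x Y)).comp x
      (hα.clm_apply (differentiableAt_const Y)).hasFDerivAt
    exact congrArg (fun L : V →L[ℝ] A => L X) h.fderiv
  simp only [extd, key, conj_sub]

theorem extd_congr {α β : V → V →L[ℝ] A} {x : V} (h : α =ᶠ[nhds x] β) (X Y : V) :
    extd α x X Y = extd β x X Y := by
  simp only [extd, h.fderiv_eq]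

end Forms

/-! ### The coordinate forms on the second bundle -/

/-- The form `dZ`. -/
noncomputable def dZ : Tot2 →L[ℝ] A :=
  (ContinuousLinearMap.fst ℝ A ReA).comp (ContinuousLinearMap.fst ℝ Base (A × A × ReA))

/-- The form `dK`. -/
noncomputable def dK : Tot2 →L[ℝ] A :=
  (ContinuousLinearMap.fst ℝ A (A × ReA)).comp (ContinuousLinearMap.snd ℝ Base (A × A × ReA))

/-- The form `dT`. -/
noncomputable def dT : Tot2 →L[ℝ] A :=
  (ContinuousLinearMap.fst ℝ A ReA).comp ((ContinuousLinearMap.snd ℝ A (A × ReA)).comp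
    (ContinuousLinearMap.snd ℝ Base (A × A × ReA)))

/-- The form `dS`. -/
noncomputable def dS : Tot2 →L[ℝ] A :=
  ofReL.comp ((ContinuousLinearMap.snd ℝ A ReA).comp ((ContinuousLinearMap.snd ℝ A (A × ReA)).comp
    (ContinuousLinearMap.snd ℝ Base (A × A × ReA))))

/-- The pullback of the contact form of the quadric. -/
noncomputable def hForm (δ : ℝ) (x : Tot2) : Tot2 →L[ℝ] A :=
  (theta0 δ x.1).comp (ContinuousLinearMap.fst ℝ Base (A × A × ReA))

/-- The form `K⁻¹ dK`. -/
noncomputable def kForm (δ : ℝ) : Tot2 → Tot2 →L[ℝ] A :=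
  fmul δ (fun x => inv δ x.2.1) (fun _ => dK)

/-- The matrix `D = K conj K`. -/
noncomputable def dMat (δ : ℝ) (x : Tot2) : A := mul δ x.2.1 (conj x.2.1)

theorem hForm_apply (δ : ℝ) (x X : Tot2) : hForm δ x X = theta0 δ x.1 X.1 := rfl

theorem conj_hForm (δ : ℝ) (x X : Tot2) : conj (hForm δ x X) = hForm δ x X :=
  conj_theta0 δ x.1 X.1

theorem conj_dMat (δ : ℝ) (x : Tot2) : conj (dMat δ x) = dMat δ x := by
  refine toQ_inj (δ := δ) ?_
  simp only [dMat, conj_mul, conj_conj, toQ_mul]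
  ring

theorem det_dMat {δ : ℝ} {x : Tot2} (hx : x ∈ dom δ) : det δ (dMat δ x) ≠ 0 := by
  rw [dMat, ← ofRe_normSq]
  exact det_normSq_ne δ _ hx

theorem isOpen_dom (δ : ℝ) : IsOpen (dom δ) := by
  refine isOpen_ne_fun ?_ continuous_const
  unfold det
  fun_prop

theorem fderiv_toP1 (δ : ℝ) (x X : Tot2) : (fderiv ℝ (toP1 δ) x X).1 = X.1 ∧
    ofRe (fderiv ℝ (toP1 δ) x X).2 = mul δ (dK X) (conj x.2.1) + mul δ x.2.1 (conj (dK X)) := by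
  have hc : ContDiff ℝ ∞ (toP1 δ) := by
    have : toP1 δ = fun x : Tot2 => (x.1, (x.2.1.1.re * x.2.1.1.re + x.2.1.1.im * x.2.1.1.im
        + δ * (x.2.1.2.re * x.2.1.2.re + x.2.1.2.im * x.2.1.2.im),
        2 * (x.2.1.1.re * x.2.1.2.re + x.2.1.1.im * x.2.1.2.im))) := by
      funext x
      simp [toP1, normSq, Complex.normSq_apply]
    rw [this]
    have hre : ContDiff ℝ ∞ Complex.re := Complex.reCLM.contDiff
    have him : ContDiff ℝ ∞ Complex.im := Complex.imCLM.contDiff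
    fun_prop
  have h := fderiv_of_cubic (toP1 δ) x X (X.1,
      (2 * (x.2.1.1 * starRingEnd ℂ X.2.1.1).re + δ * (2 * (x.2.1.2 * starRingEnd ℂ X.2.1.2).re),
      2 * (x.2.1.1 * starRingEnd ℂ X.2.1.2).re + 2 * (X.2.1.1 * starRingEnd ℂ x.2.1.2).re))
    (0, normSq δ X.2.1) 0
    (hc.contDiffAt.differentiableAt (by simp)) (by
      intro t
      ext1
      · simp [toP1]
      · ext1 <;> simp [toP1, normSq, Complex.normSq_apply] <;> ring)
  rw [h]
  refine ⟨rfl, ?_⟩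
  ext1 <;> apply Complex.ext <;> simp [ofRe, mul, conj, dK] <;> ring

theorem thetaHat_apply (δ : ℝ) (x X : Tot2) :
    thetaHat δ x X = mul δ (dMat δ x) (hForm δ x X) := by
  change mul δ (ofRe (normSq δ x.2.1)) (theta0 δ x.1 (fderiv ℝ (toP1 δ) x X).1) = _
  rw [(fderiv_toP1 δ x X).1, ofRe_normSq]
  rfl

theorem omegaHat_apply (δ : ℝ) (x X : Tot2) : omegaHat δ x X =
    mul δ (mul δ x.2.2.1 (dMat δ x)) (hForm δ x X) + mul δ x.2.1 (dZ X) := by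
  change mul δ (mul δ x.2.2.1 (ofRe (normSq δ x.2.1)))
    (theta0 δ x.1 (fderiv ℝ (toP1 δ) x X).1) + mul δ x.2.1 (fderiv ℝ (toP1 δ) x X).1.1 = _
  rw [(fderiv_toP1 δ x X).1, ofRe_normSq]
  rfl

theorem kForm_apply (δ : ℝ) (x X : Tot2) : kForm δ x X = mul δ (inv δ x.2.1) (dK X) := rfl

theorem mul_kForm {δ : ℝ} {x : Tot2} (hx : x ∈ dom δ) (X : Tot2) :
    mul δ x.2.1 (kForm δ x X) = dK X := by
  refine toQ_inj (δ := δ) ?_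
  rw [kForm_apply, toQ_mul, toQ_mul]
  linear_combination toQ δ (dK X) * toQ_inv δ x.2.1 hx

theorem phiHat_apply {δ : ℝ} {x : Tot2} (hx : x ∈ dom δ) (X : Tot2) :
    phiHat δ x X = mul δ (dMat δ x) (mul δ (ofRe x.2.2.2) (hForm δ x X))
      + Complex.I • mul δ (mul δ x.2.1 (conj x.2.2.1)) (dZ X)
      - Complex.I • mul δ (mul δ x.2.2.1 (conj x.2.1)) (conj (dZ X))
      - (kForm δ x X + conj (kForm δ x X)) := by
  have h1 := fderiv_toP1 δ x X
  have h2 : phiHat δ x X =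
      mul δ (ofRe x.2.2.2) (mul δ (ofRe (normSq δ x.2.1))
        (theta0 δ x.1 (fderiv ℝ (toP1 δ) x X).1))
      + mul δ (Complex.I • mul δ x.2.1 (conj x.2.2.1)) (fderiv ℝ (toP1 δ) x X).1.1
      - mul δ (Complex.I • mul δ x.2.2.1 (conj x.2.1)) (conj (fderiv ℝ (toP1 δ) x X).1.1)
      - mul δ (inv δ (ofRe (normSq δ x.2.1))) (ofRe (fderiv ℝ (toP1 δ) x X).2) := rfl
  rw [h2, h1.1, h1.2, ← hForm_apply]
  have hd := det_normSq_ne δ _ hx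
  refine toQ_mul_left_cancel hd ?_
  have hi := toQ_inv δ _ hd
  have hk := congrArg (toQ δ) (mul_kForm hx X)
  have hk' := congrArg (toQ δ) (congrArg conj (mul_kForm hx X))
  rw [conj_mul] at hk'
  rw [ofRe_normSq] at *
  change _ = _ * toQ δ (_ - Complex.I • mul δ (mul δ x.2.2.1 (conj x.2.1)) (conj X.1.1) - _)
  simp only [map_add, map_sub, toQ_mul, toQ_I, dMat] at *
  change _ = _ * (_ + unitI δ * (toQ δ x.2.1 * toQ δ (conj x.2.2.1) * toQ δ X.1.1) - _ - _)
  linear_combination (-(toQ δ (dK X) * toQ δ (conj x.2.1)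
    + toQ δ x.2.1 * toQ δ (conj (dK X)))) * hi + toQ δ (conj x.2.1) * hk + toQ δ x.2.1 * hk'

/-! ### Tangent vectors with prescribed values of the coordinate forms -/

/-- The tangent vector with given values of the forms `dZ`, `h`, `dK`, `dT`, `dS`. -/
theorem exists_vector (δ : ℝ) (x : Tot2) (z k t : A) (r s : ReA) :
    ∃ X : Tot2, dZ X = z ∧ hForm δ x X = ofRe r ∧ dK X = k ∧ dT X = t ∧ dS X = ofRe s := by
  refine ⟨((z, (lift δ x.1.1 z).2 + (2 : ℝ) • r), k, t, s), rfl, ?_, rfl, rfl, rfl⟩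
  have := theta0_lift δ x.1 z
  rw [theta0_eq] at this
  have h := ofRe_inj _ 0 (this.trans ofRe_zero.symm)
  simp only [Prod.mk_eq_zero] at h
  rw [hForm_apply, theta0_eq]
  congr 1
  ext1
  · have := h.1
    simp only [lift, Prod.fst_add, Prod.smul_fst, smul_eq_mul] at this ⊢
    linarith
  · have := h.2
    simp only [lift, Prod.snd_add, Prod.smul_snd, smul_eq_mul] at this ⊢
    linarith

theorem vector_ext (δ : ℝ) (x X Y : Tot2) (hZ : dZ X = dZ Y) (hh : hForm δ x X = hForm δ x Y)
    (hK : dK X = dK Y) (hT : dT X = dT Y) (hS : dS X = dS Y) : X = Y := by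
  have h1 : X.1 = Y.1 := eq_of_theta0 δ x.1 _ _ hZ hh
  have h2 : X.2.2.2 = Y.2.2.2 := ofRe_inj _ _ hS
  exact Prod.ext h1 (Prod.ext hK (Prod.ext hT h2))

/-! ### Exterior derivatives of the tautological forms -/

section Derivatives

variable {V : Type} [NormedAddCommGroup V] [NormedSpace ℝ V]

theorem hasFDerivAt_I_smul {f : V → A} {x : V} (hf : DifferentiableAt ℝ f x) :
    DifferentiableAt ℝ (fun x => Complex.I • f x) x ∧
    ∀ X, fderiv ℝ (fun x => Complex.I • f x) x X = Complex.I • fderiv ℝ f x X := by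
  refine ⟨hf.fun_const_smul _, fun X => ?_⟩
  rw [fderiv_fun_const_smul hf]
  rfl

theorem hasFDerivAt_conj {f : V → A} {x : V} (hf : DifferentiableAt ℝ f x) :
    DifferentiableAt ℝ (fun x => conj (f x)) x ∧
    ∀ X, fderiv ℝ (fun x => conj (f x)) x X = conj (fderiv ℝ f x X) := by
  have h := (conjL.hasFDerivAt (x := f x)).comp x hf.hasFDerivAt
  exact ⟨h.differentiableAt, fun X => congrArg (fun L : V →L[ℝ] A => L X) h.fderiv⟩

theorem hasFDerivAt_inv {δ : ℝ} {f : V → A} {x : V} (hf : DifferentiableAt ℝ f x)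
    (h0 : det δ (f x) ≠ 0) : DifferentiableAt ℝ (fun x => inv δ (f x)) x ∧
    ∀ X, fderiv ℝ (fun x => inv δ (f x)) x X =
      -mul δ (mul δ (inv δ (f x)) (inv δ (f x))) (fderiv ℝ f x X) := by
  have h1 : DifferentiableAt ℝ (fun x => (f x).1) x := hf.fst
  have h2 : DifferentiableAt ℝ (fun x => (f x).2) x := hf.snd
  have hd : DifferentiableAt ℝ (fun x => det δ (f x)) x := by
    unfold det
    fun_prop
  have hi : DifferentiableAt ℝ (fun x => inv δ (f x)) x := by
    have hdi := hd.inv h0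
    unfold inv
    simp only [div_eq_mul_inv]
    exact (h1.mul hdi).prodMk (h2.neg.mul hdi)
  refine ⟨hi, fun X => ?_⟩
  have hev : (fun y => mul δ (f y) (inv δ (f y))) =ᶠ[nhds x] fun _ => ((1, 0) : A) := by
    filter_upwards [hd.continuousAt.eventually_ne h0] with y hy
    exact mul_inv δ _ hy
  have h3 := (hasFDerivAt_mul δ hf hi).2 X
  rw [hev.fderiv_eq, fderiv_fun_const] at h3
  refine toQ_mul_left_cancel h0 ?_
  have h3 := congrArg (toQ δ) h3
  have h4 := toQ_inv δ _ h0
  simp only [map_add, map_neg, toQ_mul, Pi.zero_apply, zero_apply, map_zero] at h3 ⊢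
  linear_combination -h3 + toQ δ (inv δ (f x)) * toQ δ (fderiv ℝ f x X) * h4

end Derivatives

theorem contDiff_hForm (δ : ℝ) : ContDiff ℝ ∞ (hForm δ) := by
  rw [contDiff_clm_apply_iff]
  intro Y
  simp only [hForm_apply, theta0_apply]
  simp only [← ofReL_apply, ← conjL_apply]
  refine ContDiff.const_smul (1 / 2 : ℝ) ?_
  exact (contDiff_const.sub (contDiff_mul δ (by fun_prop) (by fun_prop))).add
    (contDiff_mul δ (by fun_prop) (by fun_prop))

theorem differentiableAt_hForm (δ : ℝ) (x : Tot2) : DifferentiableAt ℝ (hForm δ) x :=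
  (contDiff_hForm δ).contDiffAt.differentiableAt (by simp)

theorem extd_hForm (δ : ℝ) (x X Y : Tot2) : extd (hForm δ) x X Y =
    Complex.I • (mul δ (dZ X) (conj (dZ Y)) - mul δ (dZ Y) (conj (dZ X))) := by
  have key : ∀ X Y : Tot2, fderiv ℝ (hForm δ) x X Y = (1 / 2 : ℝ) •
      (mul δ (Complex.I • dZ X) (conj (dZ Y)) - mul δ (Complex.I • conj (dZ X)) (dZ Y)) := by
    intro X Y
    rw [fderiv_form_apply (differentiableAt_hForm δ x)]
    refine fderiv_of_cubic _ x X _ 0 0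
      ((differentiableAt_hForm δ x).clm_apply (differentiableAt_const _)) ?_
    intro t
    simp only [hForm_apply, theta0_apply]
    ext1 <;> simp [mul, conj, ofRe, dZ] <;> ring
  simp only [extd, key]
  ext1 <;> simp [mul, conj] <;> ring

theorem thetaHat_eq (δ : ℝ) : thetaHat δ = fmul δ (dMat δ) (hForm δ) :=
  funext fun x => ContinuousLinearMap.ext fun X => thetaHat_apply δ x X

theorem omegaHat_eq (δ : ℝ) : omegaHat δ = fun x =>
    fmul δ (fun x => mul δ (dT x) (dMat δ x)) (hForm δ) x + fmul δ dK (fun _ => dZ) x :=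
  funext fun x => ContinuousLinearMap.ext fun X => omegaHat_apply δ x X

theorem hasFDerivAt_dMat (δ : ℝ) (x : Tot2) : DifferentiableAt ℝ (dMat δ) x ∧
    ∀ X, fderiv ℝ (dMat δ) x X = mul δ (dK X) (conj (dK x)) + mul δ (dK x) (conj (dK X)) := by
  have hK : DifferentiableAt ℝ (fun y => dK y) x := dK.differentiableAt
  have hc := hasFDerivAt_conj hK
  have h := hasFDerivAt_mul δ hK hc.1
  refine ⟨h.1, fun X => ?_⟩
  refine (h.2 X).trans ?_
  rw [hc.2, dK.fderiv]

theorem differentiableAt_omegaHat (δ : ℝ) (x : Tot2) : DifferentiableAt ℝ (omegaHat δ) x := by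
  rw [omegaHat_eq]
  exact (differentiableAt_fmul δ (hasFDerivAt_mul δ dT.differentiableAt (hasFDerivAt_dMat δ x).1).1
    (differentiableAt_hForm δ x)).add
    (differentiableAt_fmul δ dK.differentiableAt (differentiableAt_const _))

theorem extd_omegaHat (δ : ℝ) (x X Y : Tot2) : extd (omegaHat δ) x X Y =
    mul δ (mul δ (dT X) (dMat δ x)
        + mul δ (dT x) (mul δ (dK X) (conj (dK x)) + mul δ (dK x) (conj (dK X)))) (hForm δ x Y)
      - mul δ (mul δ (dT Y) (dMat δ x)
        + mul δ (dT x) (mul δ (dK Y) (conj (dK x)) + mul δ (dK x) (conj (dK Y)))) (hForm δ x X)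
      + mul δ (mul δ (dT x) (dMat δ x))
        (Complex.I • (mul δ (dZ X) (conj (dZ Y)) - mul δ (dZ Y) (conj (dZ X))))
      + (mul δ (dK X) (dZ Y) - mul δ (dK Y) (dZ X)) := by
  have h1 := hasFDerivAt_mul δ (f := fun x => dT x) dT.differentiableAt (hasFDerivAt_dMat δ x).1
  rw [omegaHat_eq, extd_add
    (differentiableAt_fmul δ h1.1 (differentiableAt_hForm δ x))
    (differentiableAt_fmul δ dK.differentiableAt (differentiableAt_const _)),
    extd_fmul δ h1.1 (differentiableAt_hForm δ x),
    extd_fmul δ dK.differentiableAt (differentiableAt_const _), extd_hForm, extd_const,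
    h1.2, h1.2, (hasFDerivAt_dMat δ x).2, (hasFDerivAt_dMat δ x).2, dT.fderiv, dK.fderiv,
    mul_zero', add_zero]

theorem differentiableAt_kForm {δ : ℝ} {x : Tot2} (hx : x ∈ dom δ) :
    DifferentiableAt ℝ (kForm δ) x :=
  differentiableAt_fmul δ (hasFDerivAt_inv (f := fun x => dK x) dK.differentiableAt hx).1
    (differentiableAt_const _)

theorem extd_kForm {δ : ℝ} {x : Tot2} (hx : x ∈ dom δ) (X Y : Tot2) :
    extd (kForm δ) x X Y = 0 := by
  have hi := hasFDerivAt_inv (f := fun x => dK x) dK.differentiableAt hx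
  refine (extd_fmul δ hi.1 (differentiableAt_const _) X Y).trans ?_
  rw [hi.2, hi.2, extd_const, dK.fderiv]
  refine toQ_inj (δ := δ) ?_
  simp only [map_add, map_sub, map_neg, toQ_mul, map_zero]
  ring

/-! ### The forms of the parallelism up to two functions -/

/-- The values of the forms `θ`, `ω`, `K⁻¹ dK`, `dT`, `dS` on a tangent vector are arbitrary. -/
theorem exists_frame_vector {δ : ℝ} {x : Tot2} (hx : x ∈ dom δ) {t : A} (ht : conj t = t)
    (w k m : A) (s : ReA) : ∃ X : Tot2, thetaHat δ x X = t ∧ omegaHat δ x X = w ∧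
      kForm δ x X = k ∧ dT X = m ∧ dS X = ofRe s := by
  have hd : det δ (dMat δ x) ≠ 0 := det_dMat hx
  have hi := mul_inv δ _ hd
  have hD : dMat δ x = ofRe (normSq δ x.2.1) := (ofRe_normSq δ _).symm
  have hr : conj (mul δ (inv δ (dMat δ x)) t) = mul δ (inv δ (dMat δ x)) t := by
    rw [conj_mul, ht, hD, conj_inv_ofRe]
  obtain ⟨r, hr⟩ := eq_ofRe_of_conj hr
  obtain ⟨X, hZ, hh, hK, hT, hS⟩ := exists_vector δ x
    (mul δ (inv δ x.2.1) (w - mul δ x.2.2.1 t)) (mul δ x.2.1 k) m r s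
  have hθ : thetaHat δ x X = t := by
    rw [thetaHat_apply, hh, ← hr]
    refine toQ_inj (δ := δ) ?_
    have := toQ_inv δ _ hd
    simp only [toQ_mul]
    linear_combination toQ δ t * this
  have hK0 : toQ δ x.2.1 * toQ δ (inv δ x.2.1) = 1 := toQ_inv δ _ hx
  refine ⟨X, hθ, ?_, ?_, hT, hS⟩
  · have h1 : mul δ (mul δ x.2.2.1 (dMat δ x)) (hForm δ x X) = mul δ x.2.2.1 t := by
      rw [← hθ, thetaHat_apply]
      refine toQ_inj (δ := δ) ?_
      simp only [toQ_mul]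
      ring
    rw [omegaHat_apply, h1, hZ]
    refine toQ_inj (δ := δ) ?_
    simp only [toQ_mul, map_add, map_sub]
    linear_combination (toQ δ w - toQ δ x.2.2.1 * toQ δ t) * hK0
  · rw [kForm_apply, hK]
    refine toQ_inj (δ := δ) ?_
    simp only [toQ_mul]
    linear_combination toQ δ k * hK0

theorem phiHat_eq_omega {δ : ℝ} {x : Tot2} (hx : x ∈ dom δ) (X : Tot2) :
    phiHat δ x X = mul δ (ofRe x.2.2.2) (thetaHat δ x X)
      + Complex.I • mul δ (conj x.2.2.1) (omegaHat δ x X)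
      - Complex.I • mul δ x.2.2.1 (conj (omegaHat δ x X))
      - (kForm δ x X + conj (kForm δ x X)) := by
  rw [phiHat_apply hx, thetaHat_apply, omegaHat_apply]
  refine toQ_inj (δ := δ) ?_
  simp only [map_add, map_sub, toQ_mul, toQ_I, conj_add, conj_mul, conj_dMat, conj_hForm]
  ring

/-- The structure equation `dω = ω ∧ (i T conj ω - K⁻¹ dK) + θ ∧ (-dT + T φ + T K⁻¹ dK)`. -/
theorem extd_omegaHat_eq {δ : ℝ} {x : Tot2} (hx : x ∈ dom δ) (X Y : Tot2) :
    extd (omegaHat δ) x X Y =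
      (mul δ (omegaHat δ x X) (Complex.I • mul δ x.2.2.1 (conj (omegaHat δ x Y)) - kForm δ x Y)
      - mul δ (omegaHat δ x Y) (Complex.I • mul δ x.2.2.1 (conj (omegaHat δ x X)) - kForm δ x X))
      + (mul δ (thetaHat δ x X)
          (-dT Y + mul δ x.2.2.1 (phiHat δ x Y) + mul δ x.2.2.1 (kForm δ x Y))
        - mul δ (thetaHat δ x Y)
          (-dT X + mul δ x.2.2.1 (phiHat δ x X) + mul δ x.2.2.1 (kForm δ x X))) := by
  rw [extd_omegaHat, phiHat_apply hx, phiHat_apply hx, thetaHat_apply, thetaHat_apply,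
    omegaHat_apply, omegaHat_apply, ← mul_kForm hx X, ← mul_kForm hx Y]
  refine toQ_inj (δ := δ) ?_
  simp only [map_add, map_sub, map_neg, toQ_mul, toQ_I, conj_add, conj_mul, conj_dMat, conj_hForm]
  change (_ + toQ δ x.2.2.1 * (_ * toQ δ (conj x.2.1) + toQ δ x.2.1 * _)) * _
    - (_ + toQ δ x.2.2.1 * (_ * toQ δ (conj x.2.1) + toQ δ x.2.1 * _)) * _
    + toQ δ x.2.2.1 * _ * _ + _ = _
  simp only [dMat, toQ_mul]
  ring

/-- The form `κ` up to a multiple of `θ`. -/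
noncomputable def kappa0 (δ : ℝ) (x : Tot2) : Tot2 →L[ℝ] A :=
  fmul δ (fun x => Complex.I • dT x) (fun x => bar (omegaHat δ x)) x
    + fmul δ (fun x => Complex.I • (conj (dT x) + conj (dT x))) (omegaHat δ) x - kForm δ x

/-- The form `μ` up to a combination of `ω` and `θ`. -/
noncomputable def mu0 (δ : ℝ) (x : Tot2) : Tot2 →L[ℝ] A :=
  fmul δ dT (phiHat δ) x + fmul δ dT (kForm δ) x - dT

theorem kappa0_apply (δ : ℝ) (x X : Tot2) : kappa0 δ x X =
    Complex.I • mul δ x.2.2.1 (conj (omegaHat δ x X))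
      + Complex.I • mul δ (conj x.2.2.1 + conj x.2.2.1) (omegaHat δ x X) - kForm δ x X := by
  change mul δ (Complex.I • x.2.2.1) (conj (omegaHat δ x X))
    + mul δ (Complex.I • (conj x.2.2.1 + conj x.2.2.1)) (omegaHat δ x X) - kForm δ x X = _
  refine toQ_inj (δ := δ) ?_
  simp only [map_add, map_sub, toQ_mul, toQ_I]
  ring

theorem mu0_apply (δ : ℝ) (x X : Tot2) : mu0 δ x X =
    mul δ x.2.2.1 (phiHat δ x X) + mul δ x.2.2.1 (kForm δ x X) - dT X := rfl

section Parallelism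

variable {δ : ℝ} {κ μ ψ : Tot2 → Tot2 →L[ℝ] A}

/-- The structure equation of `dω` and the reality condition determine `κ` up to a multiple of `θ` and
`μ` up to a combination of `ω` and `θ` (Cartan's lemma). -/
theorem IsParallelism.exists_coeff (hP : IsParallelism δ κ μ ψ) {x : Tot2} (hx : x ∈ dom δ) :
    ∃ β γ : A, β + conj β = ofRe x.2.2.2 ∧ ∀ X,
      κ x X = kappa0 δ x X + mul δ β (thetaHat δ x X) ∧
      μ x X = mu0 δ x X + mul δ β (omegaHat δ x X) + mul δ γ (thetaHat δ x X) := by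
  obtain ⟨e, he1, he2, -⟩ := exists_frame_vector hx conj_one 0 0 0 0
  obtain ⟨f, hf1, hf2, -⟩ := exists_frame_vector hx conj_zero (1, 0) 0 0 0
  obtain ⟨g, hg1, hg2, -⟩ := exists_frame_vector hx conj_zero (Complex.I • (1, 0)) 0 0 0
  set κ' : Tot2 → A := fun X => κ x X - kappa0 δ x X with hκ
  set μ' : Tot2 → A := fun X => μ x X - mu0 δ x X with hμ
  have hw : ∀ X Y, toQ δ (omegaHat δ x X) * toQ δ (κ' Y) - toQ δ (omegaHat δ x Y) * toQ δ (κ' X)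
      + (toQ δ (thetaHat δ x X) * toQ δ (μ' Y) - toQ δ (thetaHat δ x Y) * toQ δ (μ' X)) = 0 := by
    intro X Y
    have h := hP.d_omega x hx X Y
    rw [extd_omegaHat_eq hx] at h
    have h := congrArg (toQ δ) h
    simp only [hκ, hμ, kappa0_apply, mu0_apply, wedge, map_add, map_sub, map_neg, toQ_mul, toQ_I] at h ⊢
    linear_combination -h
  have hr : ∀ X, κ' X + conj (κ' X) = mul δ (ofRe x.2.2.2) (thetaHat δ x X) := by
    intro X
    have h := hP.re_κ x hx X
    rw [phiHat_eq_omega hx] at h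
    refine toQ_inj (δ := δ) ?_
    have h := congrArg (toQ δ) h
    simp only [hκ, kappa0_apply, map_add, map_sub, map_neg, toQ_mul, toQ_I, conj_add, conj_sub, conj_mul,
      conj_conj, conj_I] at h ⊢
    linear_combination h
  have hμ' : ∀ X, toQ δ (μ' X) =
      toQ δ (omegaHat δ x X) * toQ δ (κ' e) + toQ δ (thetaHat δ x X) * toQ δ (μ' e) := by
    intro X
    have h := hw X e
    rw [he1, he2, toQ_one, map_zero] at h
    linear_combination -h
  have hκ' : ∀ X, toQ δ (κ' X) =
      toQ δ (omegaHat δ x X) * toQ δ (κ' f) + toQ δ (thetaHat δ x X) * toQ δ (μ' f) := by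
    intro X
    have h := hw X f
    rw [hf1, hf2, toQ_one, map_zero] at h
    linear_combination -h
  have hμf : toQ δ (μ' f) = toQ δ (κ' e) := by
    have h := hμ' f
    rw [hf1, hf2, toQ_one, map_zero] at h
    linear_combination h
  have hκf : toQ δ (κ' f) = 0 := by
    have h1 := congrArg (toQ δ) (hr f)
    have h2 := congrArg (toQ δ) (hr g)
    have h3 : κ' g = Complex.I • κ' f := by
      refine toQ_inj (δ := δ) ?_
      have h := hκ' g
      rw [hg1, hg2, toQ_I, toQ_one, map_zero] at h
      rw [toQ_I]
      linear_combination h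
    rw [hf1, mul_zero', map_add, map_zero] at h1
    rw [hg1, mul_zero', h3, conj_I, map_add, map_zero, map_neg, toQ_I, toQ_I] at h2
    rw [← map_zero (toQ δ)]
    refine congrArg (toQ δ) (toQ_two_cancel (δ := δ) ?_)
    rw [map_zero]
    linear_combination h1 - unitI δ * h2
      + (toQ δ (κ' f) - toQ δ (conj (κ' f))) * unitI_sq δ
  refine ⟨κ' e, μ' e, ?_, fun X => ⟨?_, ?_⟩⟩
  · rw [hr e, he1]
    ext1 <;> simp [mul]
  · refine (sub_eq_iff_eq_add' (a := κ x X)).1 (toQ_inj (δ := δ) ?_)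
    change toQ δ (κ' X) = _
    rw [hκ' X, hκf, hμf, toQ_mul]
    ring
  · rw [add_assoc]
    refine (sub_eq_iff_eq_add' (a := μ x X)).1 (toQ_inj (δ := δ) ?_)
    change toQ δ (μ' X) = _
    rw [hμ' X, map_add, toQ_mul, toQ_mul]
    ring

end Parallelism

/-! ### Exterior derivatives of the forms of the parallelism -/

theorem differentiableAt_thetaHat (δ : ℝ) (x : Tot2) : DifferentiableAt ℝ (thetaHat δ) x := by
  rw [thetaHat_eq]
  exact differentiableAt_fmul δ (hasFDerivAt_dMat δ x).1 (differentiableAt_hForm δ x)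

/-- The structure equation `dθ = i ω ∧ conj ω + θ ∧ φ`. -/
theorem extd_thetaHat_eq {δ : ℝ} {x : Tot2} (hx : x ∈ dom δ) (X Y : Tot2) :
    extd (thetaHat δ) x X Y =
      Complex.I • (mul δ (omegaHat δ x X) (conj (omegaHat δ x Y))
        - mul δ (omegaHat δ x Y) (conj (omegaHat δ x X)))
      + (mul δ (thetaHat δ x X) (phiHat δ x Y) - mul δ (thetaHat δ x Y) (phiHat δ x X)) := by
  rw [thetaHat_eq, extd_fmul δ (hasFDerivAt_dMat δ x).1 (differentiableAt_hForm δ x), extd_hForm,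
    (hasFDerivAt_dMat δ x).2, (hasFDerivAt_dMat δ x).2, fmul_apply, fmul_apply,
    phiHat_apply hx, phiHat_apply hx, omegaHat_apply, omegaHat_apply, ← mul_kForm hx X,
    ← mul_kForm hx Y]
  refine toQ_inj (δ := δ) ?_
  simp only [map_add, map_sub, toQ_mul, toQ_I, conj_add, conj_mul, conj_dMat, conj_hForm]
  change (_ * toQ δ (conj x.2.1) + toQ δ x.2.1 * _) * _
    - (_ * toQ δ (conj x.2.1) + toQ δ x.2.1 * _) * _ + _ * _ = _
  simp only [dMat, toQ_mul]
  ring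

theorem phiHat_eventuallyEq {δ : ℝ} {x : Tot2} (hx : x ∈ dom δ) : phiHat δ =ᶠ[nhds x] fun x =>
    fmul δ dS (thetaHat δ) x + fmul δ (fun x => Complex.I • conj (dT x)) (omegaHat δ) x
      - fmul δ (fun x => Complex.I • dT x) (fun x => bar (omegaHat δ x)) x
      - (kForm δ x + bar (kForm δ x)) := by
  filter_upwards [(isOpen_dom δ).mem_nhds hx] with y hy
  refine ContinuousLinearMap.ext fun X => ?_
  change phiHat δ y X = mul δ (ofRe y.2.2.2) (thetaHat δ y X)
    + mul δ (Complex.I • conj y.2.2.1) (omegaHat δ y X)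
    - mul δ (Complex.I • y.2.2.1) (conj (omegaHat δ y X)) - (kForm δ y X + conj (kForm δ y X))
  rw [phiHat_eq_omega hy]
  refine toQ_inj (δ := δ) ?_
  simp only [map_add, map_sub, toQ_mul, toQ_I]
  ring

theorem hasFDerivAt_I_dT (x : Tot2) : DifferentiableAt ℝ (fun x => Complex.I • dT x) x ∧
    ∀ X, fderiv ℝ (fun x => Complex.I • dT x) x X = Complex.I • dT X := by
  have h := hasFDerivAt_I_smul (f := fun x => dT x) (x := x) dT.differentiableAt
  refine ⟨h.1, fun X => ?_⟩
  rw [h.2, dT.fderiv]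

theorem hasFDerivAt_conj_dT (x : Tot2) : DifferentiableAt ℝ (fun x => conj (dT x)) x ∧
    ∀ X, fderiv ℝ (fun x => conj (dT x)) x X = conj (dT X) := by
  have h := hasFDerivAt_conj (f := fun x => dT x) (x := x) dT.differentiableAt
  refine ⟨h.1, fun X => ?_⟩
  rw [h.2, dT.fderiv]

theorem hasFDerivAt_I_conj_dT (x : Tot2) : DifferentiableAt ℝ (fun x => Complex.I • conj (dT x)) x ∧
    ∀ X, fderiv ℝ (fun x => Complex.I • conj (dT x)) x X = Complex.I • conj (dT X) := by
  have h := hasFDerivAt_I_smul (hasFDerivAt_conj_dT x).1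
  refine ⟨h.1, fun X => ?_⟩
  rw [h.2, (hasFDerivAt_conj_dT x).2]

theorem hasFDerivAt_I_two_conj_dT (x : Tot2) :
    DifferentiableAt ℝ (fun x => Complex.I • (conj (dT x) + conj (dT x))) x ∧
    ∀ X, fderiv ℝ (fun x => Complex.I • (conj (dT x) + conj (dT x))) x X =
      Complex.I • (conj (dT X) + conj (dT X)) := by
  have h1 := (hasFDerivAt_conj_dT x)
  have h := hasFDerivAt_I_smul (h1.1.fun_add h1.1)
  refine ⟨h.1, fun X => ?_⟩
  rw [h.2, fderiv_fun_add h1.1 h1.1, add_apply, h1.2]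

theorem differentiableAt_phiHat {δ : ℝ} {x : Tot2} (hx : x ∈ dom δ) :
    DifferentiableAt ℝ (phiHat δ) x := by
  have hθ := differentiableAt_thetaHat δ x
  have hω := differentiableAt_omegaHat δ x
  have hk := differentiableAt_kForm hx
  exact ((((differentiableAt_fmul δ dS.differentiableAt hθ).fun_add
    (differentiableAt_fmul δ (hasFDerivAt_I_conj_dT x).1 hω)).fun_sub
    (differentiableAt_fmul δ (hasFDerivAt_I_dT x).1 (differentiableAt_bar hω))).fun_sub
    (hk.fun_add (differentiableAt_bar hk))).congr_of_eventuallyEq (phiHat_eventuallyEq hx)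

theorem extd_phiHat {δ : ℝ} {x : Tot2} (hx : x ∈ dom δ) (X Y : Tot2) : extd (phiHat δ) x X Y =
    mul δ (dS X) (thetaHat δ x Y) - mul δ (dS Y) (thetaHat δ x X)
      + mul δ (ofRe x.2.2.2) (extd (thetaHat δ) x X Y)
      + (mul δ (Complex.I • conj (dT X)) (omegaHat δ x Y)
        - mul δ (Complex.I • conj (dT Y)) (omegaHat δ x X)
        + mul δ (Complex.I • conj x.2.2.1) (extd (omegaHat δ) x X Y))
      - (mul δ (Complex.I • dT X) (conj (omegaHat δ x Y))
        - mul δ (Complex.I • dT Y) (conj (omegaHat δ x X))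
        + mul δ (Complex.I • x.2.2.1) (conj (extd (omegaHat δ) x X Y))) := by
  have hθ := differentiableAt_thetaHat δ x
  have hω := differentiableAt_omegaHat δ x
  have hk := differentiableAt_kForm hx
  have h1 := differentiableAt_fmul δ (f := fun x => dS x) dS.differentiableAt hθ
  have h2 := differentiableAt_fmul δ (hasFDerivAt_I_conj_dT x).1 hω
  have h3 := differentiableAt_fmul δ (hasFDerivAt_I_dT x).1 (differentiableAt_bar hω)
  rw [extd_congr (phiHat_eventuallyEq hx),
    extd_sub ((h1.fun_add h2).fun_sub h3) (hk.fun_add (differentiableAt_bar hk)),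
    extd_sub (h1.fun_add h2) h3, extd_add h1 h2, extd_add hk (differentiableAt_bar hk),
    extd_bar hk, extd_kForm hx, conj_zero, add_zero, sub_zero,
    extd_fmul δ dS.differentiableAt hθ, extd_fmul δ (hasFDerivAt_I_conj_dT x).1 hω,
    extd_fmul δ (hasFDerivAt_I_dT x).1 (differentiableAt_bar hω), extd_bar hω,
    (hasFDerivAt_I_conj_dT x).2, (hasFDerivAt_I_conj_dT x).2, (hasFDerivAt_I_dT x).2,
    (hasFDerivAt_I_dT x).2, dS.fderiv]
  rfl

theorem differentiableAt_kappa0 {δ : ℝ} {x : Tot2} (hx : x ∈ dom δ) :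
    DifferentiableAt ℝ (kappa0 δ) x := by
  have hω := differentiableAt_omegaHat δ x
  exact ((differentiableAt_fmul δ (hasFDerivAt_I_dT x).1 (differentiableAt_bar hω)).fun_add
    (differentiableAt_fmul δ (hasFDerivAt_I_two_conj_dT x).1 hω)).fun_sub (differentiableAt_kForm hx)

theorem extd_kappa0 {δ : ℝ} {x : Tot2} (hx : x ∈ dom δ) (X Y : Tot2) : extd (kappa0 δ) x X Y =
    (mul δ (Complex.I • dT X) (conj (omegaHat δ x Y))
        - mul δ (Complex.I • dT Y) (conj (omegaHat δ x X))
        + mul δ (Complex.I • x.2.2.1) (conj (extd (omegaHat δ) x X Y)))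
      + (mul δ (Complex.I • (conj (dT X) + conj (dT X))) (omegaHat δ x Y)
        - mul δ (Complex.I • (conj (dT Y) + conj (dT Y))) (omegaHat δ x X)
        + mul δ (Complex.I • (conj x.2.2.1 + conj x.2.2.1)) (extd (omegaHat δ) x X Y)) := by
  have hω := differentiableAt_omegaHat δ x
  have h1 := differentiableAt_fmul δ (hasFDerivAt_I_dT x).1 (differentiableAt_bar hω)
  have h2 := differentiableAt_fmul δ (hasFDerivAt_I_two_conj_dT x).1 hω
  refine (extd_sub (h1.fun_add h2) (differentiableAt_kForm hx) X Y).trans ?_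
  rw [extd_add h1 h2, extd_kForm hx, sub_zero,
    extd_fmul δ (hasFDerivAt_I_two_conj_dT x).1 hω,
    extd_fmul δ (hasFDerivAt_I_dT x).1 (differentiableAt_bar hω), extd_bar hω,
    (hasFDerivAt_I_two_conj_dT x).2, (hasFDerivAt_I_two_conj_dT x).2, (hasFDerivAt_I_dT x).2,
    (hasFDerivAt_I_dT x).2]
  rfl

theorem differentiableAt_mu0 {δ : ℝ} {x : Tot2} (hx : x ∈ dom δ) :
    DifferentiableAt ℝ (mu0 δ) x :=
  ((differentiableAt_fmul δ dT.differentiableAt (differentiableAt_phiHat hx)).fun_add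
    (differentiableAt_fmul δ dT.differentiableAt (differentiableAt_kForm hx))).fun_sub
    (differentiableAt_const dT)

theorem extd_mu0 {δ : ℝ} {x : Tot2} (hx : x ∈ dom δ) (X Y : Tot2) : extd (mu0 δ) x X Y =
    (mul δ (dT X) (phiHat δ x Y) - mul δ (dT Y) (phiHat δ x X)
        + mul δ x.2.2.1 (extd (phiHat δ) x X Y))
      + (mul δ (dT X) (kForm δ x Y) - mul δ (dT Y) (kForm δ x X)) := by
  have hφ := differentiableAt_phiHat hx
  have hk := differentiableAt_kForm hx
  have h1 := differentiableAt_fmul δ (f := fun x => dT x) dT.differentiableAt hφ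
  have h2 := differentiableAt_fmul δ (f := fun x => dT x) dT.differentiableAt hk
  refine (extd_sub (h1.fun_add h2) (differentiableAt_const dT) X Y).trans ?_
  rw [extd_add h1 h2, extd_const, sub_zero,
    extd_fmul δ dT.differentiableAt hφ, extd_fmul δ dT.differentiableAt hk, dT.fderiv,
    extd_kForm hx, mul_zero', add_zero]
  rfl

/-! ### The normalisation of the curvature -/

theorem OnlyOmega.hForm_eq_zero {δ : ℝ} {κ μ ψ : Tot2 → Tot2 →L[ℝ] A} {x X : Tot2}
    (hx : x ∈ dom δ) (hX : OnlyOmega δ κ μ ψ x X) : hForm δ x X = 0 := by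
  have h := hX.1
  rw [thetaHat_apply] at h
  exact mul_zero_iff δ _ _ (det_dMat hx) h

/-- The tangent vector of the second bundle on which `h = 1` and all other coordinate forms vanish. -/
def hVec : Tot2 := ((0, (2, 0)), 0)

theorem hForm_hVec (δ : ℝ) (x : Tot2) : hForm δ x hVec = (1, 0) := by
  rw [hForm_apply, theta0_eq]
  ext1 <;> simp [ofRe, hVec]

theorem thetaHat_hVec (δ : ℝ) (x : Tot2) : thetaHat δ x hVec = dMat δ x := by
  rw [thetaHat_apply, hForm_hVec]
  ext1 <;> simp [mul]

section Parallelism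

variable {δ : ℝ} {κ μ ψ : Tot2 → Tot2 →L[ℝ] A}

theorem extd_hForm_of_onlyOmega {x X Y : Tot2} (hx : x ∈ dom δ)
    (hX : OnlyOmega δ κ μ ψ x X) (hY : OnlyOmega δ κ μ ψ x Y) :
    mul δ (dMat δ x) (extd (hForm δ) x X Y) =
      Complex.I • (mul δ (omegaHat δ x X) (conj (omegaHat δ x Y))
        - mul δ (omegaHat δ x Y) (conj (omegaHat δ x X))) := by
  rw [extd_hForm, omegaHat_apply, omegaHat_apply, hX.hForm_eq_zero hx, hY.hForm_eq_zero hx]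
  refine toQ_inj (δ := δ) ?_
  simp only [map_add, map_sub, toQ_mul, toQ_I, conj_add, conj_mul, conj_zero, map_zero, dMat]
  ring

theorem IsParallelism.extd_omegaHat_of_onlyOmega (hP : IsParallelism δ κ μ ψ) {x X Y : Tot2}
    (hx : x ∈ dom δ) (hX : OnlyOmega δ κ μ ψ x X) (hY : OnlyOmega δ κ μ ψ x Y) :
    extd (omegaHat δ) x X Y = 0 := by
  rw [hP.d_omega x hx, wedge, wedge, hX.1, hY.1, hX.2.2.1, hY.2.2.1]
  simp only [mul_zero', zero_mul', sub_self, add_zero]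

theorem IsParallelism.extd_phiHat_of_onlyOmega (hP : IsParallelism δ κ μ ψ) {x X Y : Tot2}
    (hx : x ∈ dom δ) (hX : OnlyOmega δ κ μ ψ x X) (hY : OnlyOmega δ κ μ ψ x Y) :
    extd (phiHat δ) x X Y = 0 := by
  rw [hP.d_phi x hx, wedge, wedge, hX.1, hY.1, hX.2.2.2.1, hY.2.2.2.1]
  simp only [zero_mul', sub_self, add_zero, smul_zero, conj_zero]

theorem IsParallelism.values_of_onlyOmega {x X : Tot2}
    {β γ : A} (h : ∀ X, κ x X = kappa0 δ x X + mul δ β (thetaHat δ x X) ∧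
      μ x X = mu0 δ x X + mul δ β (omegaHat δ x X) + mul δ γ (thetaHat δ x X))
    (hX : OnlyOmega δ κ μ ψ x X) :
    kForm δ x X = Complex.I • mul δ x.2.2.1 (conj (omegaHat δ x X))
      + Complex.I • mul δ (conj x.2.2.1 + conj x.2.2.1) (omegaHat δ x X) ∧
    dT X = mul δ x.2.2.1 (kForm δ x X) + mul δ β (omegaHat δ x X) := by
  have h1 := (h X).1
  have h2 := (h X).2
  rw [hX.1, hX.2.2.1, kappa0_apply, mul_zero', add_zero] at h1
  rw [hX.1, hX.2.2.2.1, mu0_apply, hX.2.1, mul_zero', mul_zero', add_zero, zero_add] at h2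
  constructor
  · exact (sub_eq_zero.1 h1.symm).symm
  · rw [sub_add_eq_add_sub] at h2
    exact (sub_eq_zero.1 h2.symm).symm

/-- The form `ψ` on the vectors along the coordinate `S`. -/
theorem IsParallelism.psi_vertical (hP : IsParallelism δ κ μ ψ) {x V : Tot2} (hx : x ∈ dom δ)
    (h1 : thetaHat δ x V = 0) (h2 : omegaHat δ x V = 0) (h3 : kForm δ x V = 0) (h4 : dT V = 0) :
    κ x V = 0 ∧ μ x V = 0 ∧ phiHat δ x V = 0 ∧ ψ x V = -dS V := by
  obtain ⟨β, γ, -, h⟩ := hP.exists_coeff hx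
  have hφ : phiHat δ x V = 0 := by
    rw [phiHat_eq_omega hx, h1, h2, h3]
    simp only [mul_zero', conj_zero, smul_zero, add_zero, sub_zero]
  have hκ : κ x V = 0 := by
    rw [(h V).1, kappa0_apply, h1, h2, h3]
    simp only [mul_zero', conj_zero, smul_zero, add_zero, sub_zero]
  have hμ : μ x V = 0 := by
    rw [(h V).2, mu0_apply, h1, h2, h3, h4, hφ]
    simp only [mul_zero', add_zero, sub_zero]
  refine ⟨hκ, hμ, hφ, ?_⟩
  obtain ⟨e, he1, he2, -, he4, he5⟩ := exists_frame_vector hx conj_one 0 0 0 0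
  have hd := hP.d_phi x hx V e
  have hω : extd (omegaHat δ) x V e = 0 := by
    rw [hP.d_omega x hx, wedge, wedge, h1, h2, hκ, hμ]
    simp only [mul_zero', zero_mul', sub_self, add_zero]
  rw [extd_phiHat hx, extd_thetaHat_eq hx, hω, h1, h2, he1, he2, he4, hφ, h4, wedge, wedge, hμ, h1,
    he1, bar, ContinuousLinearMap.comp_apply, ContinuousLinearMap.comp_apply, h2, he2] at hd
  refine toQ_inj (δ := δ) ?_
  have hd := congrArg (toQ δ) hd
  simp only [map_add, map_sub, toQ_mul, map_zero, map_neg, toQ_one,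
    smul_zero, mul_zero', zero_mul', sub_self, conj_zero, add_zero] at hd ⊢
  linear_combination hd

/-- There are tangent vectors on which only `ω` does not vanish, and `ω` is arbitrary on them. -/
theorem IsParallelism.exists_onlyOmega (hP : IsParallelism δ κ μ ψ) {x : Tot2} (hx : x ∈ dom δ)
    (w : A) : ∃ X, OnlyOmega δ κ μ ψ x X ∧ omegaHat δ x X = w := by
  obtain ⟨β, γ, -, h⟩ := hP.exists_coeff hx
  set k : A := Complex.I • mul δ x.2.2.1 (conj w)
      + Complex.I • mul δ (conj x.2.2.1 + conj x.2.2.1) w with hk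
  obtain ⟨X, h1, h2, h3, h4, -⟩ := exists_frame_vector hx conj_zero w k
    (mul δ x.2.2.1 k + mul δ β w) 0
  obtain ⟨s, hs⟩ := eq_ofRe_of_conj (hP.real_ψ x hx X)
  obtain ⟨V, v1, v2, v3, v4, v5⟩ := exists_frame_vector hx conj_zero 0 0 0 s
  obtain ⟨w1, w2, w3, w4⟩ := hP.psi_vertical hx v1 v2 v3 v4
  have hκ : κ x X = 0 := by
    rw [(h X).1, kappa0_apply, h1, h2, h3, mul_zero', add_zero, hk, sub_self]
  have hφ : phiHat δ x X = 0 := by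
    rw [← hP.re_κ x hx, hκ, conj_zero, add_zero]
  have hμ : μ x X = 0 := by
    rw [(h X).2, mu0_apply, h1, h2, h3, h4, hφ]
    refine toQ_inj (δ := δ) ?_
    simp only [map_add, map_sub, toQ_mul, map_zero]
    ring
  -- `X` satisfies everything except `ψ = 0`, which is corrected by a vector along the coordinate `S`
  refine ⟨X + V, ⟨?_, ?_, ?_, ?_, ?_⟩, ?_⟩
  · rw [map_add, h1, v1, add_zero]
  · rw [map_add, hφ, w3, add_zero]
  · rw [map_add, hκ, w1, add_zero]
  · rw [map_add, hμ, w2, add_zero]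
  · rw [map_add, hs, w4, v5, add_neg_cancel]
  · rw [map_add, h2, v2, add_zero]

/-- A 2-form that is `c · i ω ∧ conj ω` modulo the other members of the coframe vanishes on these
vectors if it satisfies the normalising conditions. -/
theorem IsParallelism.eq_zero_of_noOmega (hP : IsParallelism δ κ μ ψ) (hδ : δ ≠ 0) {x : Tot2}
    (hx : x ∈ dom δ) {F : Tot2 → Tot2 → A} {r : ℝ} (hr : r ≠ 0) {c : A}
    (hF : ∀ X Y, OnlyOmega δ κ μ ψ x X → OnlyOmega δ κ μ ψ x Y → F X Y =
      r • Complex.I • mul δ c (mul δ (omegaHat δ x X) (conj (omegaHat δ x Y))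
        - mul δ (omegaHat δ x Y) (conj (omegaHat δ x X))))
    (h1 : NoOmega1 δ κ μ ψ x fun X Y => (F X Y).1)
    (h2 : NoOmega2 δ κ μ ψ x fun X Y => (F X Y).2) : c = 0 := by
  -- `F` is evaluated on `ω = 1`, `ω = i` for the first entry of `c`, on `ω = ε`, `ω = i ε` for the second
  obtain ⟨X₁, hX₁, eX₁⟩ := hP.exists_onlyOmega hx (1, 0)
  obtain ⟨Y₁, hY₁, eY₁⟩ := hP.exists_onlyOmega hx (Complex.I, 0)
  obtain ⟨X₂, hX₂, eX₂⟩ := hP.exists_onlyOmega hx (0, 1)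
  obtain ⟨Y₂, hY₂, eY₂⟩ := hP.exists_onlyOmega hx (0, Complex.I)
  have a1 := h1 X₁ Y₁ hX₁ hY₁ (by rw [eX₁]) (by rw [eY₁])
  have a2 := h2 X₂ Y₂ hX₂ hY₂ (by rw [eX₂]) (by rw [eY₂])
  dsimp only at a1 a2
  rw [hF _ _ hX₁ hY₁, eX₁, eY₁] at a1
  rw [hF _ _ hX₂ hY₂, eX₂, eY₂] at a2
  have hr' : (r : ℂ) ≠ 0 := by exact_mod_cast hr
  have hδ' : (δ : ℂ) ≠ 0 := by exact_mod_cast hδ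
  have b1 : (2 * r : ℂ) * c.1 = 0 := by
    rw [← a1]
    simp [mul, conj]
    linear_combination (2 * r * c.1 : ℂ) * Complex.I_mul_I
  have b2 : (2 * r * δ : ℂ) * c.2 = 0 := by
    rw [← a2]
    simp [mul, conj]
    linear_combination (2 * r * δ * c.2 : ℂ) * Complex.I_mul_I
  ext1
  · exact (mul_eq_zero.1 b1).resolve_left (mul_ne_zero two_ne_zero hr')
  · exact (mul_eq_zero.1 b2).resolve_left (mul_ne_zero (mul_ne_zero two_ne_zero hr') hδ')

/-- The normalisation of `Ω₁¹` determines the coefficient of `θ` in `κ`. -/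
theorem IsParallelism.two_beta (hP : IsParallelism δ κ μ ψ) (hδ : δ ≠ 0) {x : Tot2}
    (hx : x ∈ dom δ) {β γ : A} (hβ : β + conj β = ofRe x.2.2.2)
    (h : ∀ X, κ x X = kappa0 δ x X + mul δ β (thetaHat δ x X) ∧
      μ x X = mu0 δ x X + mul δ β (omegaHat δ x X) + mul δ γ (thetaHat δ x X)) :
    2 * toQ δ β = toQ δ (ofRe x.2.2.2)
      - 3 * unitI δ * toQ δ x.2.2.1 * toQ δ (conj x.2.2.1) := by
  -- the coefficient of `h` in `κ`, written as a value of forms so that it is seen to be differentiable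
  set η : Tot2 → A := fun y => κ y hVec - kappa0 δ y hVec with hη
  have hev : κ =ᶠ[nhds x] fun y => kappa0 δ y + fmul δ η (hForm δ) y := by
    filter_upwards [(isOpen_dom δ).mem_nhds hx] with y hy
    obtain ⟨β', γ', -, h'⟩ := hP.exists_coeff hy
    refine ContinuousLinearMap.ext fun Y => ?_
    rw [add_apply, (h' Y).1, fmul_apply, hη]
    dsimp only
    rw [(h' hVec).1, thetaHat_hVec, thetaHat_apply, add_sub_cancel_left]
    refine toQ_inj (δ := δ) ?_
    simp only [map_add, toQ_mul]
    ring
  have hκd : DifferentiableAt ℝ κ x :=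
    (hP.smooth_κ.contDiffAt ((isOpen_dom δ).mem_nhds hx)).differentiableAt (by simp)
  have hk0 := differentiableAt_kappa0 hx
  have hηd : DifferentiableAt ℝ η x :=
    (hκd.clm_apply (differentiableAt_const _)).fun_sub (hk0.clm_apply (differentiableAt_const _))
  have hηx : η x = mul δ β (dMat δ x) := by
    rw [hη]
    dsimp only
    rw [(h hVec).1, thetaHat_hVec, add_sub_cancel_left]
  have hΩ : ∀ X Y, OnlyOmega δ κ μ ψ x X → OnlyOmega δ κ μ ψ x Y → Omega11 δ κ μ x X Y =
      (4 / 3 : ℝ) • Complex.I • mul δ (Complex.I • mul δ x.2.2.1 (conj x.2.2.1)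
        + Complex.I • mul δ x.2.2.1 (conj x.2.2.1) + Complex.I • mul δ x.2.2.1 (conj x.2.2.1)
        + β - conj β) (mul δ (omegaHat δ x X) (conj (omegaHat δ x Y))
        - mul δ (omegaHat δ x Y) (conj (omegaHat δ x X))) := by
    intro X Y hX hY
    have hk : extd κ x X Y = (2 : ℝ) • Complex.I • mul δ (Complex.I • mul δ x.2.2.1 (conj x.2.2.1)
        + Complex.I • mul δ x.2.2.1 (conj x.2.2.1) + Complex.I • mul δ x.2.2.1 (conj x.2.2.1)
        + β - conj β) (mul δ (omegaHat δ x X) (conj (omegaHat δ x Y))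
        - mul δ (omegaHat δ x Y) (conj (omegaHat δ x X))) := by
      have hX' := IsParallelism.values_of_onlyOmega h hX
      have hY' := IsParallelism.values_of_onlyOmega h hY
      have hdh := extd_hForm_of_onlyOmega hx hX hY
      rw [extd_congr hev, extd_add hk0 (differentiableAt_fmul δ hηd (differentiableAt_hForm δ x)),
        extd_kappa0 hx, hP.extd_omegaHat_of_onlyOmega hx hX hY,
        extd_fmul δ hηd (differentiableAt_hForm δ x), hX.hForm_eq_zero hx, hY.hForm_eq_zero hx, hηx,
        hX'.2, hX'.1, hY'.2, hY'.1, two_smul]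
      refine toQ_inj (δ := δ) ?_
      have hdh := congrArg (toQ δ) hdh
      simp only [map_add, map_sub, map_neg, toQ_mul, toQ_I, conj_add, conj_mul, conj_I, conj_conj,
        conj_zero, map_zero] at hdh ⊢
      linear_combination toQ δ β * hdh
    rw [Omega11, hk, hP.extd_phiHat_of_onlyOmega hx hX hY, wedge, wedge, bar, bar,
      ContinuousLinearMap.comp_apply, ContinuousLinearMap.comp_apply, hX.2.2.2.1, hY.2.2.2.1,
      conjL_apply, conj_zero]
    simp only [zero_mul', sub_self, smul_zero, add_zero, sub_zero]
    rw [smul_smul]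
    norm_num
  have hc := hP.eq_zero_of_noOmega hδ hx (by norm_num) hΩ (hP.norm_κ₁ x hx) (hP.norm_κ₂ x hx)
  have hc := congrArg (toQ δ) hc
  have hβ := congrArg (toQ δ) hβ
  simp only [map_add, map_sub, toQ_mul, toQ_I, map_zero] at hc hβ
  linear_combination hc + hβ

end Parallelism

/-- The coefficient `½ (S - 3 i T conj T)` of `θ` in `κ`. -/
noncomputable def beta0 (δ : ℝ) (x : Tot2) : A :=
  (1 / 2 : ℝ) • (dS x - Complex.I • (mul δ (dT x) (conj (dT x)) + mul δ (dT x) (conj (dT x))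
    + mul δ (dT x) (conj (dT x))))

theorem two_toQ_half (δ : ℝ) (a : A) : 2 * toQ δ ((1 / 2 : ℝ) • a) = toQ δ a := by
  have : (1 / 2 : ℝ) • a + (1 / 2 : ℝ) • a = a := by
    rw [← add_smul]
    norm_num
  conv_rhs => rw [← this, map_add]
  ring

theorem two_toQ_beta0 (δ : ℝ) (x : Tot2) : 2 * toQ δ (beta0 δ x) = toQ δ (ofRe x.2.2.2)
      - 3 * unitI δ * toQ δ x.2.2.1 * toQ δ (conj x.2.2.1) := by
  rw [beta0, two_toQ_half]
  simp only [map_add, map_sub, toQ_mul, toQ_I]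
  change toQ δ (ofRe x.2.2.2) - unitI δ * (toQ δ x.2.2.1 * toQ δ (conj x.2.2.1)
    + toQ δ x.2.2.1 * toQ δ (conj x.2.2.1) + toQ δ x.2.2.1 * toQ δ (conj x.2.2.1)) = _
  ring

theorem hasFDerivAt_beta0 (δ : ℝ) (x : Tot2) : DifferentiableAt ℝ (fun x => beta0 δ x) x ∧
    ∀ X, 2 * toQ δ (fderiv ℝ (fun x => beta0 δ x) x X) = toQ δ (dS X)
      - 3 * unitI δ * (toQ δ (dT X) * toQ δ (conj x.2.2.1) + toQ δ x.2.2.1 * toQ δ (conj (dT X))) := by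
  have hc := hasFDerivAt_conj_dT x
  have hm := hasFDerivAt_mul δ (f := fun x => dT x) dT.differentiableAt hc.1
  have h3 := (hm.1.fun_add hm.1).fun_add hm.1
  have hI := hasFDerivAt_I_smul h3
  have hd := (dS.differentiableAt (x := x)).fun_sub hI.1
  refine ⟨hd.const_smul (1 / 2 : ℝ), fun X => ?_⟩
  unfold beta0
  rw [fderiv_fun_const_smul hd, smul_apply, two_toQ_half, fderiv_fun_sub dS.differentiableAt hI.1,
    sub_apply, hI.2, fderiv_fun_add (hm.1.fun_add hm.1) hm.1, fderiv_fun_add hm.1 hm.1, add_apply,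
    add_apply, hm.2, hc.2, dS.fderiv, dT.fderiv]
  simp only [map_add, map_sub, toQ_mul, toQ_I]
  change _ - unitI δ * (_ * toQ δ (conj x.2.2.1) + toQ δ x.2.2.1 * _
    + (_ * toQ δ (conj x.2.2.1) + toQ δ x.2.2.1 * _)
    + (_ * toQ δ (conj x.2.2.1) + toQ δ x.2.2.1 * _)) = _
  ring

section Parallelism

variable {δ : ℝ} {κ μ ψ : Tot2 → Tot2 →L[ℝ] A}

/-- The values of `dS` on the vectors on which only `ω` does not vanish, from the equation of `dφ`. -/
theorem IsParallelism.dS_of_onlyOmega (hP : IsParallelism δ κ μ ψ) {x X : Tot2}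
    (hx : x ∈ dom δ) {β γ : A}
    (h : ∀ X, κ x X = kappa0 δ x X + mul δ β (thetaHat δ x X) ∧
      μ x X = mu0 δ x X + mul δ β (omegaHat δ x X) + mul δ γ (thetaHat δ x X))
    (hX : OnlyOmega δ κ μ ψ x X) : dS X =
      Complex.I • mul δ (mul δ (conj x.2.2.1) (ofRe x.2.2.2 - β) + conj γ) (omegaHat δ x X)
      - Complex.I • mul δ (mul δ x.2.2.1 (ofRe x.2.2.2 - conj β) + γ) (conj (omegaHat δ x X)) := by
  -- the equation of `dφ` is evaluated on `X` and on a vector with `θ = 1`, `ω = 0`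
  obtain ⟨e, he1, he2, he3, he4, he5⟩ := exists_frame_vector hx conj_one 0 0 0 0
  have hφ : phiHat δ x e = ofRe x.2.2.2 := by
    rw [phiHat_eq_omega hx, he1, he2, he3]
    refine toQ_inj (δ := δ) ?_
    simp only [map_add, map_sub, toQ_mul, toQ_I, conj_zero, map_zero, toQ_one]
    ring
  have hμ : μ x e = mul δ x.2.2.1 (ofRe x.2.2.2) + γ := by
    rw [(h e).2, mu0_apply, he1, he2, he3, he4, hφ]
    refine toQ_inj (δ := δ) ?_
    simp only [map_add, map_sub, toQ_mul, map_zero, toQ_one]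
    ring
  have hκ : κ x e = β := by
    rw [(h e).1, kappa0_apply, he1, he2, he3]
    refine toQ_inj (δ := δ) ?_
    simp only [map_add, map_sub, toQ_mul, toQ_I, conj_zero, map_zero, toQ_one]
    ring
  have hω : extd (omegaHat δ) x X e = mul δ (omegaHat δ x X) β := by
    rw [hP.d_omega x hx, wedge, wedge, hX.1, he2, hX.2.2.2.1, hκ]
    simp only [mul_zero', zero_mul', sub_self, add_zero, sub_zero]
  have hd := hP.d_phi x hx X e
  rw [extd_phiHat hx, extd_thetaHat_eq hx, hω, he1, he2, hX.1, hX.2.1, he4, he5, wedge, wedge, bar,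
    ContinuousLinearMap.comp_apply, ContinuousLinearMap.comp_apply, he2, hX.2.2.2.1, hX.1,
    hX.2.2.2.2, hμ, conjL_apply, conjL_apply] at hd
  refine toQ_inj (δ := δ) ?_
  have hd := congrArg (toQ δ) hd
  simp only [map_add, map_sub, map_neg, toQ_mul, toQ_I, conj_add, conj_sub, conj_mul, conj_I,
    conj_conj, conj_zero, conj_ofRe, map_zero, toQ_one, ofRe_zero] at hd ⊢
  linear_combination hd

/-- The normalisation of `Ω₂¹` determines the coefficient of `θ` in `μ`. -/
theorem IsParallelism.gamma_eq (hP : IsParallelism δ κ μ ψ) (hδ : δ ≠ 0) {x : Tot2}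
    (hx : x ∈ dom δ) {β γ : A} (hβ : β + conj β = ofRe x.2.2.2)
    (h : ∀ X, κ x X = kappa0 δ x X + mul δ β (thetaHat δ x X) ∧
      μ x X = mu0 δ x X + mul δ β (omegaHat δ x X) + mul δ γ (thetaHat δ x X)) :
    γ = mul δ x.2.2.1 (Complex.I • mul δ x.2.2.1 (conj x.2.2.1) - ofRe x.2.2.2) := by
  have hb : ∀ y ∈ dom δ, ∃ γ, ∀ X,
      μ y X = mu0 δ y X + mul δ (beta0 δ y) (omegaHat δ y X) + mul δ γ (thetaHat δ y X) := by
    intro y hy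
    obtain ⟨β', γ', hβ', h'⟩ := hP.exists_coeff hy
    have e : β' = beta0 δ y :=
      toQ_two_cancel ((hP.two_beta hδ hy hβ' h').trans (two_toQ_beta0 δ y).symm)
    rw [e] at h'
    exact ⟨γ', fun X => (h' X).2⟩
  have hβx : β = beta0 δ x :=
    toQ_two_cancel ((hP.two_beta hδ hx hβ h).trans (two_toQ_beta0 δ x).symm)
  -- the coefficient of `h` in `μ`, written as a value of forms so that it is seen to be differentiable
  set η : Tot2 → A := fun y =>
    μ y hVec - mu0 δ y hVec - mul δ (beta0 δ y) (omegaHat δ y hVec) with hη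
  have hev : μ =ᶠ[nhds x] fun y => mu0 δ y + fmul δ (fun y => beta0 δ y) (omegaHat δ) y
      + fmul δ η (hForm δ) y := by
    filter_upwards [(isOpen_dom δ).mem_nhds hx] with y hy
    obtain ⟨γ', h'⟩ := hb y hy
    refine ContinuousLinearMap.ext fun Y => ?_
    rw [add_apply, add_apply, h' Y, fmul_apply, fmul_apply, hη]
    dsimp only
    rw [h' hVec, thetaHat_hVec, thetaHat_apply]
    refine toQ_inj (δ := δ) ?_
    simp only [map_add, map_sub, toQ_mul]
    ring
  have hμd : DifferentiableAt ℝ μ x :=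
    (hP.smooth_μ.contDiffAt ((isOpen_dom δ).mem_nhds hx)).differentiableAt (by simp)
  have hm0 := differentiableAt_mu0 hx
  have hβd := hasFDerivAt_beta0 δ x
  have hω := differentiableAt_omegaHat δ x
  have hηd : DifferentiableAt ℝ η x :=
    ((hμd.clm_apply (differentiableAt_const _)).fun_sub
      (hm0.clm_apply (differentiableAt_const _))).fun_sub
      (hasFDerivAt_mul δ hβd.1 (hω.clm_apply (differentiableAt_const _))).1
  have hηx : η x = mul δ γ (dMat δ x) := by
    rw [hη]
    dsimp only
    rw [(h hVec).2, thetaHat_hVec, ← hβx]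
    abel
  have hΩ : ∀ X Y, OnlyOmega δ κ μ ψ x X → OnlyOmega δ κ μ ψ x Y → Omega21 δ κ μ ψ x X Y =
      (3 / 4 : ℝ) • Complex.I • mul δ
        (γ - mul δ x.2.2.1 (Complex.I • mul δ x.2.2.1 (conj x.2.2.1) - ofRe x.2.2.2))
        (mul δ (omegaHat δ x X) (conj (omegaHat δ x Y))
        - mul δ (omegaHat δ x Y) (conj (omegaHat δ x X))) := by
    intro X Y hX hY
    have hX' := IsParallelism.values_of_onlyOmega h hX
    have hY' := IsParallelism.values_of_onlyOmega h hY
    have hSX := hP.dS_of_onlyOmega hx h hX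
    have hSY := hP.dS_of_onlyOmega hx h hY
    have hBX := hβd.2 X
    have hBY := hβd.2 Y
    have hdh := extd_hForm_of_onlyOmega hx hX hY
    have hk : 2 * toQ δ (extd μ x X Y) = 3 * unitI δ * toQ δ (mul δ
        (γ - mul δ x.2.2.1 (Complex.I • mul δ x.2.2.1 (conj x.2.2.1) - ofRe x.2.2.2))
        (mul δ (omegaHat δ x X) (conj (omegaHat δ x Y))
        - mul δ (omegaHat δ x Y) (conj (omegaHat δ x X)))) := by
      have hd1 := differentiableAt_fmul δ hβd.1 hω
      rw [extd_congr hev, extd_add (hm0.fun_add hd1)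
        (differentiableAt_fmul δ hηd (differentiableAt_hForm δ x)), extd_add hm0 hd1,
        extd_mu0 hx, hP.extd_phiHat_of_onlyOmega hx hX hY, extd_fmul δ hβd.1 hω,
        hP.extd_omegaHat_of_onlyOmega hx hX hY,
        extd_fmul δ hηd (differentiableAt_hForm δ x), hX.hForm_eq_zero hx, hY.hForm_eq_zero hx, hηx,
        hX.2.1, hY.2.1]
      rw [hSX, hX'.2, hX'.1] at hBX
      rw [hSY, hY'.2, hY'.1] at hBY
      rw [hX'.2, hX'.1, hY'.2, hY'.1]
      have hdh := congrArg (toQ δ) hdh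
      have hβ := congrArg (toQ δ) hβ
      simp only [map_add, map_sub, map_neg, toQ_mul, toQ_I, conj_add, conj_mul, conj_I, conj_conj,
        map_zero] at hdh hBX hBY hβ ⊢
      linear_combination 2 * toQ δ γ * hdh + toQ δ (omegaHat δ x Y) * hBX
        - toQ δ (omegaHat δ x X) * hBY
        + 2 * toQ δ x.2.2.1 * unitI δ * (toQ δ (omegaHat δ x X) * toQ δ (conj (omegaHat δ x Y))
          - toQ δ (omegaHat δ x Y) * toQ δ (conj (omegaHat δ x X))) * hβ
    have hk : (2 : ℝ) • extd μ x X Y = (3 : ℝ) • Complex.I • mul δ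
        (γ - mul δ x.2.2.1 (Complex.I • mul δ x.2.2.1 (conj x.2.2.1) - ofRe x.2.2.2))
        (mul δ (omegaHat δ x X) (conj (omegaHat δ x Y))
        - mul δ (omegaHat δ x Y) (conj (omegaHat δ x X))) := by
      refine toQ_inj (δ := δ) ?_
      rw [two_smul, show (3 : ℝ) = 1 + 1 + 1 by norm_num, add_smul, add_smul, one_smul, map_add,
        map_add, map_add, toQ_I]
      linear_combination hk
    rw [Omega21, wedge, wedge, bar, ContinuousLinearMap.comp_apply, ContinuousLinearMap.comp_apply,
      hX.2.2.2.1, hY.2.2.2.1, hX.2.2.2.2, hY.2.2.2.2]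
    simp only [zero_mul', sub_self, smul_zero, add_zero]
    rw [show (3 / 4 : ℝ) = 1 / 4 * 3 by norm_num, mul_smul, ← hk, smul_smul]
    norm_num
  exact sub_eq_zero.1 (hP.eq_zero_of_noOmega hδ hx (by norm_num) hΩ (hP.norm_μ₁ x hx)
    (hP.norm_μ₂ x hx))

/-- On the kernel of `ω` the form `μ` is `-dT - T conj (K⁻¹ dK) + i T² conj T θ`. -/
theorem IsParallelism.mu_of_omegaHat_eq_zero (hP : IsParallelism δ κ μ ψ) (hδ : δ ≠ 0) {x X : Tot2}
    (hx : x ∈ dom δ) (hX : omegaHat δ x X = 0) :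
    μ x X = Complex.I • mul δ (mul δ x.2.2.1 (mul δ x.2.2.1 (conj x.2.2.1))) (thetaHat δ x X)
      - dT X - mul δ x.2.2.1 (conj (kForm δ x X)) := by
  obtain ⟨β, γ, hβ, h⟩ := hP.exists_coeff hx
  rw [(h X).2, hP.gamma_eq hδ hx hβ h, mu0_apply, phiHat_eq_omega hx, hX]
  refine toQ_inj (δ := δ) ?_
  simp only [map_add, map_sub, toQ_mul, toQ_I, conj_zero, map_zero]
  ring

end Parallelism

/-! ### First integrals of the chain distribution -/

/-- The matrix `a = -T conj K`, for which `dZ = a h` along the chain distribution. -/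
noncomputable def slope (δ : ℝ) (x : Tot2) : A := -mul δ (dT x) (conj (dK x))

/-- The matrix `q = 1 + i a conj Z`, for which `dW = 2 q h` along the chain distribution. -/
noncomputable def phase (δ : ℝ) (x : Tot2) : A :=
  (1, 0) + Complex.I • mul δ (slope δ x) (conj (dZ x))

/-- The coordinate `W` of the quadric. -/
noncomputable def wCoord (δ : ℝ) (x : Tot2) : A := (embed δ x.1).2

theorem hasFDerivAt_slope (δ : ℝ) (x : Tot2) : DifferentiableAt ℝ (slope δ) x ∧
    ∀ X, fderiv ℝ (slope δ) x X = -(mul δ (dT X) (conj (dK x)) + mul δ (dT x) (conj (dK X))) := by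
  have hc := hasFDerivAt_conj (f := fun x => dK x) (x := x) dK.differentiableAt
  have hm := hasFDerivAt_mul δ (f := fun x => dT x) dT.differentiableAt hc.1
  refine ⟨hm.1.fun_neg, fun X => ?_⟩
  unfold slope
  rw [fderiv_fun_neg, neg_apply, hm.2, hc.2, dK.fderiv, dT.fderiv]

theorem hasFDerivAt_phase (δ : ℝ) (x : Tot2) : DifferentiableAt ℝ (phase δ) x ∧
    ∀ X, fderiv ℝ (phase δ) x X = Complex.I • (mul δ (fderiv ℝ (slope δ) x X) (conj (dZ x))
      + mul δ (slope δ x) (conj (dZ X))) := by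
  have hc := hasFDerivAt_conj (f := fun x => dZ x) (x := x) dZ.differentiableAt
  have hm := hasFDerivAt_mul δ (hasFDerivAt_slope δ x).1 hc.1
  have hI := hasFDerivAt_I_smul hm.1
  refine ⟨hI.1.const_add _, fun X => ?_⟩
  unfold phase
  rw [fderiv_const_add, hI.2, hm.2, hc.2, dZ.fderiv]

theorem hasFDerivAt_wCoord (δ : ℝ) (x : Tot2) : DifferentiableAt ℝ (wCoord δ) x ∧
    ∀ X, toQ δ (fderiv ℝ (wCoord δ) x X) = 2 * toQ δ (hForm δ x X)
      + 2 * unitI δ * toQ δ (conj (dZ x)) * toQ δ (dZ X) := by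
  have he : DifferentiableAt ℝ (embed δ) x.1 :=
    (contDiff_embed δ).contDiffAt.differentiableAt (by simp)
  have h1 : HasFDerivAt (fun x : Tot2 => embed δ x.1) ((fderiv ℝ (embed δ) x.1).comp
      (ContinuousLinearMap.fst ℝ Base (A × A × ReA))) x :=
    he.hasFDerivAt.comp x (ContinuousLinearMap.fst ℝ Base (A × A × ReA)).hasFDerivAt
  have h2 := h1.snd
  refine ⟨h2.differentiableAt, fun X => ?_⟩
  have h3 : fderiv ℝ (wCoord δ) x X = (fderiv ℝ (embed δ) x.1 X.1).2 :=
    congrArg (fun L : Tot2 →L[ℝ] A => L X) h2.fderiv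
  rw [h3, fderiv_embed, hForm_apply, theta0_apply, two_toQ_half]
  simp only [map_add, map_sub, toQ_mul, toQ_I]
  change _ = toQ δ (ofRe X.1.2) - unitI δ * toQ δ (conj x.1.1) * toQ δ X.1.1
    + unitI δ * toQ δ x.1.1 * toQ δ (conj X.1.1)
    + 2 * unitI δ * toQ δ (conj x.1.1) * toQ δ X.1.1
  ring

section Chains

variable {δ : ℝ} {κ μ ψ : Tot2 → Tot2 →L[ℝ] A}

/-- The chain distribution is given by the equations `dZ = a h` and `da = i a² conj a h`. -/
theorem IsParallelism.mem_chainDistribution_iff (hP : IsParallelism δ κ μ ψ) (hδ : δ ≠ 0)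
    {x X : Tot2} (hx : x ∈ dom δ) : X ∈ chainDistribution δ μ x ↔
      dZ X = mul δ (slope δ x) (hForm δ x X) ∧ fderiv ℝ (slope δ) x X =
        Complex.I • mul δ (mul δ (slope δ x) (mul δ (slope δ x) (conj (slope δ x))))
          (hForm δ x X) := by
  have hT : dT x = x.2.2.1 := rfl
  have hK : dK x = x.2.1 := rfl
  have hω : omegaHat δ x X = 0 ↔ dZ X = mul δ (slope δ x) (hForm δ x X) := by
    have e : omegaHat δ x X = mul δ x.2.1 (dZ X - mul δ (slope δ x) (hForm δ x X)) := by
      rw [omegaHat_apply]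
      refine toQ_inj (δ := δ) ?_
      simp only [map_add, map_sub, map_neg, toQ_mul, slope, dMat, hT, hK]
      ring
    rw [e]
    refine ⟨fun h => sub_eq_zero.1 (mul_zero_iff δ _ _ hx h), fun h => ?_⟩
    rw [h, sub_self, mul_zero']
  have hc : X ∈ chainDistribution δ μ x ↔ omegaHat δ x X = 0 ∧ μ x X = 0 := Iff.rfl
  rw [hc, ← hω]
  refine and_congr_right fun h0 => ?_
  have e : mul δ (conj x.2.1) (μ x X) = fderiv ℝ (slope δ) x X - Complex.I •
      mul δ (mul δ (slope δ x) (mul δ (slope δ x) (conj (slope δ x)))) (hForm δ x X) := by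
    rw [hP.mu_of_omegaHat_eq_zero hδ hx h0, thetaHat_apply, (hasFDerivAt_slope δ x).2,
      ← mul_kForm hx X]
    refine toQ_inj (δ := δ) ?_
    simp only [map_add, map_sub, map_neg, toQ_mul, toQ_I, slope, dMat, conj_mul, conj_neg,
      conj_conj, hT, hK]
    ring
  rw [← sub_eq_zero (a := fderiv ℝ (slope δ) x X), ← e]
  refine ⟨fun h => ?_, fun h => mul_zero_iff δ _ _ (det_conj_ne hx) h⟩
  rw [h, mul_zero']

/-- The equation `dq = i a conj a q h` on the chain distribution. -/
theorem IsParallelism.fderiv_phase (hP : IsParallelism δ κ μ ψ) (hδ : δ ≠ 0)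
    {x X : Tot2} (hx : x ∈ dom δ) (hX : X ∈ chainDistribution δ μ x) :
    fderiv ℝ (phase δ) x X = Complex.I • mul δ (mul δ (phase δ x)
      (mul δ (slope δ x) (conj (slope δ x)))) (hForm δ x X) := by
  obtain ⟨h1, h2⟩ := (hP.mem_chainDistribution_iff hδ hx).1 hX
  rw [(hasFDerivAt_phase δ x).2, h2, h1]
  refine toQ_inj (δ := δ) ?_
  simp only [map_add, toQ_mul, toQ_I, phase, conj_mul, conj_hForm, toQ_one]
  ring

end Chains

/-- A function whose derivative vanishes on the tangent spaces of a connected immersed manifold is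
constant on it. -/
theorem eq_of_fderiv_eq_zero {N : Type} [TopologicalSpace N] [ConnectedSpace N]
    [ChartedSpace (EuclideanSpace ℝ (Fin 8)) N] [IsManifold (𝓡 8) ∞ N] {ι : N → Tot2}
    (hι : ContMDiff (𝓡 8) 𝓘(ℝ, Tot2) ∞ ι) {f : Tot2 → A} (hf : ∀ x, DifferentiableAt ℝ f x)
    {D : Tot2 → Submodule ℝ Tot2}
    (hr : ∀ n, Set.range (mfderiv (𝓡 8) 𝓘(ℝ, Tot2) ι n) = (D (ι n) : Set Tot2))
    (h : ∀ n, ∀ X ∈ D (ι n), fderiv ℝ f (ι n) X = 0) (m n : N) :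
    f (ι m) = f (ι n) := by
  have hloc : IsLocallyConstant fun n => f (ι n) := by
    rw [IsLocallyConstant.iff_eventually_eq]
    intro n
    set e := extChartAt (𝓡 8) n with he
    have ho : IsOpen e.target := isOpen_extChartAt_target n
    have hn : e n ∈ e.target := mem_extChartAt_target n
    obtain ⟨r, hr₀, hb⟩ := Metric.isOpen_iff.1 ho _ hn
    have hd : ∀ y ∈ Metric.ball (e n) r,
        HasFDerivAt (fun y : EuclideanSpace ℝ (Fin 8) => f (ι (e.symm y)))
          (0 : EuclideanSpace ℝ (Fin 8) →L[ℝ] A) y := by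
      intro y hy
      have h1 : MDifferentiableAt 𝓘(ℝ, EuclideanSpace ℝ (Fin 8)) (𝓡 8) e.symm y :=
        ((contMDiffOn_extChartAt_symm (I := 𝓡 8) (n := ∞) n).contMDiffAt
          (ho.mem_nhds (hb hy))).mdifferentiableAt (by simp)
      have h2 : MDifferentiableAt (𝓡 8) 𝓘(ℝ, Tot2) ι (e.symm y) :=
        (hι _).mdifferentiableAt (by simp)
      have h3 := (h2.comp y h1)
      have h4 : DifferentiableAt ℝ (fun y : EuclideanSpace ℝ (Fin 8) => ι (e.symm y)) y :=
        h3.differentiableAt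
      have h5 : fderiv ℝ (fun y : EuclideanSpace ℝ (Fin 8) => ι (e.symm y)) y =
          (mfderiv (𝓡 8) 𝓘(ℝ, Tot2) ι (e.symm y)).comp
          (mfderiv 𝓘(ℝ, EuclideanSpace ℝ (Fin 8)) (𝓡 8) e.symm y) := by
        rw [← mfderiv_eq_fderiv]
        exact mfderiv_comp y h2 h1
      have h6 := (hf (ι (e.symm y))).hasFDerivAt.comp y h4.hasFDerivAt
      have h7 : (fderiv ℝ f (ι (e.symm y))).comp
          (fderiv ℝ (fun y : EuclideanSpace ℝ (Fin 8) => ι (e.symm y)) y) = 0 := by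
        refine ContinuousLinearMap.ext fun v => ?_
        rw [h5]
        refine h _ _ ?_
        rw [← SetLike.mem_coe, ← hr]
        exact ⟨_, rfl⟩
      rw [h7] at h6
      exact h6
    have hc : ∀ y ∈ Metric.ball (e n) r, f (ι (e.symm y)) = f (ι (e.symm (e n))) :=
      fun y hy => Metric.isOpen_ball.is_const_of_fderiv_eq_zero (𝕜 := ℝ)
        (f := fun y : EuclideanSpace ℝ (Fin 8) => f (ι (e.symm y)))
        (convex_ball (e n) r).isPreconnected
        (fun z hz => (hd z hz).differentiableAt.differentiableWithinAt)
        (fun z hz => (hd z hz).fderiv) hy (Metric.mem_ball_self hr₀)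
    have hev : ∀ᶠ m in nhds n, e m ∈ Metric.ball (e n) r :=
      (continuousAt_extChartAt n).eventually (Metric.ball_mem_nhds _ hr₀)
    filter_upwards [hev, extChartAt_source_mem_nhds (I := 𝓡 8) n] with m h1 h2
    have h3 := hc _ h1
    rwa [e.left_inv h2, e.left_inv (mem_extChartAt_source n)] at h3
  exact hloc.apply_eq_of_isPreconnected isPreconnected_univ trivial trivial

section Chains

variable {δ : ℝ} {κ μ ψ : Tot2 → Tot2 →L[ℝ] A}

/-- Along an integral manifold of the chain distribution over the origin, `Z = ½ a₀ W`, where `a₀` is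
the value of `a` at a point over the origin. -/
theorem IsParallelism.eq_mul_wCoord (hP : IsParallelism δ κ μ ψ) (hδ : δ ≠ 0) {L : Set Tot2}
    (hL : IsConnectedIntegralManifold δ (chainDistribution δ μ) L) {x₀ : Tot2} (h₀ : x₀ ∈ L)
    (hx₀ : x₀.1 = 0) {x : Tot2} (hx : x ∈ L) :
    x.1.1 = mul δ ((1 / 2 : ℝ) • slope δ x₀) (embed δ x.1).2 := by
  obtain ⟨N, _, _, _, _, _, _, ι, hι, -, -, hr, hd, rfl⟩ := hL
  obtain ⟨n₀, rfl⟩ := h₀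
  have hz : dZ (ι n₀) = 0 := by
    change (ι n₀).1.1 = 0
    rw [hx₀]
    rfl
  have hp₀ : phase δ (ι n₀) = (1, 0) := by
    rw [phase, hz, conj_zero, mul_zero', smul_zero, add_zero]
  have hc : ∀ x, DifferentiableAt ℝ (fun x => conj (phase δ x)) x ∧
      ∀ X, fderiv ℝ (fun x => conj (phase δ x)) x X = conj (fderiv ℝ (phase δ) x X) :=
    fun x => hasFDerivAt_conj (hasFDerivAt_phase δ x).1
  -- the first integrals `q conj q = 1` and `a conj q = a₀`
  have hqq : ∀ n, mul δ (phase δ (ι n)) (conj (phase δ (ι n))) = (1, 0) := by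
    intro n
    have hm := fun x => hasFDerivAt_mul δ (hasFDerivAt_phase δ x).1 (hc x).1
    have := eq_of_fderiv_eq_zero hι (fun x => (hm x).1) hr (fun n X hX => ?_) n n₀
    · rw [this, hp₀, conj_one]
      ext1 <;> simp [mul]
    · rw [(hm _).2, (hc _).2, hP.fderiv_phase hδ (hd n) hX]
      refine toQ_inj (δ := δ) ?_
      simp only [map_add, map_neg, toQ_mul, toQ_I, conj_mul, conj_I, conj_conj, conj_hForm, map_zero]
      ring
  have haq : ∀ n, mul δ (slope δ (ι n)) (conj (phase δ (ι n))) = slope δ (ι n₀) := by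
    intro n
    have hm := fun x => hasFDerivAt_mul δ (hasFDerivAt_slope δ x).1 (hc x).1
    have := eq_of_fderiv_eq_zero hι (fun x => (hm x).1) hr (fun n X hX => ?_) n n₀
    · rw [this, hp₀, conj_one]
      ext1 <;> simp [mul]
    · rw [(hm _).2, (hc _).2, hP.fderiv_phase hδ (hd n) hX,
        ((hP.mem_chainDistribution_iff hδ (hd n)).1 hX).2]
      refine toQ_inj (δ := δ) ?_
      simp only [map_add, map_neg, toQ_mul, toQ_I, conj_mul, conj_I, conj_conj, conj_hForm, map_zero]
      ring
  obtain ⟨n, rfl⟩ := hx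
  have hw := fun x => hasFDerivAt_mul δ (f := fun _ => (1 / 2 : ℝ) • slope δ (ι n₀))
    (differentiableAt_const _) (hasFDerivAt_wCoord δ x).1
  have := eq_of_fderiv_eq_zero hι (f := fun x => dZ x - mul δ ((1 / 2 : ℝ) • slope δ (ι n₀))
    (wCoord δ x)) (fun x => dZ.differentiableAt.fun_sub (hw x).1) hr
    (fun n X hX => ?_) n n₀
  · have hw₀ : wCoord δ (ι n₀) = 0 := by
      rw [wCoord, hx₀]
      ext1 <;> simp [embed, ofRe, mul]
    rw [hz, hw₀, mul_zero', sub_zero] at this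
    exact sub_eq_zero.1 this
  · rw [fderiv_fun_sub dZ.differentiableAt (hw _).1, sub_apply, (hw _).2, dZ.fderiv,
      fderiv_fun_const]
    refine toQ_inj (δ := δ) ?_
    have h1 := congrArg (toQ δ) ((hP.mem_chainDistribution_iff hδ (hd n)).1 hX).1
    have h2 := congrArg (toQ δ) (hqq n)
    have h3 := congrArg (toQ δ) (haq n)
    have h4 := (hasFDerivAt_wCoord δ (ι n)).2 X
    have h5 := two_toQ_half δ (slope δ (ι n₀))
    have h6 : toQ δ (phase δ (ι n)) =
        1 + unitI δ * (toQ δ (slope δ (ι n)) * toQ δ (conj (dZ (ι n)))) := by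
      rw [phase, map_add, toQ_I, toQ_mul, toQ_one]
    simp only [Pi.zero_apply, zero_apply, zero_mul', zero_add, map_sub, map_zero, toQ_mul, toQ_one]
      at h1 h2 h3 ⊢
    rw [h4, h1]
    linear_combination 2 * toQ δ ((1 / 2 : ℝ) • slope δ (ι n₀)) * toQ δ (hForm δ (ι n) X) * h6
      - toQ δ (hForm δ (ι n) X) * toQ δ (phase δ (ι n)) * h5
      + toQ δ (hForm δ (ι n) X) * toQ δ (phase δ (ι n)) * h3
      - toQ δ (slope δ (ι n)) * toQ δ (hForm δ (ι n) X) * h2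

end Chains

/-! ### Parametrised integral manifolds -/

/-- A connected integral manifold from a local parametrisation. -/
theorem exists_isConnectedIntegralManifold {E : Type} [NormedAddCommGroup E] [NormedSpace ℝ E]
    (e : EuclideanSpace ℝ (Fin 8) ≃L[ℝ] E) {δ : ℝ} {Δ : Tot2 → Submodule ℝ Tot2} {F : E → Tot2}
    {O : Set E} (hO : IsOpen O) (hF : ContDiffOn ℝ ∞ F O) (hi : Set.InjOn F O)
    (hd : ∀ p ∈ O, Function.Injective (fderiv ℝ F p))
    (hr : ∀ p ∈ O, Set.range (fderiv ℝ F p) = (Δ (F p) : Set Tot2))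
    (hm : ∀ p ∈ O, F p ∈ dom δ) {c : E} (hc : c ∈ O) :
    ∃ U ∈ nhds c, IsConnectedIntegralManifold δ Δ (F '' U) := by
  have ho : IsOpen (e ⁻¹' O) := hO.preimage e.continuous
  have hc' : e.symm c ∈ e ⁻¹' O := by
    rw [Set.mem_preimage, e.apply_symm_apply]
    exact hc
  obtain ⟨r, hr₀, hb⟩ := Metric.isOpen_iff.1 ho _ hc'
  set u := OpenPartialHomeomorph.univBall (e.symm c) r with hu
  have hut : u.target = Metric.ball (e.symm c) r := OpenPartialHomeomorph.univBall_target _ hr₀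
  have hus : u.source = Set.univ := OpenPartialHomeomorph.univBall_source _ _
  have hmem : ∀ n, u n ∈ Metric.ball (e.symm c) r := by
    intro n
    rw [← hut]
    exact u.map_source (by rw [hus]; trivial)
  have huO : ∀ n, e (u n) ∈ O := fun n => hb (hmem n)
  have hud : ContDiff ℝ ∞ u := OpenPartialHomeomorph.contDiff_univBall
  have hus' : ∀ y ∈ Metric.ball (e.symm c) r, DifferentiableAt ℝ u.symm y := by
    intro y hy
    have h : ContDiffOn ℝ ∞ u.symm (Metric.ball (e.symm c) r) :=
      OpenPartialHomeomorph.contDiffOn_univBall_symm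
    exact (h.contDiffAt (Metric.isOpen_ball.mem_nhds hy)).differentiableAt (by simp)
  have hudn : ∀ n, DifferentiableAt ℝ u n := fun n => hud.contDiffAt.differentiableAt (by simp)
  have hl : ∀ n, Function.Injective (fderiv ℝ u n) := by
    intro n
    have h1 := (hus' _ (hmem n)).hasFDerivAt.comp n (hudn n).hasFDerivAt
    have h2 : (u.symm ∘ u) = id := funext fun m => u.left_inv (by rw [hus]; trivial)
    rw [h2] at h1
    have h3 := h1.unique (hasFDerivAt_id n)
    intro v w hvw
    have h4 := fun v => congrArg (fun L => L v) h3
    simp only [ContinuousLinearMap.comp_apply, ContinuousLinearMap.id_apply] at h4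
    rw [← h4 v, ← h4 w, hvw]
  have hsurj : ∀ n, Function.Surjective (fderiv ℝ u n) := fun n =>
    (LinearMap.injective_iff_surjective (f := (fderiv ℝ u n).toLinearMap)).1 (hl n)
  have hFd : ∀ p ∈ O, DifferentiableAt ℝ F p := fun p hp =>
    (hF.contDiffAt (hO.mem_nhds hp)).differentiableAt (by simp)
  have hder : ∀ n, mfderiv (𝓡 8) 𝓘(ℝ, Tot2) (fun n => F (e (u n))) n =
      (fderiv ℝ F (e (u n))).comp ((e : _ →L[ℝ] E).comp (fderiv ℝ u n)) := by
    intro n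
    rw [mfderiv_eq_fderiv]
    exact ((hFd _ (huO n)).hasFDerivAt.comp n
      (e.hasFDerivAt.comp n (hudn n).hasFDerivAt)).fderiv
  refine ⟨e '' Metric.ball (e.symm c) r, ?_, EuclideanSpace ℝ (Fin 8), inferInstance, inferInstance,
    inferInstance, inferInstance, inferInstance, inferInstance, fun n => F (e (u n)), ?_, ?_, ?_, ?_,
    fun n => hm _ (huO n), ?_⟩
  · have h := e.toHomeomorph.isOpenMap.image_mem_nhds (Metric.ball_mem_nhds (e.symm c) hr₀)
    have h' : e.toHomeomorph (e.symm c) = c := e.apply_symm_apply c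
    rw [h'] at h
    exact h
  · rw [contMDiff_iff_contDiff]
    rw [contDiff_iff_contDiffAt]
    intro n
    exact (hF.contDiffAt (hO.mem_nhds (huO n))).comp n
      (e.contDiff.contDiffAt.comp n hud.contDiffAt)
  · intro n m h
    have h1 := e.injective (hi (huO n) (huO m) h)
    exact u.injOn (by rw [hus]; trivial) (by rw [hus]; trivial) h1
  · intro n
    rw [hder n]
    exact (hd _ (huO n)).comp (e.injective.comp (hl n))
  · intro n
    rw [← hr _ (huO n), hder n]
    exact ((e.surjective.comp (hsurj n)).range_comp (fderiv ℝ F (e (u n))))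
  · have h1 : Set.range u = Metric.ball (e.symm c) r := by
      rw [← hut, ← u.image_source_eq_target, hus, Set.image_univ]
    rw [← h1, ← Set.range_comp, ← Set.range_comp]
    rfl

/-! ### The curves `Z = a W` on the quadric -/

/-- The condition on `W` for `(a W, W)` to lie on the quadric: `Im W = a conj a W conj W`. -/
def chainCurve (δ : ℝ) (a : A) : Set A :=
  {w | w - conj w = Complex.I • (mul δ (mul δ a (conj a)) (mul δ w (conj w))
    + mul δ (mul δ a (conj a)) (mul δ w (conj w)))}

/-- The function `q = 1 + 2 i a conj a W`, the phase along the curve `Z = a W`. -/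
noncomputable def curvePhase (δ : ℝ) (a w : A) : A :=
  (1, 0) + Complex.I • (mul δ (mul δ a (conj a)) w + mul δ (mul δ a (conj a)) w)

/-- The point of the second bundle over the point `(a W, W)` of the quadric, with the coordinates
`K`, `S`, at which the chain through that point has the direction of the curve `Z = a W`. -/
noncomputable def chainPoint (δ : ℝ) (a K : A) (S : ReA) (w : A) : Tot2 :=
  ((mul δ a w, (w.1.re, w.2.re)), K,
    -mul δ (mul δ (a + a) (curvePhase δ a w)) (inv δ (conj K)), S)

theorem mem_chainCurve {δ : ℝ} {a w : A} (hw : w ∈ chainCurve δ a) :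
    toQ δ w - toQ δ (conj w) = 2 * unitI δ * toQ δ a * toQ δ (conj a) * toQ δ w * toQ δ (conj w) := by
  have h := congrArg (toQ δ) (show w - conj w = _ from hw)
  simp only [map_add, map_sub, toQ_mul, toQ_I] at h
  linear_combination h

theorem toQ_curvePhase (δ : ℝ) (a w : A) : toQ δ (curvePhase δ a w) =
    1 + 2 * unitI δ * toQ δ a * toQ δ (conj a) * toQ δ w := by
  simp only [curvePhase, map_add, toQ_mul, toQ_I, toQ_one]
  ring

theorem toQ_conj_curvePhase (δ : ℝ) (a w : A) : toQ δ (conj (curvePhase δ a w)) =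
    1 - 2 * unitI δ * toQ δ a * toQ δ (conj a) * toQ δ (conj w) := by
  simp only [curvePhase, map_add, map_neg, toQ_mul, toQ_I, toQ_one, conj_add, conj_one, conj_mul,
    conj_I, conj_conj]
  ring

theorem curvePhase_mul_conj {δ : ℝ} {a w : A} (hw : w ∈ chainCurve δ a) :
    toQ δ (curvePhase δ a w) * toQ δ (conj (curvePhase δ a w)) = 1 := by
  rw [toQ_curvePhase, toQ_conj_curvePhase]
  linear_combination 2 * unitI δ * toQ δ a * toQ δ (conj a) * mem_chainCurve hw

theorem embed_chainPoint {δ : ℝ} {a w : A} (hw : w ∈ chainCurve δ a) (K : A) (S : ReA) :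
    embed δ (chainPoint δ a K S w).1 = (mul δ a w, w) := by
  ext1
  · rfl
  · refine toQ_two_cancel (δ := δ) ?_
    have h1 : ofRe (w.1.re, w.2.re) + ofRe (w.1.re, w.2.re) = w + conj w := by
      ext1 <;> apply Complex.ext <;> simp [ofRe, conj]
    have h1 := congrArg (toQ δ) h1
    change 2 * toQ δ (ofRe (w.1.re, w.2.re) + Complex.I • mul δ (mul δ a w) (conj (mul δ a w))) = _
    simp only [map_add, toQ_mul, toQ_I, conj_mul] at h1 ⊢
    linear_combination h1 - mem_chainCurve hw

theorem slope_chainPoint {δ : ℝ} {a K w : A} (hK : det δ K ≠ 0) (S : ReA) :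
    slope δ (chainPoint δ a K S w) = mul δ (a + a) (curvePhase δ a w) := by
  have hi := toQ_inv δ _ (det_conj_ne hK)
  refine toQ_inj (δ := δ) ?_
  change toQ δ (-mul δ (-mul δ (mul δ (a + a) (curvePhase δ a w)) (inv δ (conj K))) (conj K)) = _
  simp only [map_neg, map_add, toQ_mul]
  linear_combination (toQ δ a + toQ δ a) * toQ δ (curvePhase δ a w) * hi

/-- The denominator `1 - i a conj a t` of the rational parametrisation of the curve. -/
noncomputable def curveDenom (δ : ℝ) (a t : A) : A :=
  (1, 0) - Complex.I • mul δ (mul δ a (conj a)) t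

/-- The parametrisation `t ↦ w₀ + q(w₀) t (1 - i a conj a t)⁻¹` of the curve near its point `w₀`. -/
noncomputable def curveParam (δ : ℝ) (a w₀ t : A) : A :=
  w₀ + mul δ (curvePhase δ a w₀) (mul δ t (inv δ (curveDenom δ a t)))

theorem toQ_curveDenom (δ : ℝ) (a t : A) : toQ δ (curveDenom δ a t) =
    1 - unitI δ * toQ δ a * toQ δ (conj a) * toQ δ t := by
  simp only [curveDenom, map_sub, toQ_mul, toQ_I, toQ_one]
  ring

theorem toQ_conj_curveDenom (δ : ℝ) (a : A) (t : ReA) : toQ δ (conj (curveDenom δ a (ofRe t))) =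
    1 + unitI δ * toQ δ a * toQ δ (conj a) * toQ δ (ofRe t) := by
  simp only [curveDenom, map_neg, map_sub, toQ_mul, toQ_I, toQ_one, conj_sub, conj_one, conj_mul,
    conj_I, conj_conj, conj_ofRe]
  ring

theorem toQ_curveParam (δ : ℝ) (a w₀ t : A) : toQ δ (curveParam δ a w₀ t) =
    toQ δ w₀ + toQ δ (curvePhase δ a w₀) * (toQ δ t * toQ δ (inv δ (curveDenom δ a t))) := by
  simp only [curveParam, map_add, toQ_mul]

theorem curveParam_mem {δ : ℝ} {a w₀ : A} (hw : w₀ ∈ chainCurve δ a) {t : ReA}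
    (ht : det δ (curveDenom δ a (ofRe t)) ≠ 0) : curveParam δ a w₀ (ofRe t) ∈ chainCurve δ a := by
  have h1 := toQ_inv δ _ ht
  have h2 := congrArg (fun a => toQ δ (conj a)) (mul_inv δ _ ht)
  have h0 := mem_chainCurve hw
  rw [conj_mul, toQ_mul, conj_one, toQ_one, toQ_conj_curveDenom] at h2
  rw [toQ_curveDenom] at h1
  refine toQ_inj (δ := δ) ?_
  have e1 := toQ_curveParam δ a w₀ (ofRe t)
  have e2 : toQ δ (conj (curveParam δ a w₀ (ofRe t))) = toQ δ (conj w₀)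
      + toQ δ (conj (curvePhase δ a w₀)) *
        (toQ δ (ofRe t) * toQ δ (conj (inv δ (curveDenom δ a (ofRe t))))) := by
    simp only [curveParam, conj_add, conj_mul, conj_ofRe, map_add, toQ_mul]
  rw [toQ_curvePhase] at e1
  rw [toQ_conj_curvePhase] at e2
  simp only [map_add, map_sub, toQ_mul, toQ_I]
  rw [e1, e2]
  set j := toQ δ (inv δ (curveDenom δ a (ofRe t)))
  set j' := toQ δ (conj (inv δ (curveDenom δ a (ofRe t))))
  set N := toQ δ a * toQ δ (conj a) with hN
  set s := toQ δ (ofRe t)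
  linear_combination h0 + (1 + 2 * unitI δ * N * toQ δ w₀)
    * (1 - 2 * unitI δ * N * toQ δ (conj w₀)) * s * (j' * h1 - j * h2)

/-! ### Integral manifolds over the curves -/

theorem contDiffAt_mul {V : Type} [NormedAddCommGroup V] [NormedSpace ℝ V] (δ : ℝ) {f g : V → A}
    {x : V} (hf : ContDiffAt ℝ ∞ f x) (hg : ContDiffAt ℝ ∞ g x) :
    ContDiffAt ℝ ∞ (fun x => mul δ (f x) (g x)) x := by
  unfold mul
  fun_prop

theorem contDiffAt_inv {V : Type} [NormedAddCommGroup V] [NormedSpace ℝ V] (δ : ℝ) {f : V → A}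
    {x : V} (hf : ContDiffAt ℝ ∞ f x) (h0 : det δ (f x) ≠ 0) :
    ContDiffAt ℝ ∞ (fun x => inv δ (f x)) x := by
  have h1 : ContDiffAt ℝ ∞ (fun x => (f x).1) x := hf.fst
  have h2 : ContDiffAt ℝ ∞ (fun x => (f x).2) x := hf.snd
  have hd : ContDiffAt ℝ ∞ (fun x => det δ (f x)) x := by
    unfold det
    fun_prop
  have hdi := hd.inv h0
  unfold inv
  simp only [div_eq_mul_inv]
  exact (h1.mul hdi).prodMk (h2.neg.mul hdi)

/-- The parameters of an integral manifold of the chain distribution: the parameter `t` of the chain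
and the coordinates `K` and `S`. -/
abbrev Param : Type := ReA × A × ReA

/-- An integral manifold of the chain distribution over a part of the curve `Z = a W`. -/
noncomputable def chainParam (δ : ℝ) (a w₀ : A) (p : Param) : Tot2 :=
  chainPoint δ a p.2.1 p.2.2 (curveParam δ a w₀ (ofRe p.1))

/-- The domain of `chainParam`. -/
def paramDom (δ : ℝ) (a : A) : Set Param :=
  {p | det δ (curveDenom δ a (ofRe p.1)) ≠ 0 ∧ det δ p.2.1 ≠ 0}

theorem contDiff_curveDenom (δ : ℝ) (a : A) :
    ContDiff ℝ ∞ fun p : Param => curveDenom δ a (ofRe p.1) := by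
  unfold curveDenom
  simp only [← ofReL_apply]
  exact contDiff_const.sub
    (ContDiff.const_smul Complex.I (contDiff_mul δ contDiff_const (by fun_prop)))

theorem isOpen_paramDom (δ : ℝ) (a : A) : IsOpen (paramDom δ a) := by
  have h := (contDiff_curveDenom δ a).continuous
  refine (isOpen_ne_fun ?_ continuous_const).inter (isOpen_ne_fun ?_ continuous_const)
  · unfold det
    fun_prop
  · unfold det
    fun_prop

theorem contDiffAt_curveParam {δ : ℝ} {a : A} (w₀ : A) {p : Param} (hp : p ∈ paramDom δ a) :
    ContDiffAt ℝ ∞ (fun p : Param => curveParam δ a w₀ (ofRe p.1)) p := by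
  have h := contDiffAt_inv δ (contDiff_curveDenom δ a).contDiffAt hp.1
  have ht : ContDiffAt ℝ ∞ (fun p : Param => ofRe p.1) p := by
    simp only [← ofReL_apply]
    fun_prop
  exact contDiffAt_const.add (contDiffAt_mul δ contDiffAt_const (contDiffAt_mul δ ht h))

theorem contDiffAt_chainParam {δ : ℝ} {a : A} (w₀ : A) {p : Param} (hp : p ∈ paramDom δ a) :
    ContDiffAt ℝ ∞ (chainParam δ a w₀) p := by
  have hw := contDiffAt_curveParam w₀ hp
  have hK : ContDiffAt ℝ ∞ (fun p : Param => conj p.2.1) p := by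
    simp only [← conjL_apply]
    fun_prop
  have hi := contDiffAt_inv δ hK (det_conj_ne hp.2)
  have hc : ContDiffAt ℝ ∞ (fun _ : Param => mul δ a (conj a)) p := contDiffAt_const
  have hq : ContDiffAt ℝ ∞ (fun p : Param => curvePhase δ a (curveParam δ a w₀ (ofRe p.1))) p :=
    contDiffAt_const.add (((contDiffAt_mul δ hc hw).add (contDiffAt_mul δ hc hw)).const_smul _)
  have hre : ContDiff ℝ ∞ Complex.re := Complex.reCLM.contDiff
  have h1 : ContDiffAt ℝ ∞ (fun p : Param => ((curveParam δ a w₀ (ofRe p.1)).1.re,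
      (curveParam δ a w₀ (ofRe p.1)).2.re)) p :=
    (hre.contDiffAt.comp p hw.fst).prodMk (hre.contDiffAt.comp p hw.snd)
  have h2 := contDiffAt_mul δ (contDiffAt_const (c := a)) hw
  have h3 := (contDiffAt_mul δ (contDiffAt_mul δ (contDiffAt_const (c := a + a)) hq) hi).neg
  have hK' : ContDiffAt ℝ ∞ (fun p : Param => p.2.1) p := by fun_prop
  have hS' : ContDiffAt ℝ ∞ (fun p : Param => p.2.2) p := by fun_prop
  exact (h2.prodMk h1).prodMk (hK'.prodMk (h3.prodMk hS'))

theorem fderiv_curveParam {δ : ℝ} {a : A} (w₀ : A) {p : Param} (hp : p ∈ paramDom δ a) (v : Param) :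
    toQ δ (curveDenom δ a (ofRe p.1)) ^ 2
      * toQ δ (fderiv ℝ (fun p : Param => curveParam δ a w₀ (ofRe p.1)) p v) =
      toQ δ (curvePhase δ a w₀) * toQ δ (ofRe v.1) := by
  set T : Param →L[ℝ] A := ofReL.comp (ContinuousLinearMap.fst ℝ ReA (A × ReA)) with hT
  have hTd : DifferentiableAt ℝ (fun p => T p) p := T.differentiableAt
  have hN := hasFDerivAt_mul δ (differentiableAt_const (mul δ a (conj a))) hTd
  have hI := hasFDerivAt_I_smul hN.1
  have hc : DifferentiableAt ℝ (fun p => curveDenom δ a (T p)) p ∧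
      ∀ v, fderiv ℝ (fun p => curveDenom δ a (T p)) p v =
        -(Complex.I • mul δ (mul δ a (conj a)) (T v)) := by
    refine ⟨hI.1.const_sub _, fun v => ?_⟩
    unfold curveDenom
    rw [fderiv_const_sub, neg_apply, hI.2, hN.2, fderiv_fun_const, T.fderiv, Pi.zero_apply,
      zero_apply, zero_mul', zero_add]
  have hW : DifferentiableAt ℝ (fun p : Param => curveParam δ a w₀ (T p)) p :=
    (contDiffAt_curveParam w₀ hp).differentiableAt (by simp)
  have hWs := hW.sub_const w₀
  have h1 := (hasFDerivAt_mul δ hc.1 hWs).2 v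
  have h2 := (hasFDerivAt_mul δ (differentiableAt_const (curvePhase δ a w₀)) hTd).2 v
  have hev : (fun p => mul δ (curveDenom δ a (T p)) (curveParam δ a w₀ (T p) - w₀)) =ᶠ[nhds p]
      fun p => mul δ (curvePhase δ a w₀) (T p) := by
    filter_upwards [(isOpen_paramDom δ a).mem_nhds hp] with y hy
    refine toQ_inj (δ := δ) ?_
    have h := toQ_inv δ _ hy.1
    change toQ δ (curveDenom δ a (T y)) * toQ δ (inv δ (curveDenom δ a (T y))) = 1 at h
    simp only [toQ_mul, map_sub, toQ_curveParam]
    linear_combination toQ δ (curvePhase δ a w₀) * toQ δ (T y) * h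
  have h3 := congrArg (toQ δ) (hev.eq_of_nhds)
  rw [hev.fderiv_eq, h2, fderiv_sub_const, hc.2, fderiv_fun_const, T.fderiv] at h1
  have h1 := congrArg (toQ δ) h1
  simp only [map_add, map_sub, map_neg, toQ_mul, toQ_I, Pi.zero_apply, zero_apply, map_zero] at h1 h3
  have h4 := toQ_curveDenom δ a (T p)
  change toQ δ (curveDenom δ a (T p)) ^ 2
      * toQ δ (fderiv ℝ (fun p : Param => curveParam δ a w₀ (T p)) p v) =
      toQ δ (curvePhase δ a w₀) * toQ δ (T v)
  linear_combination (-toQ δ (curveDenom δ a (T p))) * h1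
    + unitI δ * toQ δ a * toQ δ (conj a) * toQ δ (T v) * h3
    + toQ δ (curvePhase δ a w₀) * toQ δ (T v) * h4

theorem injOn_chainParam {δ : ℝ} {a w₀ : A} (hw : w₀ ∈ chainCurve δ a) :
    Set.InjOn (chainParam δ a w₀) (paramDom δ a) := by
  rintro ⟨t, K, S⟩ hp ⟨t', K', S'⟩ hp' h
  have hK : K = K' := congrArg (fun x : Tot2 => x.2.1) h
  have hS : S = S' := congrArg (fun x : Tot2 => x.2.2.2) h
  have hW : curveParam δ a w₀ (ofRe t) = curveParam δ a w₀ (ofRe t') := by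
    have h1 := congrArg (fun x : Tot2 => (embed δ x.1).2) h
    have e1 := embed_chainPoint (curveParam_mem hw hp.1) K S
    have e2 := embed_chainPoint (curveParam_mem hw hp'.1) K' S'
    exact (congrArg Prod.snd e1).symm.trans (h1.trans (congrArg Prod.snd e2))
  have hW := congrArg (toQ δ) hW
  rw [toQ_curveParam, toQ_curveParam] at hW
  have hq := curvePhase_mul_conj hw
  have h1 := toQ_inv δ _ hp.1
  have h2 := toQ_inv δ _ hp'.1
  dsimp only at h1 h2
  have e1 := toQ_curveDenom δ a (ofRe t)
  have e2 := toQ_curveDenom δ a (ofRe t')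
  set c := toQ δ (curveDenom δ a (ofRe t))
  set c' := toQ δ (curveDenom δ a (ofRe t'))
  have ht : toQ δ (ofRe t) = toQ δ (ofRe t') := by
    linear_combination c * c' * toQ δ (conj (curvePhase δ a w₀)) * hW
      - toQ δ (ofRe t) * c' * c * toQ δ (inv δ (curveDenom δ a (ofRe t))) * hq
      + toQ δ (ofRe t') * c * c' * toQ δ (inv δ (curveDenom δ a (ofRe t'))) * hq
      - toQ δ (ofRe t) * c' * h1 + toQ δ (ofRe t') * c * h2
      - toQ δ (ofRe t) * e2 + toQ δ (ofRe t') * e1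
  have ht : t = t' := ofRe_inj _ _ (toQ_inj ht)
  rw [ht, hK, hS]

section Tangent

variable {δ : ℝ} {a w₀ : A} {p : Param}

theorem fderiv_comp_chainParam (hp : p ∈ paramDom δ a) {f : Tot2 → A} {g : Param → A}
    (hf : DifferentiableAt ℝ f (chainParam δ a w₀ p))
    (h : ∀ p ∈ paramDom δ a, f (chainParam δ a w₀ p) = g p) (v : Param) :
    fderiv ℝ f (chainParam δ a w₀ p) (fderiv ℝ (chainParam δ a w₀) p v) = fderiv ℝ g p v := by
  have hd : DifferentiableAt ℝ (chainParam δ a w₀) p :=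
    (contDiffAt_chainParam w₀ hp).differentiableAt (by simp)
  have hev : (fun p => f (chainParam δ a w₀ p)) =ᶠ[nhds p] g := by
    filter_upwards [(isOpen_paramDom δ a).mem_nhds hp] with y hy
    exact h y hy
  rw [← hev.fderiv_eq]
  exact congrArg (fun L : Param →L[ℝ] A => L v)
    (hf.hasFDerivAt.comp p hd.hasFDerivAt).fderiv.symm

/-- The values of the coordinate forms on the tangent vectors of the integral manifold, in terms of
the derivative of `W`. -/
theorem fderiv_chainParam (hw : w₀ ∈ chainCurve δ a) (hp : p ∈ paramDom δ a) (v : Param) :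
    dZ (fderiv ℝ (chainParam δ a w₀) p v) =
      mul δ a (fderiv ℝ (fun p : Param => curveParam δ a w₀ (ofRe p.1)) p v) ∧
    dK (fderiv ℝ (chainParam δ a w₀) p v) = v.2.1 ∧
    dS (fderiv ℝ (chainParam δ a w₀) p v) = ofRe v.2.2 ∧
    2 * toQ δ (hForm δ (chainParam δ a w₀ p) (fderiv ℝ (chainParam δ a w₀) p v)) =
      toQ δ (conj (curvePhase δ a (curveParam δ a w₀ (ofRe p.1))))
        * toQ δ (fderiv ℝ (fun p : Param => curveParam δ a w₀ (ofRe p.1)) p v) ∧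
    toQ δ (fderiv ℝ (slope δ) (chainParam δ a w₀ p) (fderiv ℝ (chainParam δ a w₀) p v)) =
      4 * unitI δ * toQ δ a ^ 2 * toQ δ (conj a)
        * toQ δ (fderiv ℝ (fun p : Param => curveParam δ a w₀ (ofRe p.1)) p v) := by
  set x := chainParam δ a w₀ p with hx
  set X := fderiv ℝ (chainParam δ a w₀) p v with hX
  have hW : DifferentiableAt ℝ (fun p : Param => curveParam δ a w₀ (ofRe p.1)) p :=
    (contDiffAt_curveParam w₀ hp).differentiableAt (by simp)
  have hm := fun b : A => hasFDerivAt_mul δ (differentiableAt_const b) hW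
  have hm' : ∀ b : A, fderiv ℝ (fun p : Param => mul δ b (curveParam δ a w₀ (ofRe p.1))) p v =
      mul δ b (fderiv ℝ (fun p : Param => curveParam δ a w₀ (ofRe p.1)) p v) := by
    intro b
    rw [(hm b).2, fderiv_fun_const, Pi.zero_apply, zero_apply, zero_mul', zero_add]
  have hZ : dZ X = mul δ a (fderiv ℝ (fun p : Param => curveParam δ a w₀ (ofRe p.1)) p v) := by
    have h := fderiv_comp_chainParam (w₀ := w₀) hp (f := dZ) dZ.differentiableAt
      (g := fun p => mul δ a (curveParam δ a w₀ (ofRe p.1))) (fun _ _ => rfl) v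
    rw [dZ.fderiv, hm'] at h
    exact h
  refine ⟨hZ, ?_, ?_, ?_, ?_⟩
  · have h := fderiv_comp_chainParam (w₀ := w₀) hp (f := dK) dK.differentiableAt
      (g := (ContinuousLinearMap.fst ℝ A ReA).comp (ContinuousLinearMap.snd ℝ ReA (A × ReA)))
      (fun _ _ => rfl) v
    rw [dK.fderiv, ContinuousLinearMap.fderiv] at h
    exact h
  · have h := fderiv_comp_chainParam (w₀ := w₀) hp (f := dS) dS.differentiableAt
      (g := ofReL.comp ((ContinuousLinearMap.snd ℝ A ReA).comp
        (ContinuousLinearMap.snd ℝ ReA (A × ReA)))) (fun _ _ => rfl) v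
    rw [dS.fderiv, ContinuousLinearMap.fderiv] at h
    exact h
  · have h := fderiv_comp_chainParam (w₀ := w₀) hp (f := wCoord δ) (hasFDerivAt_wCoord δ _).1
      (g := fun p => curveParam δ a w₀ (ofRe p.1)) (fun p hp =>
        congrArg Prod.snd (embed_chainPoint (curveParam_mem hw hp.1) p.2.1 p.2.2)) v
    have h1 := (hasFDerivAt_wCoord δ x).2 X
    rw [h, hZ] at h1
    have h2 : dZ x = mul δ a (curveParam δ a w₀ (ofRe p.1)) := rfl
    rw [h2] at h1
    simp only [conj_mul, toQ_mul] at h1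
    rw [toQ_conj_curvePhase]
    linear_combination -h1
  · have hc := hm (mul δ a (conj a))
    have hI := hasFDerivAt_I_smul (hc.1.fun_add hc.1)
    have hq : DifferentiableAt ℝ
        (fun p : Param => curvePhase δ a (curveParam δ a w₀ (ofRe p.1))) p := hI.1.const_add _
    have hm2 := hasFDerivAt_mul δ (differentiableAt_const (a + a)) hq
    have h := fderiv_comp_chainParam (w₀ := w₀) hp (f := slope δ) (hasFDerivAt_slope δ _).1
      (g := fun p => mul δ (a + a) (curvePhase δ a (curveParam δ a w₀ (ofRe p.1))))
      (fun p hp => slope_chainPoint hp.2 p.2.2) v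
    have e : fderiv ℝ (fun p : Param => curvePhase δ a (curveParam δ a w₀ (ofRe p.1))) p v =
        Complex.I • (mul δ (mul δ a (conj a))
          (fderiv ℝ (fun p : Param => curveParam δ a w₀ (ofRe p.1)) p v)
          + mul δ (mul δ a (conj a))
          (fderiv ℝ (fun p : Param => curveParam δ a w₀ (ofRe p.1)) p v)) := by
      unfold curvePhase
      rw [fderiv_const_add, hI.2, fderiv_fun_add hc.1 hc.1, add_apply, hm']
    rw [h, hm2.2, e, fderiv_fun_const, Pi.zero_apply, zero_apply, zero_mul', zero_add]
    simp only [map_add, toQ_mul, toQ_I]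
    ring

variable {κ μ ψ : Tot2 → Tot2 →L[ℝ] A}

theorem IsParallelism.fderiv_chainParam_mem (hP : IsParallelism δ κ μ ψ) (hδ : δ ≠ 0)
    (hw : w₀ ∈ chainCurve δ a) (hp : p ∈ paramDom δ a) (v : Param) :
    fderiv ℝ (chainParam δ a w₀) p v ∈ chainDistribution δ μ (chainParam δ a w₀ p) := by
  obtain ⟨h1, -, -, h2, h3⟩ := fderiv_chainParam hw hp v
  have hx : chainParam δ a w₀ p ∈ dom δ := hp.2
  have hs : slope δ (chainParam δ a w₀ p) =
    mul δ (a + a) (curvePhase δ a (curveParam δ a w₀ (ofRe p.1))) := slope_chainPoint hp.2 p.2.2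
  have hq := curvePhase_mul_conj (curveParam_mem hw hp.1)
  refine (hP.mem_chainDistribution_iff hδ hx).2 ⟨?_, ?_⟩
  · rw [h1, hs]
    refine toQ_inj (δ := δ) ?_
    simp only [map_add, toQ_mul]
    linear_combination (-toQ δ a * toQ δ (curvePhase δ a (curveParam δ a w₀ (ofRe p.1)))) * h2
      - toQ δ a * toQ δ (fderiv ℝ (fun p : Param => curveParam δ a w₀ (ofRe p.1)) p v) * hq
  · rw [hs]
    refine toQ_inj (δ := δ) ?_
    simp only [map_add, toQ_mul, toQ_I, conj_add, conj_mul]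
    rw [h3]
    set q := toQ δ (curvePhase δ a (curveParam δ a w₀ (ofRe p.1)))
    set q' := toQ δ (conj (curvePhase δ a (curveParam δ a w₀ (ofRe p.1))))
    linear_combination (-4 * unitI δ * toQ δ a ^ 2 * toQ δ (conj a) * q ^ 2 * q') * h2
      - 4 * unitI δ * toQ δ a ^ 2 * toQ δ (conj a)
        * toQ δ (fderiv ℝ (fun p : Param => curveParam δ a w₀ (ofRe p.1)) p v) * (q * q' + 1) * hq

theorem injective_fderiv_chainParam (hw : w₀ ∈ chainCurve δ a) (hp : p ∈ paramDom δ a) :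
    Function.Injective (fderiv ℝ (chainParam δ a w₀) p) := by
  rw [injective_iff_map_eq_zero]
  intro v hv
  obtain ⟨-, h2, h3, h4, -⟩ := fderiv_chainParam hw hp v
  have h5 := fderiv_curveParam w₀ hp v
  have hq := curvePhase_mul_conj (curveParam_mem hw hp.1)
  have hq₀ := curvePhase_mul_conj hw
  rw [hv, map_zero] at h2 h3 h4
  rw [map_zero, mul_zero] at h4
  have ht : toQ δ (ofRe v.1) = 0 := by
    linear_combination (-toQ δ (ofRe v.1)) * hq₀ - toQ δ (conj (curvePhase δ a w₀)) * h5
      - toQ δ (conj (curvePhase δ a w₀)) * toQ δ (curveDenom δ a (ofRe p.1)) ^ 2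
        * toQ δ (fderiv ℝ (fun p : Param => curveParam δ a w₀ (ofRe p.1)) p v) * hq
      - toQ δ (conj (curvePhase δ a w₀)) * toQ δ (curveDenom δ a (ofRe p.1)) ^ 2
        * toQ δ (curvePhase δ a (curveParam δ a w₀ (ofRe p.1))) * h4
  have ht : v.1 = 0 := ofRe_inj _ _ ((toQ_inj (ht.trans (map_zero (toQ δ)).symm)).trans
    ofRe_zero.symm)
  have hS : v.2.2 = 0 := ofRe_inj _ _ (h3.symm.trans ofRe_zero.symm)
  exact Prod.ext ht (Prod.ext h2.symm hS)

theorem IsParallelism.range_fderiv_chainParam (hP : IsParallelism δ κ μ ψ) (hδ : δ ≠ 0)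
    (hw : w₀ ∈ chainCurve δ a) (hp : p ∈ paramDom δ a) :
    Set.range (fderiv ℝ (chainParam δ a w₀) p) =
      (chainDistribution δ μ (chainParam δ a w₀ p) : Set Tot2) := by
  refine Set.Subset.antisymm ?_ ?_
  · rintro _ ⟨v, rfl⟩
    exact hP.fderiv_chainParam_mem hδ hw hp v
  · intro Y hY
    have hx : chainParam δ a w₀ p ∈ dom δ := hp.2
    set x := chainParam δ a w₀ p with hxdef
    set c := curveDenom δ a (ofRe p.1) with hc
    -- the derivative of `t` along `Y` is `2 (1 - i a conj a t) (1 + i a conj a t) h(Y)`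
    have hr : conj (mul δ (mul δ c (conj c)) (hForm δ x Y + hForm δ x Y)) =
        mul δ (mul δ c (conj c)) (hForm δ x Y + hForm δ x Y) := by
      refine toQ_inj (δ := δ) ?_
      simp only [conj_mul, conj_add, conj_conj, conj_hForm, toQ_mul, map_add]
      ring
    obtain ⟨s, hs⟩ := eq_ofRe_of_conj hr
    refine ⟨(s, dK Y, Y.2.2.2), ?_⟩
    have hX := hP.fderiv_chainParam_mem hδ hw hp (s, dK Y, Y.2.2.2)
    obtain ⟨-, h2, h3, h4, -⟩ := fderiv_chainParam hw hp (s, dK Y, Y.2.2.2)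
    have h5 := fderiv_curveParam w₀ hp (s, dK Y, Y.2.2.2)
    set X := fderiv ℝ (chainParam δ a w₀) p (s, dK Y, Y.2.2.2) with hXdef
    obtain ⟨x1, x2⟩ := (hP.mem_chainDistribution_iff hδ hx).1 hX
    obtain ⟨y1, y2⟩ := (hP.mem_chainDistribution_iff hδ hx).1 hY
    have hh : hForm δ x X = hForm δ x Y := by
      refine toQ_two_cancel (δ := δ) (h4.trans ?_)
      have hq := curvePhase_mul_conj (curveParam_mem hw hp.1)
      have hi := toQ_inv δ _ hp.1
      have e1 := toQ_curveDenom δ a (ofRe p.1)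
      have e2 := toQ_conj_curveDenom δ a p.1
      have e3 := toQ_curvePhase δ a (curveParam δ a w₀ (ofRe p.1))
      have e4 := toQ_curvePhase δ a w₀
      rw [toQ_curveParam] at e3
      rw [← hs] at h5
      rw [← hc] at e1 e2 e3 hi h5
      simp only [toQ_mul, map_add] at h5
      set j := toQ δ (inv δ c)
      set C := toQ δ c
      set C' := toQ δ (conj c)
      set q := toQ δ (curvePhase δ a (curveParam δ a w₀ (ofRe p.1)))
      set q' := toQ δ (conj (curvePhase δ a (curveParam δ a w₀ (ofRe p.1))))
      set q₀ := toQ δ (curvePhase δ a w₀)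
      set dW := toQ δ (fderiv ℝ (fun p : Param => curveParam δ a w₀ (ofRe p.1)) p (s, dK Y, Y.2.2.2))
      set N := toQ δ a * toQ δ (conj a) with hN
      set t := toQ δ (ofRe p.1)
      have hqC : q * C = q₀ * C' := by
        linear_combination C * e3 - C * e4 + q₀ * (e1 - e2) + 2 * unitI δ * N * q₀ * t * hi
      have hdW : dW = 2 * q * toQ δ (hForm δ x Y) := by
        linear_combination (-dW * (1 + C * j)) * hi + j ^ 2 * h5
          + 2 * q * toQ δ (hForm δ x Y) * (1 + C * j) * hi
          - 2 * toQ δ (hForm δ x Y) * j ^ 2 * C * hqC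
      linear_combination q' * hdW + 2 * toQ δ (hForm δ x Y) * hq
    refine vector_ext δ x X Y (by rw [x1, y1, hh]) hh h2 ?_ h3
    have hT : fderiv ℝ (slope δ) x X = fderiv ℝ (slope δ) x Y := by rw [x2, y2, hh]
    rw [(hasFDerivAt_slope δ x).2, (hasFDerivAt_slope δ x).2, h2, neg_inj, add_left_inj] at hT
    have hT := congrArg (toQ δ) hT
    rw [toQ_mul, toQ_mul, mul_comm, mul_comm (toQ δ (dT Y))] at hT
    exact toQ_mul_left_cancel (det_conj_ne hx) hT

end Tangent

theorem IsParallelism.exists_integralManifold {δ : ℝ} {κ μ ψ : Tot2 → Tot2 →L[ℝ] A}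
    (hP : IsParallelism δ κ μ ψ) (hδ : δ ≠ 0) {a w₀ : A} (hw : w₀ ∈ chainCurve δ a) {K : A}
    (hK : det δ K ≠ 0) (S : ReA) :
    ∃ L, IsConnectedIntegralManifold δ (chainDistribution δ μ) L ∧
      ∀ᶠ w in nhdsWithin w₀ (chainCurve δ a), chainPoint δ a K S w ∈ L := by
  have e : EuclideanSpace ℝ (Fin 8) ≃L[ℝ] Param := ContinuousLinearEquiv.ofFinrankEq (by simp)
  have hc : ((0, K, S) : Param) ∈ paramDom δ a := by
    refine ⟨?_, hK⟩
    rw [ofRe_zero, curveDenom, mul_zero', smul_zero, sub_zero]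
    simp [det]
  obtain ⟨U, hU, hL⟩ := exists_isConnectedIntegralManifold e (F := chainParam δ a w₀)
    (isOpen_paramDom δ a)
    (fun p hp => (contDiffAt_chainParam w₀ hp).contDiffWithinAt) (injOn_chainParam hw)
    (fun p hp => injective_fderiv_chainParam hw hp)
    (fun p hp => hP.range_fderiv_chainParam hδ hw hp) (fun p hp => hp.2) hc
  refine ⟨_, hL, ?_⟩
  -- the parameter of the point `w` is `t = v (1 + i a conj a v)⁻¹`, `v = conj q(w₀) (w - w₀)`
  set v : A → A := fun w => mul δ (conj (curvePhase δ a w₀)) (w - w₀) with hv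
  set d : A → A := fun w => (1, 0) + Complex.I • mul δ (mul δ a (conj a)) (v w) with hd
  set τ : A → A := fun w => mul δ (v w) (inv δ (d w)) with hτ
  have hv₀ : v w₀ = 0 := by
    rw [hv]
    dsimp only
    rw [sub_self, mul_zero']
  have hd₀ : d w₀ = (1, 0) := by
    rw [hd]
    dsimp only
    rw [hv₀, mul_zero', smul_zero, add_zero]
  have hvc : ContDiff ℝ ∞ v := contDiff_mul δ contDiff_const (by fun_prop)
  have hdc : ContDiff ℝ ∞ d :=
    contDiff_const.add (ContDiff.const_smul Complex.I (contDiff_mul δ contDiff_const hvc))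
  have hdet : det δ (d w₀) ≠ 0 := by
    rw [hd₀]
    simp [det]
  have hτc : ContinuousAt τ w₀ :=
    (contDiffAt_mul δ hvc.contDiffAt (contDiffAt_inv δ hdc.contDiffAt hdet)).continuousAt
  have hτ₀ : τ w₀ = 0 := by
    rw [hτ]
    dsimp only
    rw [hv₀, zero_mul']
  have hg : ContinuousAt (fun w => ((((τ w).1.re, (τ w).2.re), K, S) : Param)) w₀ :=
    ((Complex.continuous_re.continuousAt.comp hτc.fst).prodMk
      (Complex.continuous_re.continuousAt.comp hτc.snd)).prodMk continuousAt_const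
  have hg₀ : ((((τ w₀).1.re, (τ w₀).2.re), K, S) : Param) = (0, K, S) := by
    rw [hτ₀]
    rfl
  have h1 : ∀ᶠ w in nhds w₀, ((((τ w).1.re, (τ w).2.re), K, S) : Param) ∈ U := by
    refine hg.eventually_mem ?_
    rw [hg₀]
    exact hU
  have h2 : ∀ᶠ w in nhds w₀, det δ (d w) ≠ 0 := by
    have : ContinuousAt (fun w => det δ (d w)) w₀ := by
      have := hdc.continuous
      unfold det
      fun_prop
    exact this.eventually_ne hdet
  filter_upwards [nhdsWithin_le_nhds h1, nhdsWithin_le_nhds h2, self_mem_nhdsWithin] with w m1 m2 m3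
  refine ⟨_, m1, ?_⟩
  have q0 := curvePhase_mul_conj hw
  have r0 := mem_chainCurve hw
  have rw' := mem_chainCurve m3
  have i1 := toQ_inv δ _ m2
  have i2 := congrArg (fun a => toQ δ (conj a)) (mul_inv δ _ m2)
  rw [conj_mul, toQ_mul, conj_one, toQ_one] at i2
  have ev : toQ δ (v w) = toQ δ (conj (curvePhase δ a w₀)) * (toQ δ w - toQ δ w₀) := by
    rw [hv]
    simp only [toQ_mul, map_sub]
  have ev' : toQ δ (conj (v w)) = toQ δ (curvePhase δ a w₀) * (toQ δ (conj w) - toQ δ (conj w₀)) := by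
    rw [hv]
    simp only [conj_mul, conj_sub, conj_conj, toQ_mul, map_sub]
  have ed : toQ δ (d w) = 1 + unitI δ * (toQ δ a * toQ δ (conj a)) * toQ δ (v w) := by
    rw [hd]
    simp only [toQ_mul, map_add, toQ_I, toQ_one]
    ring
  have ed' : toQ δ (conj (d w)) = 1 - unitI δ * (toQ δ a * toQ δ (conj a)) * toQ δ (conj (v w)) := by
    rw [hd]
    simp only [conj_add, conj_one, conj_I, conj_mul, conj_conj, toQ_mul, map_add, map_neg, toQ_I,
      toQ_one]
    ring
  have eτ : toQ δ (τ w) = toQ δ (v w) * toQ δ (inv δ (d w)) := by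
    rw [hτ]
    simp only [toQ_mul]
  have eτ' : toQ δ (conj (τ w)) = toQ δ (conj (v w)) * toQ δ (conj (inv δ (d w))) := by
    rw [hτ]
    simp only [conj_mul, toQ_mul]
  have rv : toQ δ (v w) - toQ δ (conj (v w)) =
      2 * unitI δ * (toQ δ a * toQ δ (conj a)) * toQ δ (v w) * toQ δ (conj (v w)) := by
    have p1 := toQ_curvePhase δ a w₀
    have p2 := toQ_conj_curvePhase δ a w₀
    rw [ev, ev']
    linear_combination rw' - r0 - 2 * unitI δ * (toQ δ a * toQ δ (conj a)) * (toQ δ w - toQ δ w₀)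
      * (toQ δ (conj w) - toQ δ (conj w₀)) * q0 + (toQ δ w - toQ δ w₀) * p2
      - (toQ δ (conj w) - toQ δ (conj w₀)) * p1
  have hreal : conj (τ w) = τ w := by
    refine toQ_inj (δ := δ) ?_
    rw [eτ, eτ']
    set j := toQ δ (inv δ (d w))
    set j' := toQ δ (conj (inv δ (d w)))
    linear_combination (-toQ δ (conj (v w)) * j') * i1 + toQ δ (v w) * j * i2
      - j * j' * rv + toQ δ (conj (v w)) * j * j' * ed - toQ δ (v w) * j * j' * ed'
  have hre : ofRe ((τ w).1.re, (τ w).2.re) = τ w := by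
    obtain ⟨u, hu⟩ := eq_ofRe_of_conj hreal
    rw [hu]
    rfl
  have hden : curveDenom δ a (τ w) = inv δ (d w) := by
    refine toQ_inj (δ := δ) ?_
    rw [toQ_curveDenom, eτ]
    linear_combination -i1 + toQ δ (inv δ (d w)) * ed
  have i3 := toQ_inv δ _ (det_inv δ _ m2)
  have hcur : curveParam δ a w₀ (τ w) = w := by
    refine toQ_inj (δ := δ) ?_
    rw [toQ_curveParam, hden, eτ, ev]
    linear_combination (toQ δ w - toQ δ w₀) * q0
      + toQ δ (curvePhase δ a w₀) * toQ δ (conj (curvePhase δ a w₀)) * (toQ δ w - toQ δ w₀) * i3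
  change chainPoint δ a K S (curveParam δ a w₀ (ofRe ((τ w).1.re, (τ w).2.re))) = _
  rw [hre, hcur]

/-! ### The curves are connected -/

/-- The plane curve `Im z = r |z|²` is a line or a circle. -/
theorem isPreconnected_im_eq (r : ℝ) :
    IsPreconnected {z : ℂ | z.im = r * Complex.normSq z} := by
  by_cases hr : r = 0
  · have : {z : ℂ | z.im = r * Complex.normSq z} = Set.range ((↑) : ℝ → ℂ) := by
      ext z
      rw [hr, Set.mem_ofPred_eq, zero_mul]
      exact ⟨fun h => ⟨z.re, by apply Complex.ext <;> simp [h]⟩, by rintro ⟨x, rfl⟩; simp⟩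
    rw [this]
    exact isPreconnected_range Complex.continuous_ofReal
  · have : {z : ℂ | z.im = r * Complex.normSq z} =
        Metric.sphere (⟨0, 1 / (2 * r)⟩ : ℂ) |1 / (2 * r)| := by
      ext z
      rw [Set.mem_ofPred_eq, mem_sphere_iff_norm, ← sq_eq_sq₀ (norm_nonneg _) (abs_nonneg _),
        sq_abs, ← Complex.normSq_eq_norm_sq, Complex.normSq_apply, Complex.normSq_apply]
      simp only [Complex.sub_re, Complex.sub_im, sub_zero]
      constructor
      · intro h
        field_simp
        linear_combination (-4 * r) * h
      · intro h
        field_simp at h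
        have h2 : (4 * r) * (z.im - r * (z.re * z.re + z.im * z.im)) = 0 := by
          linear_combination -h
        have := (mul_eq_zero.1 h2).resolve_left (mul_ne_zero four_ne_zero hr)
        linarith
    rw [this]
    exact (isConnected_sphere (by simp) _ (abs_nonneg _)).isPreconnected

theorem isPreconnected_chainCurve_one (a : A) : IsPreconnected (chainCurve 1 a) := by
  have hmem : ∀ w : A, w ∈ chainCurve 1 a ↔
      (w.1 + w.2).im = Complex.normSq (a.1 + a.2) * Complex.normSq (w.1 + w.2) ∧
      (w.1 - w.2).im = Complex.normSq (a.1 - a.2) * Complex.normSq (w.1 - w.2) := by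
    intro w
    rw [chainCurve, Set.mem_ofPred_eq]
    simp only [Prod.ext_iff, Complex.ext_iff, Complex.normSq_apply]
    simp [mul, conj]
    constructor
    · rintro ⟨⟨h1, h2⟩, h3, h4⟩
      constructor
      · linear_combination (1 / 2 : ℝ) * h2 + (1 / 2 : ℝ) * h4
      · linear_combination (1 / 2 : ℝ) * h2 - (1 / 2 : ℝ) * h4
    · rintro ⟨h1, h2⟩
      refine ⟨⟨?_, ?_⟩, ?_, ?_⟩
      · ring
      · linear_combination h1 + h2
      · ring
      · linear_combination h1 - h2
  have himg : chainCurve 1 a = (fun p : ℂ × ℂ => ((p.1 + p.2) / 2, (p.1 - p.2) / 2)) ''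
      ({z : ℂ | z.im = Complex.normSq (a.1 + a.2) * Complex.normSq z} ×ˢ
        {z : ℂ | z.im = Complex.normSq (a.1 - a.2) * Complex.normSq z}) := by
    ext w
    constructor
    · intro h
      refine ⟨(w.1 + w.2, w.1 - w.2), (hmem w).1 h, ?_⟩
      ext1 <;> dsimp only <;> ring
    · rintro ⟨⟨x, y⟩, ⟨hx, hy⟩, rfl⟩
      rw [hmem]
      dsimp only
      rw [show (x + y) / 2 + (x - y) / 2 = x by ring, show (x + y) / 2 - (x - y) / 2 = y by ring]
      exact ⟨hx, hy⟩
  rw [himg]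
  refine ((isPreconnected_im_eq _).prod (isPreconnected_im_eq _)).image _ ?_
  fun_prop

theorem isPreconnected_chainCurve_neg_one (a : A) : IsPreconnected (chainCurve (-1) a) := by
  set N : A := mul (-1) a (conj a) with hN
  have hNc : conj N = N := by
    refine toQ_inj (δ := -1) ?_
    simp only [hN, conj_mul, conj_conj, toQ_mul]
    ring
  set ν : ℂ := N.1 + Complex.I * N.2 with hν
  -- the homomorphism `(a, b) ↦ a + i b` to `ℂ` turns the curve into the conic `x - y = 2 i ν x y`
  have hχ : ∀ a b : A, (mul (-1) a b).1 + Complex.I * (mul (-1) a b).2 =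
      (a.1 + Complex.I * a.2) * (b.1 + Complex.I * b.2) := by
    intro a b
    simp only [mul]
    push_cast
    linear_combination (-a.2 * b.2) * Complex.I_mul_I
  have hmem : ∀ w : A, w ∈ chainCurve (-1) a ↔
      (w.1 + Complex.I * w.2) - ((conj w).1 + Complex.I * (conj w).2) =
        2 * Complex.I * ν * (w.1 + Complex.I * w.2) * ((conj w).1 + Complex.I * (conj w).2) := by
    intro w
    have e : (mul (-1) N (mul (-1) w (conj w))).1 + Complex.I * (mul (-1) N (mul (-1) w (conj w))).2 =
        ν * ((w.1 + Complex.I * w.2) * ((conj w).1 + Complex.I * (conj w).2)) := by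
      rw [hχ N, hχ w]
    have hmc : conj (mul (-1) N (mul (-1) w (conj w))) = mul (-1) N (mul (-1) w (conj w)) := by
      refine toQ_inj (δ := -1) ?_
      simp only [conj_mul, conj_conj, hNc, toQ_mul]
      ring
    change w - conj w = Complex.I • (mul (-1) N (mul (-1) w (conj w))
      + mul (-1) N (mul (-1) w (conj w))) ↔ _
    set m := mul (-1) N (mul (-1) w (conj w)) with hm
    have c1 : starRingEnd ℂ m.1 = m.1 := congrArg Prod.fst hmc
    have c2 : starRingEnd ℂ m.2 = m.2 := congrArg Prod.snd hmc
    constructor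
    · intro h
      have h1 := congrArg Prod.fst h
      have h2 := congrArg Prod.snd h
      simp only [Prod.fst_sub, Prod.snd_sub, Prod.smul_fst, Prod.smul_snd, Prod.fst_add,
        Prod.snd_add, smul_eq_mul] at h1 h2
      linear_combination h1 + Complex.I * h2 + 2 * Complex.I * e
    · intro h
      have h1 : (w.1 - (conj w).1 - 2 * Complex.I * m.1)
          + Complex.I * (w.2 - (conj w).2 - 2 * Complex.I * m.2) = 0 := by
        linear_combination h - 2 * Complex.I * e
      have h2 := congrArg (starRingEnd ℂ) h1
      simp only [map_add, map_sub, map_mul, conj, Complex.conj_I, Complex.conj_conj, c1, c2,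
        map_ofNat, map_zero] at h1 h2
      ext1
      · simp only [Prod.fst_sub, conj, Prod.smul_fst, Prod.fst_add, smul_eq_mul]
        linear_combination (1 / 2 : ℂ) * h1 - (1 / 2 : ℂ) * h2
      · simp only [Prod.snd_sub, conj, Prod.smul_snd, Prod.snd_add, smul_eq_mul]
        linear_combination (-Complex.I / 2 : ℂ) * (h1 + h2)
          + (w.2 - starRingEnd ℂ w.2 - 2 * Complex.I * m.2) * Complex.I_mul_I
  have himg : chainCurve (-1) a = (fun y : ℂ =>
      ((y / (1 - 2 * Complex.I * ν * y) + starRingEnd ℂ y) / 2,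
        -Complex.I * (y / (1 - 2 * Complex.I * ν * y) - starRingEnd ℂ y) / 2)) ''
      {y : ℂ | 1 - 2 * Complex.I * ν * y ≠ 0} := by
    ext w
    rw [hmem]
    constructor
    · intro h
      set x := w.1 + Complex.I * w.2 with hx
      set y := (conj w).1 + Complex.I * (conj w).2 with hy
      have h1 : x * (1 - 2 * Complex.I * ν * y) = y := by linear_combination h
      have h2 : 1 - 2 * Complex.I * ν * y ≠ 0 := by
        intro h0
        rw [h0, mul_zero] at h1
        rw [← h1, mul_zero, sub_zero] at h0
        exact one_ne_zero h0
      have h3 : y / (1 - 2 * Complex.I * ν * y) = x := (eq_div_of_mul_eq h2 h1).symm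
      have h4 : starRingEnd ℂ y = w.1 - Complex.I * w.2 := by
        simp only [hy, conj, map_add, map_mul, Complex.conj_I, Complex.conj_conj]
        ring
      refine ⟨y, h2, ?_⟩
      dsimp only
      rw [h3, h4]
      ext1
      · simp only [hx]
        ring
      · simp only [hx]
        linear_combination (-w.2) * Complex.I_mul_I
    · rintro ⟨y, hy, rfl⟩
      obtain ⟨x, hx⟩ : ∃ x, x = y / (1 - 2 * Complex.I * ν * y) := ⟨_, rfl⟩
      have h1 : x * (1 - 2 * Complex.I * ν * y) = y := by
        rw [hx]
        exact div_mul_cancel₀ y hy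
      dsimp only
      rw [← hx]
      simp only [conj, map_div₀, map_add, map_sub, map_mul, map_neg, Complex.conj_I,
        Complex.conj_conj, map_ofNat]
      have e1 : (x + starRingEnd ℂ y) / 2 + Complex.I * (-Complex.I * (x - starRingEnd ℂ y) / 2)
          = x := by
        linear_combination (-(x - starRingEnd ℂ y) / 2) * Complex.I_mul_I
      have e2 : (starRingEnd ℂ x + y) / 2 + Complex.I * (- -Complex.I * (starRingEnd ℂ x - y) / 2)
          = y := by
        linear_combination ((starRingEnd ℂ x - y) / 2) * Complex.I_mul_I
      rw [e1, e2]
      linear_combination h1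
  rw [himg]
  refine IsPreconnected.image ?_ _ ?_
  · by_cases h0 : ν = 0
    · have : {y : ℂ | 1 - 2 * Complex.I * ν * y ≠ 0} = Set.univ := by
        ext y
        simp [h0]
      rw [this]
      exact isPreconnected_univ
    · have : {y : ℂ | 1 - 2 * Complex.I * ν * y ≠ 0} = {1 / (2 * Complex.I * ν)}ᶜ := by
        ext y
        have h2 : 2 * Complex.I * ν ≠ 0 := mul_ne_zero (mul_ne_zero two_ne_zero Complex.I_ne_zero) h0
        rw [Set.mem_ofPred_eq, Set.mem_compl_iff, Set.mem_singleton_iff, not_iff_not,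
          eq_div_iff h2, sub_eq_zero, mul_comm y, eq_comm]
      rw [this]
      exact (isConnected_compl_singleton_of_one_lt_rank (by simp) _).isPreconnected
  · have h1 : ContinuousOn (fun y : ℂ => y / (1 - 2 * Complex.I * ν * y))
        {y : ℂ | 1 - 2 * Complex.I * ν * y ≠ 0} :=
      ContinuousOn.div (by fun_prop) (by fun_prop) fun y hy => hy
    have h2 : ContinuousOn (fun y : ℂ => starRingEnd ℂ y)
        {y : ℂ | 1 - 2 * Complex.I * ν * y ≠ 0} := Complex.continuous_conj.continuousOn
    exact ((h1.add h2).div_const 2).prodMk ((continuousOn_const.mul (h1.sub h2)).div_const 2)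

theorem isPreconnected_chainCurve {δ : ℝ} (hδ : δ = 1 ∨ δ = -1) (a : A) :
    IsPreconnected (chainCurve δ a) := by
  rcases hδ with rfl | rfl
  · exact isPreconnected_chainCurve_one a
  · exact isPreconnected_chainCurve_neg_one a

/-! ### The leaves over the curves -/

/-- A leaf of the chain distribution that contains one of the points `chainPoint δ a K S w` contains
all of them. -/
theorem IsParallelism.chainPoint_mem_leaf {δ : ℝ} (hδ : δ = 1 ∨ δ = -1)
    {κ μ ψ : Tot2 → Tot2 →L[ℝ] A} (hP : IsParallelism δ κ μ ψ) {L : Set Tot2}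
    (hL : IsLeaf δ (chainDistribution δ μ) L) {a K : A} (hK : det δ K ≠ 0) {S : ReA} {w₀ w : A}
    (hw₀ : w₀ ∈ chainCurve δ a) (hw : w ∈ chainCurve δ a) (h : chainPoint δ a K S w₀ ∈ L) :
    chainPoint δ a K S w ∈ L := by
  have hδ0 : δ ≠ 0 := by rcases hδ with rfl | rfl <;> norm_num
  have : PreconnectedSpace (chainCurve δ a) :=
    isPreconnected_iff_preconnectedSpace.1 (isPreconnected_chainCurve hδ a)
  have hloc : IsLocallyConstant fun v : chainCurve δ a => chainPoint δ a K S v ∈ L := by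
    rw [IsLocallyConstant.iff_eventually_eq]
    intro v
    obtain ⟨L', hL', hev⟩ := hP.exists_integralManifold hδ0 v.2 hK S
    have hv := hev.self_of_nhdsWithin v.2
    have hev' : ∀ᶠ v' : chainCurve δ a in nhds v, chainPoint δ a K S v' ∈ L' :=
      (eventually_nhds_subtype_iff _ v _).2 hev
    filter_upwards [hev'] with v' hv'
    exact propext ⟨fun h => hL.2 L' hL' ⟨_, h, hv'⟩ hv, fun h => hL.2 L' hL' ⟨_, h, hv⟩ hv'⟩
  have heq := hloc.apply_eq_of_isPreconnected isPreconnected_univ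
    (x := ⟨w₀, hw₀⟩) (y := ⟨w, hw⟩) trivial trivial
  exact heq.mp h

end CRQuadric

theorem proposition3p4 (δ : ℝ) (hδ : δ = 1 ∨ δ = -1) (Γ : Set (CRQuadric.A × CRQuadric.A))
    (hΓ : CRQuadric.IsGChain δ Γ) (h0 : (0, 0) ∈ Γ) :
    ∃ M ∈ CRQuadric.algebraA δ,
      Γ = {p | p ∈ CRQuadric.quadric δ ∧ CRQuadric.mat δ p.1 = M * CRQuadric.mat δ p.2} := by
  open CRQuadric in
  obtain ⟨κ, μ, ψ, hP, L, hL, rfl⟩ := hΓ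
  obtain ⟨x₀, hx₀, he⟩ := h0
  have hδ0 : δ ≠ 0 := by rcases hδ with rfl | rfl <;> norm_num
  have hb : x₀.1 = 0 := by
    refine (embed_bijOn δ).injOn trivial trivial (he.trans ?_)
    ext1
    · rfl
    · ext1 <;> simp [embed, mul, ofRe]
  have hK : det δ x₀.2.1 ≠ 0 := by
    obtain ⟨N, _, _, _, _, _, _, ι, -, -, -, -, hd, rfl⟩ := hL.1
    obtain ⟨n, rfl⟩ := hx₀
    exact hd n
  set a : A := (1 / 2 : ℝ) • slope δ x₀ with ha
  have hmat : ∀ p : A × A, mat δ p.1 = mat δ a * mat δ p.2 ↔ p.1 = mul δ a p.2 := by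
    intro p
    rw [← mat_mul]
    refine ⟨fun h => ?_, fun h => by rw [h]⟩
    ext1
    · exact congrFun (congrFun h 0) 0
    · exact congrFun (congrFun h 1) 0
  refine ⟨mat δ a, ⟨a.1, a.2, rfl⟩, Set.Subset.antisymm ?_ ?_⟩
  · rintro _ ⟨x, hx, rfl⟩
    exact ⟨(embed_bijOn δ).mapsTo trivial, (hmat _).2 (hP.eq_mul_wCoord hδ0 hL.1 hx₀ hb hx)⟩
  · rintro ⟨z, w⟩ ⟨hq, hz⟩
    obtain rfl : z = mul δ a w := (hmat _).1 hz
    have hw : w ∈ chainCurve δ a := by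
      have him : ofRe (w.1.im, w.2.im) = mul δ (mul δ a w) (conj (mul δ a w)) := by
        ext1
        · exact hq.1
        · exact hq.2
      have h1 : w - conj w = Complex.I • (ofRe (w.1.im, w.2.im) + ofRe (w.1.im, w.2.im)) := by
        ext1 <;> apply Complex.ext <;> simp [ofRe, conj]
      rw [him] at h1
      refine h1.trans (toQ_inj (δ := δ) ?_)
      simp only [map_add, toQ_mul, toQ_I, conj_mul]
      ring
    have h00 : (0 : A) ∈ chainCurve δ a := by
      change (0 : A) - conj 0 = _
      simp only [conj_zero, mul_zero', sub_self, add_zero, smul_zero]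
    have hx : chainPoint δ a x₀.2.1 x₀.2.2.2 0 = x₀ := by
      have hT : -mul δ (mul δ (a + a) (curvePhase δ a 0)) (inv δ (conj x₀.2.1)) = x₀.2.2.1 := by
        have h1 := two_toQ_half δ (slope δ x₀)
        have h2 : toQ δ (slope δ x₀) = -(toQ δ x₀.2.2.1 * toQ δ (conj x₀.2.1)) := by
          rw [← toQ_mul, ← map_neg]
          rfl
        have h3 := toQ_inv δ _ (det_conj_ne hK)
        refine toQ_inj (δ := δ) ?_
        rw [map_neg, toQ_mul, toQ_mul, toQ_curvePhase, map_add, map_zero]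
        linear_combination (-toQ δ (inv δ (conj x₀.2.1))) * (h1 + h2) + toQ δ x₀.2.2.1 * h3
      refine Prod.ext ?_ (Prod.ext rfl (Prod.ext hT rfl))
      rw [hb]
      exact Prod.ext (mul_zero' δ a) rfl
    rw [← hx] at hx₀
    exact ⟨_, hP.chainPoint_mem_leaf hδ hL hK h00 hw hx₀, embed_chainPoint hw _ _⟩
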